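/- **Setting.** Let $X$ be a projective scheme over $\mathbb Z$ and $\mathcal L$ a line bundle on $X$, very ample over $\mathbb Z$; let $s_0,\dots,s_N\in H^0(X,\mathcal L)$ induce a closed immersion $X\to\mathbb P^N_{\mathbb Z}$. Let $Y\subset X$ be a hyperplane section with respect to $\mathcal L$, i.e. a closed subscheme whose ideal is generated by sections $t_1,\dots,t_M\in H^0(X,\mathcal L)$. Write $\mathbb V_X(\mathcal L)(\mathbb C)=\{(x,\varphi): x\in X(\mathbb C),\ \varphi\in\mathcal L_{|x}^\vee\}$ for the total space of the dual of $\mathcal L$, with its analytic topology. A *seminormed line bundle* $\overline{\mathcal L}=(\mathbb V_X(\mathcal L),T)$ is given by its tube $T=\{|\varphi|\le 1\}$: a compact subset of $\mathbb V_X(\mathcal L)(\mathbb C)$ that contains the zero section, is stable under multiplication on the fibres by complex numbers of modulus $\le1$, and is invariant under complex conjugation. The seminorm is *uniformly definite* if it is bounded below by a continuous norm on $\mathcal L$, i.e. if there is a continuous norm on the fibres of $\mathcal L^\vee$ whose unit disc bundle is contained in $T$. For a subset $K$, its holomorphically convex hull $\widehat K$ is the set of points $z$ such that $|f(z)|\le\sup_K|f|$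 for all holomorphic functions $f$ on the total space. For very ample $\mathcal L$, $\overline{\mathcal L}$ is *semipositive* if $\widehat T=T$. **Deformation.** Let $D_YX\subset\mathbb P^{N+M}_{\mathbb Z}\times\mathbb P^1_{\mathbb Z}$ be the schematic closure of the image of $$X\times\mathbb A^1\to\mathbb P^{N+M}_{\mathbb Z}\times\mathbb P^1_{\mathbb Z},\qquad (x,u)\mapsto([s_0(x):\dots:s_N(x):u\,t_1(x):\dots:u\,t_M(x)],[u:1]),$$ and let $\mathcal L'$ be the restriction of $\mathcal O(1)\boxtimes\mathcal O(1)$ to $D_YX$. The points of $\mathbb V_{D_YX}(\mathcal L')(\mathbb C)$ are the triples $([x:y],[u:t],\mu\,(x,y)\otimes(u,t))$ with $([x:y],[u:t])\in D_YX(\mathbb C)$ and $\mu\in\mathbb C$, and $\lambda\in\mathbb C^*$ acts by $$([x:y],[u:t],\mu(x,y)\otimes(u,t))\mapsto([x:\lambda y],[\lambda u:t],\mu(x,\lambda y)\otimes(\lambda u,t)).$$ Over $[u:t]=[1:1]$ one has $\mathcal L'=\mathcal L$, so that $T$ is a subset $T\times\{[1:1]\}$ of $\mathbb V_{D_YX}(\mathcal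 L')(\mathbb C)$; let $U(1)\cdot T$ be its orbit under $\{\lambda:|\lambda|=1\}$. Let $T'$ be the holomorphically convex hull of the union of $U(1)\cdot T$ and the zero section, and let $\overline{\mathcal L'}=(\mathbb V_{D_YX}(\mathcal L'),T')$. **Proposition.** If $\overline{\mathcal L}$ is semipositive and uniformly definite, then $\overline{\mathcal L'}$ is a uniformly definite seminormed line bundle on $D_YX$. Moreover $\widehat{U(1)\cdot T}$ contains an open neighbourhood of the zero section of $\mathbb V_{D_YX}(\mathcal L')(\mathbb C)$. -/

import Mathlib

open AlgebraicGeometry CategoryTheory Topology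
open scoped LinearAlgebra.Projectivization ComplexConjugate

noncomputable section

/-! ### Tubes, hulls and uniform definiteness

In this section `V` is the space of complex points of the total space of (the dual of) a line
bundle.  The scalars act fibrewise, so that `(0 : ℂ) • v` is the zero vector of the fibre
containing `v`, and `star` is the complex conjugation. -/

section Tubes

variable {V : Type*} [TopologicalSpace V] [SMul ℂ V]

/-- The data `(V, T)` of a seminormed line bundle: a compact subset `T` of the total space of the
dual line bundle which contains the zero section, is stable under fibrewise multiplication by
complex numbers of modulus at most one, and is invariant under complex conjugation.  (It is the
set of the linear forms of norm at most one on the fibres of the line bundle.) -/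
structure IsAnalyticTube [Star V] (T : Set V) : Prop where
  isCompact : IsCompact T
  zero_mem : ∀ v : V, (0 : ℂ) • v ∈ T
  smul_mem : ∀ c : ℂ, ‖c‖ ≤ 1 → ∀ v ∈ T, c • v ∈ T
  star_mem : ∀ v ∈ T, star v ∈ T

/-- A continuous norm on the line bundle, given as the dual norm on the fibres of the dual line
bundle: a continuous function on the total space which is a norm on every fibre. -/
structure IsContinuousNorm (n : V → ℝ) : Prop where
  continuous : Continuous n
  map_smul : ∀ (c : ℂ) (v : V), n (c • v) = ‖c‖ * n v
  pos : ∀ v : V, v ≠ (0 : ℂ) • v → 0 < n v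

/-- The seminorm with tube `T` is uniformly definite: it is bounded below by a continuous norm.
An inequality `|·|' ≤ |·|` between seminorms on the line bundle is the reverse inequality between
the dual norms, that is, the inclusion of the tube of `|·|'` in the tube of `|·|`. -/
def IsUniformlyDefinite (T : Set V) : Prop :=
  ∃ n : V → ℝ, IsContinuousNorm n ∧ {v | n v ≤ 1} ⊆ T

end Tubes

/-- The hull of `K` with respect to a class `𝓞` of functions: the points `v` such that
`|f v| ≤ sup_K |f|` for all `f` in `𝓞`. -/
def functionHull {V : Type*} (𝓞 : Set (V → ℂ)) (K : Set V) : Set V :=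
  {v | ∀ f ∈ 𝓞, ∀ C : ℝ, (∀ k ∈ K, ‖f k‖ ≤ C) → ‖f v‖ ≤ C}

/-! ### Complex points of a scheme and of the total space of a line bundle -/

/-- A complex point of the scheme `X`: a point `p` with a local homomorphism from the local ring
at `p` to `ℂ`; equivalently, a morphism `Spec ℂ ⟶ X`. -/
structure ComplexPoint (X : Scheme.{0}) where
  pt : X
  ev : X.presheaf.stalk pt →+* ℂ
  isLocalHom : IsLocalHom ev

namespace ComplexPoint

variable {X : Scheme.{0}}

/-- The value at `x` of a function defined on an open neighbourhood of `x`. -/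
def value (x : ComplexPoint X) {U : X.Opens} (hU : x.pt ∈ U) (a : Γ(X, U)) : ℂ :=
  x.ev (X.presheaf.germ U x.pt hU a)

/-- Complex conjugation on the complex points. -/
instance : Star (ComplexPoint X) where
  star x := ⟨x.pt, (starRingEnd ℂ).comp x.ev, by
    have h := x.isLocalHom
    refine ⟨fun a ha => h.map_nonunit a ?_⟩
    have h0 : starRingEnd ℂ (x.ev a) ≠ 0 := ha.ne_zero
    exact isUnit_iff_ne_zero.mpr fun h1 => h0 (by rw [h1, map_zero])⟩

end ComplexPoint

/-- A complex point of the total space `𝕍_X(L)` of the dual of a line bundle `L`: a complex point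
`x` of `X` together with a linear form on the fibre of `L` at `x`, that is, an additive map
`L_p → ℂ` that is linear along the evaluation `𝒪_{X,p} → ℂ` (`p` being the point of `X`
underlying `x`). -/
structure TotalSpace {X : Scheme.{0}} (L : X.Modules) where
  base : ComplexPoint X
  form : L.presheaf.stalk base.pt →+ ℂ
  map_smul : ∀ (U : X.Opens) (hU : base.pt ∈ U) (a : Γ(X, U)) (σ : Γ(L, U)),
    form (L.presheaf.germ U base.pt hU (a • σ)) =
      base.value hU a * form (L.presheaf.germ U base.pt hU σ)

namespace TotalSpace

variable {X : Scheme.{0}} {L : X.Modules}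

/-- The value `φ(σ(x))` at the point `(x, φ)` of a section `σ` of `L` defined near `x`. -/
def value (v : TotalSpace L) {U : X.Opens} (hU : v.base.pt ∈ U) (σ : Γ(L, U)) : ℂ :=
  v.form (L.presheaf.germ U v.base.pt hU σ)

instance : SMul ℂ (TotalSpace L) where
  smul c v := ⟨v.base, (AddMonoidHom.mulLeft c).comp v.form, by
    intro U hU a σ
    simp only [AddMonoidHom.comp_apply, AddMonoidHom.coe_mulLeft, v.map_smul]
    ring⟩

/-- Complex conjugation `(x, φ) ↦ (x̄, φ̄)`, where `φ̄(σ)` is the conjugate of `φ(σ)` for every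
(integral) local section `σ` of `L`. -/
instance : Star (TotalSpace L) where
  star v := ⟨star v.base, (starRingEnd ℂ : ℂ →+* ℂ).toAddMonoidHom.comp v.form, by
    intro U hU a σ
    have h := congrArg (starRingEnd ℂ) (v.map_smul U hU a σ)
    rw [map_mul] at h
    exact h⟩

/-- The analytic topology on `𝕍_X(L)(ℂ)`: the coarsest topology for which the domains of all
regular functions of the form `a` or `σ` (with `a` a local section of `𝒪_X` and `σ` a local
section of `L`, seen as a function linear on the fibres) are open and these functions are
continuous. -/
instance : TopologicalSpace (TotalSpace L) :=
  TopologicalSpace.generateFrom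
    ({S | ∃ (U : X.Opens) (a : Γ(X, U)) (W : Set ℂ), IsOpen W ∧
        S = {v | ∃ hU : v.base.pt ∈ U, v.base.value hU a ∈ W}} ∪
     {S | ∃ (U : X.Opens) (σ : Γ(L, U)) (W : Set ℂ), IsOpen W ∧
        S = {v | ∃ hU : v.base.pt ∈ U, v.value hU σ ∈ W}})

/-- The holomorphic functions on `𝕍_X(L)(ℂ)`: locally, they are holomorphic functions of finitely
many regular functions `a₁, …, a_m, σ₁, …, σ_k`, with `a_i` local sections of `𝒪_X` and `σ_i`
local sections of `L`. -/
def holomorphic (L : X.Modules) : Set (TotalSpace L → ℂ) :=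
  {f | ∀ v : TotalSpace L, ∃ (U : X.Opens) (hU : v.base.pt ∈ U) (m k : ℕ)
    (a : Fin m → Γ(X, U)) (σ : Fin k → Γ(L, U)) (G : (Fin m → ℂ) × (Fin k → ℂ) → ℂ),
    AnalyticAt ℂ G (fun i => v.base.value hU (a i), fun i => v.value hU (σ i)) ∧
    ∀ᶠ v' in 𝓝 v, ∀ hU' : v'.base.pt ∈ U,
      f v' = G (fun i => v'.base.value hU' (a i), fun i => v'.value hU' (σ i))}

end TotalSpace

/-- Semipositivity of `(𝕍_X(L), T)` for an ample line bundle `L`: the tube is holomorphically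
convex.  (The other condition in the general definition, that `𝕍_X(L)` be a modification of an
affine scheme, expresses the ampleness of `L`.) -/
def IsSemipositive {X : Scheme.{0}} {L : X.Modules} (T : Set (TotalSpace L)) : Prop :=
  functionHull (TotalSpace.holomorphic L) T = T

/-! ### Very ample line bundles and hyperplane sections -/

section LineBundles

variable {X : Scheme.{0}}

/-- Restriction of a section of a sheaf of modules to a smaller open set. -/
def restrictSection {L : X.Modules} {U V : X.Opens} (h : V ≤ U) (σ : Γ(L, U)) : Γ(L, V) :=
  L.presheaf.map (homOfLE h).op σ

/-- The section `e` of `L` on `U` is a frame: multiplication by `e` is an isomorphism from `𝒪_U`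
to `L|_U`. -/
def IsFrame (L : X.Modules) {U : X.Opens} (e : Γ(L, U)) : Prop :=
  ∀ (V : X.Opens) (h : V ≤ U), Function.Bijective fun a : Γ(X, V) => a • restrictSection h e

instance (n : Type) : GradedAlgebra (MvPolynomial.homogeneousSubmodule n ℤ) :=
  MvPolynomial.gradedAlgebra

/-- The projective space `ℙ^N` over `ℤ`. -/
abbrev projSpace (N : ℕ) : Scheme.{0} := Proj (MvPolynomial.homogeneousSubmodule (Fin (N + 1)) ℤ)

/-- The open set of `ℙ^N` where the coordinate `x_k` does not vanish. -/
def coordOpen {N : ℕ} (k : Fin (N + 1)) : (projSpace N).Opens :=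
  Proj.basicOpen (MvPolynomial.homogeneousSubmodule (Fin (N + 1)) ℤ) (MvPolynomial.X k)

/-- The function `x_l / x_k` on the open set of `ℙ^N` where `x_k` does not vanish. -/
def coordRatio {N : ℕ} (l k : Fin (N + 1)) : Γ(projSpace N, coordOpen k) :=
  Proj.awayToSection (MvPolynomial.homogeneousSubmodule (Fin (N + 1)) ℤ) (MvPolynomial.X k)
    (HomogeneousLocalization.Away.mk _ (MvPolynomial.isHomogeneous_X ℤ k) 1 (MvPolynomial.X l)
      (MvPolynomial.isHomogeneous_X ℤ l))

/-- The morphism `i : X ⟶ ℙ^N` is the one induced by the global sections `s_0, …, s_N` of `L`,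
that is, `i = [s_0 : … : s_N]`, and `L` is identified with `i^* 𝒪(1)` in such a way that `s_k` is
the pullback of `x_k`: on the preimage of `{x_k ≠ 0}` the section `s_k` is a frame of `L` and
`s_l = (x_l / x_k) s_k`.  (In particular `L` is a line bundle.) -/
structure IsInducedBy {N : ℕ} (i : X ⟶ projSpace N) (L : X.Modules)
    (s : Fin (N + 1) → Γ(L, ⊤)) : Prop where
  isFrame : ∀ k, IsFrame L (restrictSection (V := i ⁻¹ᵁ coordOpen k) le_top (s k))
  ratio : ∀ l k, restrictSection (V := i ⁻¹ᵁ coordOpen k) le_top (s l) =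
    (i.app (coordOpen k) (coordRatio l k) : Γ(X, i ⁻¹ᵁ coordOpen k)) •
      restrictSection (V := i ⁻¹ᵁ coordOpen k) le_top (s k)

/-- The closed subscheme `j : Y ⟶ X` is the hyperplane section with respect to `L` defined by the
global sections `t_1, …, t_M` of `L`: its ideal is generated by these sections.  On an affine open
set with a frame `e` this means that the ideal of `Y` is generated by the functions `t_i / e`. -/
def IsHyperplaneSection {Y : Scheme.{0}} (j : Y ⟶ X) (L : X.Modules) {M : ℕ}
    (t : Fin M → Γ(L, ⊤)) : Prop :=
  ∀ (U : X.affineOpens) (e : Γ(L, U.1)), IsFrame L e → ∀ g : Fin M → Γ(X, U.1),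
    (∀ l, restrictSection le_top (t l) = g l • e) → j.ker.ideal U = Ideal.span (Set.range g)

end LineBundles

/-! ### The total space of `𝒪(1) ⊠ 𝒪(1)` over a product of projective spaces -/

instance {n : Type} [Finite n] : TopologicalSpace (ℙ ℂ (n → ℂ)) :=
  inferInstanceAs (TopologicalSpace (Quotient (projectivizationSetoid ℂ (n → ℂ))))

/-- The complex points of the total space of the dual of `𝒪(1) ⊠ 𝒪(1)` over `ℙ(ℂ^n) × ℙ^1`: the
triples `([x], [w], μ x ⊗ w)`, where the tensor `x ⊗ w` is the matrix with entries `x_i w_j`.  It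
carries the topology induced by that of `ℙ(ℂ^n) × ℙ^1 × ℂ^(n × 2)`. -/
def SegreTotalSpace (n : Type) [Finite n] : Type :=
  {z : ℙ ℂ (n → ℂ) × ℙ ℂ (Fin 2 → ℂ) × Matrix n (Fin 2) ℂ //
    ∃ (x : n → ℂ) (hx : x ≠ 0) (w : Fin 2 → ℂ) (hw : w ≠ 0) (μ : ℂ),
      z = (Projectivization.mk ℂ x hx, Projectivization.mk ℂ w hw, μ • Matrix.vecMulVec x w)}

namespace SegreTotalSpace

variable {n : Type} [Finite n]

instance : TopologicalSpace (SegreTotalSpace n) := instTopologicalSpaceSubtype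

/-- The point `([x], [w], μ x ⊗ w)`. -/
def mk (x : n → ℂ) (hx : x ≠ 0) (w : Fin 2 → ℂ) (hw : w ≠ 0) (μ : ℂ) : SegreTotalSpace n :=
  ⟨_, x, hx, w, hw, μ, rfl⟩

/-- The projection to `ℙ(ℂ^n) × ℙ^1`. -/
def base (z : SegreTotalSpace n) : ℙ ℂ (n → ℂ) × ℙ ℂ (Fin 2 → ℂ) := (z.1.1, z.1.2.1)

instance : SMul ℂ (SegreTotalSpace n) where
  smul c z := ⟨(z.1.1, z.1.2.1, c • z.1.2.2), by
    obtain ⟨_, x, hx, w, hw, μ, rfl⟩ := z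
    exact ⟨x, hx, w, hw, c * μ, by simp [smul_smul]⟩⟩

end SegreTotalSpace

/-- Complex conjugation of vectors, as a conjugate-linear map. -/
def conjVec (n : Type) : (n → ℂ) →ₛₗ[starRingEnd ℂ] (n → ℂ) where
  toFun x := fun i => conj (x i)
  map_add' x y := by ext i; simp
  map_smul' c x := by ext i; simp

theorem conjVec_injective (n : Type) : Function.Injective (conjVec n) := by
  intro x y h
  ext i
  exact (starRingEnd ℂ).injective (congrFun h i)

/-- Complex conjugation on a projective space. -/
def conjProj {n : Type} : ℙ ℂ (n → ℂ) → ℙ ℂ (n → ℂ) :=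
  Projectivization.map (conjVec n) (conjVec_injective n)

instance {n : Type} [Finite n] : Star (SegreTotalSpace n) where
  star z := ⟨(conjProj z.1.1, conjProj z.1.2.1, z.1.2.2.map conj), by
    obtain ⟨_, x, hx, w, hw, μ, rfl⟩ := z
    refine ⟨conjVec n x, fun h => hx (conjVec_injective n (h.trans (map_zero _).symm)),
      conjVec _ w, fun h => hw (conjVec_injective _ (h.trans (map_zero _).symm)), conj μ, ?_⟩
    refine Prod.ext rfl (Prod.ext rfl ?_)
    ext i j
    simp [Matrix.vecMulVec, conjVec]⟩

/-! ### The deformation to the projective completion of the cone -/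

section Deformation

variable {X : Scheme.{0}} (L : X.Modules) {N M : ℕ} (s : Fin (N + 1) → Γ(L, ⊤))
  (t : Fin M → Γ(L, ⊤))

/-- The homogeneous coordinates of `ℙ^(N+M)`: `x_0, …, x_N` and `y_1, …, y_M`. -/
abbrev Coord (N M : ℕ) : Type := Fin (N + 1) ⊕ Fin M

/-- Integral polynomials in `x_0, …, x_N, y_1, …, y_M` and in the homogeneous coordinates `u` (of
index `0`) and `t` (of index `1`) of `ℙ^1` that are homogeneous of degree `a` in the former and
homogeneous of degree `b` in the latter variables. -/
def IsBihomogeneous (F : MvPolynomial (Coord N M ⊕ Fin 2) ℤ) (a b : ℕ) : Prop :=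
  MvPolynomial.IsWeightedHomogeneous
    (Sum.elim (fun _ => (1, 0)) (fun _ => (0, 1)) : Coord N M ⊕ Fin 2 → ℕ × ℕ) F (a, b)

/-- The form `F` vanishes on the image of the morphism
`X × 𝔸^1 → ℙ^(N+M) × ℙ^1`, `(x, u) ↦ ([s_0(x) : … : s_N(x) : u t_1(x) : … : u t_M(x)], [u : 1])`,
in the sense of schemes: if `s_k = f_k e` and `t_l = g_l e` on an open set `U` with a frame `e`
of `L`, then `F(f, u g; u, 1) = 0` in `𝒪(U)[u]`. -/
def VanishesOnImage (F : MvPolynomial (Coord N M ⊕ Fin 2) ℤ) : Prop :=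
  ∀ (U : X.Opens) (e : Γ(L, U)), IsFrame L e →
    ∀ (f : Fin (N + 1) → Γ(X, U)) (g : Fin M → Γ(X, U)),
      (∀ k, restrictSection le_top (s k) = f k • e) →
      (∀ l, restrictSection le_top (t l) = g l • e) →
      MvPolynomial.aeval
        (Sum.elim (Sum.elim (fun k => Polynomial.C (f k))
            (fun l => Polynomial.C (g l) * Polynomial.X))
          ![Polynomial.X, 1] : Coord N M ⊕ Fin 2 → Polynomial Γ(X, U)) F = 0

/-- The complex points of `D_Y X`, the deformation to the projective completion of the cone
associated to `(X, Y, L)`, where the sections `t_1, …, t_M` of `L` generate the ideal of `Y`.  The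
scheme `D_Y X` is the schematic closure in `ℙ^(N+M) × ℙ^1` (over `ℤ`) of the image of the morphism
`(x, u) ↦ ([s(x) : u t(x)], [u : 1])` on `X × 𝔸^1`, that is, the closed subscheme defined by the
bihomogeneous forms with integral coefficients that vanish on this image. -/
def deformation : Set (ℙ ℂ (Coord N M → ℂ) × ℙ ℂ (Fin 2 → ℂ)) :=
  {p | ∀ (F : MvPolynomial (Coord N M ⊕ Fin 2) ℤ) (a b : ℕ), IsBihomogeneous F a b →
    VanishesOnImage L s t F → ∀ (x : Coord N M → ℂ) (hx : x ≠ 0) (w : Fin 2 → ℂ) (hw : w ≠ 0),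
      p = (Projectivization.mk ℂ x hx, Projectivization.mk ℂ w hw) →
      MvPolynomial.aeval (Sum.elim x w) F = 0}

/-- The complex points of the total space of the dual of the line bundle `L'` on `D_Y X`, the
restriction of `𝒪(1) ⊠ 𝒪(1)` to `D_Y X`, with the topology induced by the one on the total space
over `ℙ^(N+M) × ℙ^1`. -/
def DeformationTotalSpace : Type :=
  {z : SegreTotalSpace (Coord N M) // z.base ∈ deformation L s t}

namespace DeformationTotalSpace

instance : TopologicalSpace (DeformationTotalSpace L s t) := instTopologicalSpaceSubtype

instance : SMul ℂ (DeformationTotalSpace L s t) where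
  smul c z := ⟨c • z.1, z.2⟩

instance : Star (DeformationTotalSpace L s t) where
  star z := ⟨star z.1, by
    intro F a b hF hv x hx w hw h
    have hx' : conjVec _ x ≠ 0 := fun h0 => hx (conjVec_injective _ (h0.trans (map_zero _).symm))
    have hw' : conjVec _ w ≠ 0 := fun h0 => hw (conjVec_injective _ (h0.trans (map_zero _).symm))
    have key := z.2 F a b hF hv (conjVec _ x) hx' (conjVec _ w) hw' (by
      have inv : ∀ {n : Type} (p : ℙ ℂ (n → ℂ)), conjProj (conjProj p) = p := by
        intro n p
        induction p using Projectivization.ind with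
        | h v hv =>
          simp only [conjProj, Projectivization.map_mk]
          congr 1
          ext i
          simp [conjVec]
      have h1 : conjProj z.1.1.1 = Projectivization.mk ℂ x hx := congrArg Prod.fst h
      have h2 : conjProj z.1.1.2.1 = Projectivization.mk ℂ w hw := congrArg Prod.snd h
      refine Prod.ext ?_ ?_
      · exact (inv z.1.1.1).symm.trans (congrArg conjProj h1)
      · exact (inv z.1.1.2.1).symm.trans (congrArg conjProj h2))
    have h3 : (Sum.elim (conjVec _ x) (conjVec _ w) : Coord N M ⊕ Fin 2 → ℂ) =
        fun i => conj (Sum.elim x w i) := by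
      ext i
      rcases i with i | i <;> rfl
    rw [h3] at key
    have h4 : MvPolynomial.aeval (fun i => conj (Sum.elim x w i)) F =
        conj (MvPolynomial.aeval (Sum.elim x w : Coord N M ⊕ Fin 2 → ℂ) F) := by
      have := MvPolynomial.map_aeval (R := ℤ) (Sum.elim x w : Coord N M ⊕ Fin 2 → ℂ)
        (starRingEnd ℂ) F
      rw [this, MvPolynomial.aeval_def, MvPolynomial.coe_eval₂Hom]
      congr 1
      exact RingHom.ext_int _ _
    rw [h4] at key
    exact (starRingEnd ℂ).injective (key.trans (map_zero _).symm)⟩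

/-- The holomorphic functions on `𝕍(L')(ℂ)`, a closed analytic subset of the total space over
`ℙ^(N+M) × ℙ^1`: locally, they are restrictions of holomorphic functions on the latter.  This is
expressed on homogeneous coordinates `(x, w, μ)`, with `x, w ≠ 0`, for the point
`([x], [w], μ x ⊗ w)`. -/
def holomorphic : Set (DeformationTotalSpace L s t → ℂ) :=
  {f | ∀ (x : Coord N M → ℂ) (hx : x ≠ 0) (w : Fin 2 → ℂ) (hw : w ≠ 0) (μ : ℂ),
    (SegreTotalSpace.mk x hx w hw μ).base ∈ deformation L s t →
    ∃ G : (Coord N M → ℂ) × (Fin 2 → ℂ) × ℂ → ℂ, AnalyticAt ℂ G (x, w, μ) ∧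
      ∀ᶠ q in 𝓝 (x, w, μ), ∀ (hx' : q.1 ≠ 0) (hw' : q.2.1 ≠ 0)
        (h : (SegreTotalSpace.mk q.1 hx' q.2.1 hw' q.2.2).base ∈ deformation L s t),
        f ⟨SegreTotalSpace.mk q.1 hx' q.2.1 hw' q.2.2, h⟩ = G q}

end DeformationTotalSpace

variable {L}

/-- The vector `(φ(s_0), …, φ(s_N), φ(t_1), …, φ(t_M))` attached to the point `v = (x, φ)` of the
total space over `X`. -/
def coordVec (v : TotalSpace L) : Coord N M → ℂ :=
  Sum.elim (fun k => v.value (U := ⊤) trivial (s k)) (fun l => v.value (U := ⊤) trivial (t l))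

theorem pair_one_ne_zero : (![1, 1] : Fin 2 → ℂ) ≠ 0 := fun h =>
  one_ne_zero (α := ℂ) (congrFun h 0)

/-- The image of `T × {[1 : 1]}` under the identification of `𝕍(L')` over the fibre `u = 1` with
`𝕍_X(L)`: the point `(x, φ)` is sent to
`([s(x) : t(x)], [1 : 1], (φ(s), φ(t)) ⊗ (1, 1))`.  The homogeneous coordinates of
`[s(x) : t(x)]` are given by any nonzero linear form `ψ` on the fibre of `L` at `x`. -/
def fibreOne (T : Set (TotalSpace L)) : Set (DeformationTotalSpace L s t) :=
  {z | ∃ v ∈ T, ∃ ψ : TotalSpace L, ψ.base = v.base ∧ ∃ hψ : coordVec s t ψ ≠ 0,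
    z.1.1 = (Projectivization.mk ℂ (coordVec s t ψ) hψ,
      Projectivization.mk ℂ ![1, 1] pair_one_ne_zero,
      Matrix.vecMulVec (coordVec s t v) ![1, 1])}

/-- The points `z'` and `z` of `𝕍(L')` satisfy `z' = c · z` for the natural transverse action of
`𝔾_m`, which sends `([x : y], [u : t], μ (x, y) ⊗ (u, t))` to
`([x : c y], [c u : t], μ (x, c y) ⊗ (c u, t))`. -/
def IsTransverseTranslate (c : ℂ) (z z' : DeformationTotalSpace L s t) : Prop :=
  ∃ (x : Fin (N + 1) → ℂ) (y : Fin M → ℂ) (w : Fin 2 → ℂ) (μ : ℂ)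
    (hx : (Sum.elim x y : Coord N M → ℂ) ≠ 0) (hw : w ≠ 0)
    (hx' : (Sum.elim x (c • y) : Coord N M → ℂ) ≠ 0)
    (hw' : (![c * w 0, w 1] : Fin 2 → ℂ) ≠ 0),
    z.1 = SegreTotalSpace.mk (Sum.elim x y) hx w hw μ ∧
    z'.1 = SegreTotalSpace.mk (Sum.elim x (c • y)) hx' ![c * w 0, w 1] hw' μ

/-- The orbit of `T × {[1 : 1]}` under the group `U(1)` of complex numbers of modulus one, acting
by the natural transverse action. -/
def unitOrbit (T : Set (TotalSpace L)) : Set (DeformationTotalSpace L s t) :=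
  {z' | ∃ c : ℂ, ‖c‖ = 1 ∧ ∃ z ∈ fibreOne s t T, IsTransverseTranslate s t c z z'}

/-- The tube `T'` of the deformation: the holomorphically convex hull of the union of the zero
section and of the `U(1)`-orbit of `T × {[1 : 1]}`. -/
def deformedTube (T : Set (TotalSpace L)) : Set (DeformationTotalSpace L s t) :=
  functionHull (DeformationTotalSpace.holomorphic L s t)
    (Set.range (fun z : DeformationTotalSpace L s t => (0 : ℂ) • z) ∪ unitOrbit s t T)

end Deformation

end

/-!
Let `F` be a holomorphic function on the total space `𝕍(L')(ℂ)` of the deformation that is bounded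
by `C` on the orbit `U(1) · T`.  Everything rests on the estimate `|F| ≤ C` at all points
`([x], [w], μ x ⊗ w)` for which `|μ| ‖x‖ ‖w‖` is smaller than a constant `δ` independent of `F`
(`exists_mem_functionHull_unitOrbit`).  It says that the hull of the orbit contains the
neighbourhood `{|μ| ‖x‖ ‖w‖ < δ}` of the zero section, hence the unit disc bundle of a multiple of
the continuous norm `|μ| ‖x‖ ‖w‖`.  That the hull `T'` is the tube of a seminormed line bundle is
formal (`isAnalyticTube_deformedTube`): the entries of the tensor `μ x ⊗ w` are holomorphic and
bounded on the orbit, so that `T'` is bounded; it is closed, and it inherits the symmetries of the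
orbit.

For the estimate, take `μ = 1` by absorbing it into `x`.  The pairs `(x, w)` form an affine cone,
a finite union of irreducible varieties, the zero loci of primes `Q` stable under rescaling of `x`
and `w` (`exists_coneComponents`).  These primes come from minimal primes over `ℤ`, on which `u`
is not a zero divisor, and therefore the generic points of a component are of the form
`(w₁ φ(s), w₀ φ(t), w)` with a point `φ` of `𝕍_X(L)(ℂ)` (`IsConeComponent.exists_totalSpace`).  By
uniform definiteness, `φ` is in `T` as soon as `φ(s)` is small.  The maximum principle on the disc
`|w₀| ≤ 1`, `w₁ = 1`, and on the disc `|w₁| ≤ 1`, `w₀ = 1`, the boundaries of which are in the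
orbit, gives the estimate where `‖x‖` is small compared with `|w₁|`, hence, by homogeneity, in
every region `|w₁| ≥ r |w₀|` with a constant `δ` depending on `r` (`norm_coordLift_le`,
`IsConeComponent.norm_coordLift_le_of_le`).

Near `w₁ = 0` the vector `φ` is not controlled by `x`.  Instead, choose a minimal number of linear
forms `α` in `x` without common nontrivial zero on the part `w₁ = 0` of the component.  By
minimality `w₀, w₁, α` are algebraically independent on the component, and they can be completed
to a transcendence basis (`IsConeComponent.exists_transcendenceBasis`).  Fixing all functions of
the basis other than `w₁` gives a curve, on which `x` stays bounded for `|w₁| ≤ r |w₀|`.  Outside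
of finitely many values of `w₁` the curve is locally parametrized by `w₁`, by the implicit
function theorem (`exists_analytic_section`), so that the maximum principle bounds `F` on the
curve by its maximum on `|w₁| = r |w₀|` (`norm_le_of_norm_le_boundary`), where the estimate is
already known.  This applies to the curves through generic points, which are dense in the
component for the analytic topology (`mem_closure_zeroLocus_aeval_ne_zero`).
-/

noncomputable section

/-! ### Values of homogeneous polynomials -/

/-- Behaviour of the values of a weighted homogeneous polynomial under rescaling of the variables:
the factors are the values of a character `χ` of the group of weights. -/
theorem MvPolynomial.IsWeightedHomogeneous.aeval_mul {σ R S Λ : Type*} [CommSemiring R]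
    [CommSemiring S] [Algebra R S] [AddCommMonoid Λ] {wt : σ → Λ} {F : MvPolynomial σ R} {n : Λ}
    (hF : F.IsWeightedHomogeneous wt n) (χ : Multiplicative Λ →* S) (v : σ → S) :
    MvPolynomial.aeval (fun i => χ (.ofAdd (wt i)) * v i) F =
      χ (.ofAdd n) * MvPolynomial.aeval v F := by
  rw [F.as_sum, map_sum, map_sum, Finset.mul_sum]
  refine Finset.sum_congr rfl fun d hd => ?_
  have h := hF (MvPolynomial.mem_support_iff.mp hd)
  rw [MvPolynomial.aeval_monomial, MvPolynomial.aeval_monomial, ← h, Finsupp.prod, Finsupp.prod]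
  simp only [mul_pow, Finset.prod_mul_distrib]
  have : χ (.ofAdd (Finsupp.weight wt d)) = ∏ i ∈ d.support, χ (.ofAdd (wt i)) ^ d i := by
    rw [Finsupp.weight_apply, Finsupp.sum, ofAdd_sum, map_prod]
    exact Finset.prod_congr rfl fun i _ => by rw [ofAdd_nsmul, map_pow]
  rw [this]; ring

theorem MvPolynomial.IsHomogeneous.aeval_mul {σ R S : Type*} [CommSemiring R]
    [CommSemiring S] [Algebra R S] {F : MvPolynomial σ R} {n : ℕ}
    (hF : F.IsHomogeneous n) (c : S) (v : σ → S) :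
    MvPolynomial.aeval (fun i => c * v i) F = c ^ n * MvPolynomial.aeval v F := by
  simpa [powersHom_apply] using
    MvPolynomial.IsWeightedHomogeneous.aeval_mul hF (powersHom S c) v

theorem IsBihomogeneous.aeval_mul {N M : ℕ} {S : Type*} [CommRing S] [Algebra ℤ S]
    {F : MvPolynomial (Coord N M ⊕ Fin 2) ℤ} {a b : ℕ} (hF : IsBihomogeneous F a b) (c d : S)
    (x : Coord N M → S) (w : Fin 2 → S) :
    MvPolynomial.aeval (Sum.elim (fun i => c * x i) (fun i => d * w i)) F =
      c ^ a * d ^ b * MvPolynomial.aeval (Sum.elim x w) F := by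
  have := MvPolynomial.IsWeightedHomogeneous.aeval_mul hF
    (((powersHom S c).comp (AddMonoidHom.fst ℕ ℕ).toMultiplicative) *
      ((powersHom S d).comp (AddMonoidHom.snd ℕ ℕ).toMultiplicative)) (Sum.elim x w)
  convert this using 2
  · congr 1
    ext i
    rcases i with i | i <;> simp [powersHom_apply]
  · simp [powersHom_apply]

theorem map_aeval_int {σ S S' : Type*} [CommRing S] [CommRing S']
    [Algebra ℤ S] [Algebra ℤ S'] (φ : S →+* S') (v : σ → S)
    (G : MvPolynomial σ ℤ) :
    φ (MvPolynomial.aeval v G) = MvPolynomial.aeval (fun i => φ (v i)) G := by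
  rw [MvPolynomial.map_aeval, MvPolynomial.aeval_def, MvPolynomial.coe_eval₂Hom]
  congr 1
  exact RingHom.ext_int _ _

/-! ### Charts of a scheme embedded in projective space -/

/-- The functions on `{x_k ≠ 0}` are the integral polynomials in the ratios `x_l / x_k`. -/
theorem exists_aeval_coordRatio {N : ℕ} (k : Fin (N + 1)) (a : Γ(projSpace N, coordOpen k)) :
    ∃ G : MvPolynomial (Fin (N + 1)) ℤ, MvPolynomial.aeval (fun l => coordRatio l k) G = a := by
  let 𝒜 := MvPolynomial.homogeneousSubmodule (Fin (N + 1)) ℤ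
  let e := Proj.basicOpenIsoAway 𝒜 (MvPolynomial.X k) (MvPolynomial.isHomogeneous_X ℤ k) one_pos
  obtain ⟨b, hb⟩ : ∃ b, Proj.awayToSection 𝒜 (MvPolynomial.X k) b = a :=
    ⟨e.inv a, congr($(e.inv_hom_id) a)⟩
  obtain ⟨n, x, hx, rfl⟩ := HomogeneousLocalization.Away.mk_surjective 𝒜
    (MvPolynomial.isHomogeneous_X ℤ k) b
  refine ⟨x, ?_⟩
  rw [← hb]
  have hx' : x.IsHomogeneous n := by rwa [smul_eq_mul, mul_one] at hx
  have h1 : MvPolynomial.aeval (fun l => coordRatio l k) x =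
      (Proj.awayToSection 𝒜 (MvPolynomial.X k)).hom (MvPolynomial.aeval (fun l =>
        (HomogeneousLocalization.Away.mk 𝒜 (MvPolynomial.isHomogeneous_X ℤ k) 1
          (MvPolynomial.X l) (MvPolynomial.isHomogeneous_X ℤ l) :
          HomogeneousLocalization.Away 𝒜 (MvPolynomial.X k))) x) :=
    (map_aeval_int _ _ _).symm
  rw [h1]
  refine congrArg (Proj.awayToSection 𝒜 (MvPolynomial.X k)).hom ?_
  -- the identity is checked in the localization `S` of the polynomial ring at `x_k`
  apply HomogeneousLocalization.val_injective
  refine Eq.trans ?_ (HomogeneousLocalization.Away.val_mk _ n _ x hx).symm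
  refine (map_aeval_int (algebraMap (HomogeneousLocalization.Away 𝒜 (MvPolynomial.X k))
    (Localization.Away (MvPolynomial.X k : MvPolynomial (Fin (N + 1)) ℤ))) _ x).trans ?_
  refine (congrArg (fun v : Fin (N + 1) → Localization.Away
    (MvPolynomial.X k : MvPolynomial (Fin (N + 1)) ℤ) => MvPolynomial.aeval (R := ℤ) v x)
    (funext fun l => HomogeneousLocalization.Away.val_mk 𝒜 1
      (MvPolynomial.isHomogeneous_X ℤ k) (MvPolynomial.X l)
      (MvPolynomial.isHomogeneous_X ℤ l))).trans ?_
  let P := MvPolynomial (Fin (N + 1)) ℤ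
  let S := Localization.Away (MvPolynomial.X k : P)
  let ι : S := IsLocalization.Away.invSelf (MvPolynomial.X k : P)
  have hι : algebraMap P S (MvPolynomial.X k) * ι = 1 := IsLocalization.Away.mul_invSelf _
  have hu : ∀ (p : P) (m : ℕ), (Localization.mk p (⟨MvPolynomial.X k ^ m, m, rfl⟩ :
      Submonoid.powers (MvPolynomial.X k : P)) : S) = ι ^ m * algebraMap P S p := by
    intro p m
    rw [Localization.mk_eq_mk', IsLocalization.mk'_eq_iff_eq_mul, map_pow]
    have h2 : algebraMap P S (MvPolynomial.X k) ^ m * ι ^ m = 1 := by rw [← mul_pow, hι, one_pow]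
    linear_combination (-(algebraMap P S p)) * h2
  refine Eq.trans ?_ (hu x n).symm
  refine (congrArg (fun v : Fin (N + 1) → S => MvPolynomial.aeval (R := ℤ) v x) (funext fun l =>
    (hu (MvPolynomial.X l) 1).trans (by rw [pow_one]))).trans ?_
  rw [hx'.aeval_mul, ← map_aeval_int]
  congr 2
  exact MvPolynomial.aeval_X_left_apply x

/-- The affine open set `U` is a chart on which `s_k` is a frame of `L`.  On it `s_l = f_l s_k` and
`t_l = g_l s_k`, and the functions `f_l` generate the ring of functions on `U`. -/
structure IsCoordChart {X : Scheme.{0}} {L : X.Modules} {N M : ℕ} (s : Fin (N + 1) → Γ(L, ⊤))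
    (t : Fin M → Γ(L, ⊤)) (k : Fin (N + 1)) (U : X.Opens) (f : Fin (N + 1) → Γ(X, U))
    (g : Fin M → Γ(X, U)) : Prop where
  isAffineOpen : IsAffineOpen U
  isFrame : IsFrame L (restrictSection (V := U) le_top (s k))
  s_eq : ∀ l, restrictSection (V := U) le_top (s l) = f l • restrictSection le_top (s k)
  t_eq : ∀ l, restrictSection (V := U) le_top (t l) = g l • restrictSection le_top (s k)
  f_self : f k = 1
  generate : ∀ a, ∃ G : MvPolynomial (Fin (N + 1)) ℤ, MvPolynomial.aeval f G = a

section Charts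

variable {X : Scheme.{0}} {L : X.Modules}

theorem restrictSection_rfl {U : X.Opens} (h : U ≤ U) (σ : Γ(L, U)) : restrictSection h σ = σ := by
  simp [restrictSection]

theorem restrictSection_trans {U V W : X.Opens} (h : V ≤ U) (h' : W ≤ V) (σ : Γ(L, U)) :
    restrictSection h' (restrictSection h σ) = restrictSection (h'.trans h) σ := by
  simp only [restrictSection]
  rw [← ConcreteCategory.comp_apply, ← Functor.map_comp]
  rfl

theorem restrictSection_smul {U V : X.Opens} (h : V ≤ U) (a : Γ(X, U)) (σ : Γ(L, U)) :
    restrictSection h (a • σ) = X.presheaf.map (homOfLE h).op a • restrictSection h σ :=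
  Scheme.Modules.map_smul L _ _ _

theorem germ_restrictSection {U V : X.Opens} (h : V ≤ U) (x : X) (hx : x ∈ V) (σ : Γ(L, U)) :
    L.presheaf.germ V x hx (restrictSection h σ) = L.presheaf.germ U x (h hx) σ :=
  TopCat.Presheaf.germ_res_apply L.presheaf _ _ hx _

theorem IsFrame.injective {U V : X.Opens} {e : Γ(L, U)} (he : IsFrame L e) (h : V ≤ U)
    {a b : Γ(X, V)} (hab : a • restrictSection h e = b • restrictSection h e) : a = b :=
  (he V h).1 hab

theorem exists_isCoordChart {N M : ℕ} {s : Fin (N + 1) → Γ(L, ⊤)} {i : X ⟶ projSpace N}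
    (hi : IsClosedImmersion i) (his : IsInducedBy i L s) (t : Fin M → Γ(L, ⊤)) (k : Fin (N + 1)) :
    ∃ f g, IsCoordChart s t k (i ⁻¹ᵁ coordOpen k) f g := by
  have hP : IsAffineOpen (coordOpen k) :=
    Proj.isAffineOpen_basicOpen _ _ (MvPolynomial.isHomogeneous_X ℤ k) one_pos
  have hfr := his.isFrame k
  choose g hg using fun l => (hfr _ le_rfl).2 (restrictSection le_top (t l))
  refine ⟨fun l => i.app (coordOpen k) (coordRatio l k), g, hP.preimage i, hfr,
    fun l => his.ratio l k, fun l => ?_, ?_, fun a => ?_⟩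
  · rw [← hg l]
    simp only [restrictSection_rfl]
  · refine hfr.injective le_rfl ?_
    rw [restrictSection_rfl, one_smul]
    exact (his.ratio k k).symm
  · obtain ⟨b, rfl⟩ := i.app_surjective _ hP a
    obtain ⟨G, rfl⟩ := exists_aeval_coordRatio k b
    exact ⟨G, (map_aeval_int (i.app (coordOpen k)).hom _ G).symm⟩

theorem exists_mem_chart {N : ℕ} (i : X ⟶ projSpace N) (x : X) : ∃ k, x ∈ i ⁻¹ᵁ coordOpen k := by
  have h : ⨆ k, coordOpen (N := N) k = ⊤ := by
    refine Proj.iSup_basicOpen_eq_top' _ _ (fun k => ⟨1, MvPolynomial.isHomogeneous_X ℤ k⟩) ?_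
    rw [eq_top_iff]
    intro p _
    induction p using MvPolynomial.induction_on with
    | C a =>
      exact Subalgebra.algebraMap_mem (Algebra.adjoin _ _)
        (⟨MvPolynomial.C a, MvPolynomial.isHomogeneous_C _ _⟩ :
          MvPolynomial.homogeneousSubmodule (Fin (N + 1)) ℤ 0)
    | add p q hp hq => exact add_mem (hp trivial) (hq trivial)
    | mul_X p l hp => exact mul_mem (hp trivial) (Algebra.subset_adjoin ⟨l, rfl⟩)
  have hx : i x ∈ ⨆ k, coordOpen (N := N) k := h.ge trivial
  obtain ⟨k, hk⟩ := TopologicalSpace.Opens.mem_iSup.mp hx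
  exact ⟨k, hk⟩

/-- The vanishing of a bihomogeneous form on the image of `X × 𝔸^1` may be checked with the frames
`s_k` on charts covering `X`: two frames differ by a unit, by which the form rescales. -/
theorem vanishesOnImage_of_forall_chart {N M : ℕ} {s : Fin (N + 1) → Γ(L, ⊤)}
    {t : Fin M → Γ(L, ⊤)} {U : Fin (N + 1) → X.Opens} (hU : ∀ x, ∃ k, x ∈ U k)
    {f : ∀ k, Fin (N + 1) → Γ(X, U k)} {g : ∀ k, Fin M → Γ(X, U k)}
    (hc : ∀ k, IsCoordChart s t k (U k) (f k) (g k)) {F : MvPolynomial (Coord N M ⊕ Fin 2) ℤ}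
    {a b : ℕ} (hF : IsBihomogeneous F a b)
    (h : ∀ k, MvPolynomial.aeval (Sum.elim (Sum.elim (fun l => Polynomial.C (f k l))
      (fun l => Polynomial.C (g k l) * Polynomial.X)) ![Polynomial.X, 1]) F = 0) :
    VanishesOnImage L s t F := by
  intro V e he f' g' hf' hg'
  ext n
  rw [Polynomial.coeff_zero]
  refine X.sheaf.eq_of_locally_eq' (fun k => V ⊓ U k) V (fun k => homOfLE inf_le_left)
    (fun x hx => ?_) _ _ fun k => ?_
  · obtain ⟨k, hk⟩ := hU x
    exact TopologicalSpace.Opens.mem_iSup.mpr ⟨k, hx, hk⟩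
  set ρ := (X.presheaf.map (homOfLE (inf_le_left : V ⊓ U k ≤ V)).op).hom with hρ
  set κ := (X.presheaf.map (homOfLE (inf_le_right : V ⊓ U k ≤ U k)).op).hom with hκ
  change ρ _ = ρ 0
  rw [map_zero, ← Polynomial.coeff_map, ← Polynomial.coe_mapRingHom, map_aeval_int]
  have hs : ∀ l, restrictSection (V := V ⊓ U k) le_top (s l) =
      ρ (f' l) • restrictSection inf_le_left e := fun l => by
    rw [← restrictSection_trans le_top inf_le_left, hf', restrictSection_smul]
  have ht : ∀ l, restrictSection (V := V ⊓ U k) le_top (t l) =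
      ρ (g' l) • restrictSection inf_le_left e := fun l => by
    rw [← restrictSection_trans le_top inf_le_left, hg', restrictSection_smul]
  have hfk : ∀ l, ρ (f' l) = ρ (f' k) * κ (f k l) := fun l => by
    refine he.injective inf_le_left ?_
    rw [← hs, mul_comm, mul_smul, ← hs, ← restrictSection_trans le_top inf_le_right, (hc k).s_eq,
      restrictSection_smul, restrictSection_trans]
  have hgk : ∀ l, ρ (g' l) = ρ (f' k) * κ (g k l) := fun l => by
    refine he.injective inf_le_left ?_
    rw [← ht, mul_comm, mul_smul, ← hs, ← restrictSection_trans le_top inf_le_right, (hc k).t_eq,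
      restrictSection_smul, restrictSection_trans]
  have key := hF.aeval_mul (Polynomial.C (ρ (f' k))) 1 (fun i => Polynomial.mapRingHom κ
    (Sum.elim (fun l => Polynomial.C (f k l)) (fun l => Polynomial.C (g k l) * Polynomial.X) i))
    (fun i => Polynomial.mapRingHom κ ((![Polynomial.X, 1] : Fin 2 → Polynomial Γ(X, U k)) i))
  have h0 := congrArg (Polynomial.mapRingHom κ) (h k)
  rw [map_aeval_int, map_zero] at h0
  have h1 : (fun i => Polynomial.mapRingHom κ (Sum.elim (Sum.elim (fun l => Polynomial.C (f k l))
      (fun l => Polynomial.C (g k l) * Polynomial.X)) ![Polynomial.X, 1] i)) =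
      Sum.elim (fun i => Polynomial.mapRingHom κ
        (Sum.elim (fun l => Polynomial.C (f k l)) (fun l => Polynomial.C (g k l) * Polynomial.X) i))
      (fun i => Polynomial.mapRingHom κ
        ((![Polynomial.X, 1] : Fin 2 → Polynomial Γ(X, U k)) i)) := by
    ext1 i; rcases i with i | i <;> rfl
  rw [← h1, h0, mul_zero] at key
  convert Polynomial.coeff_zero n using 2
  rw [← key]
  congr 2
  ext1 i
  rcases i with (i | i) | i
  · simp [hfk i]
  · simp [hgk i, mul_assoc]
  · fin_cases i <;> simp

/-! ### Complex points of the total space -/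

theorem TotalSpace.value_of_smul {U : X.Opens} (v : TotalSpace L) (hv : v.base.pt ∈ U)
    {σ : Γ(L, ⊤)} {a : Γ(X, U)} {e : Γ(L, U)} (h : restrictSection le_top σ = a • e) :
    v.value (U := ⊤) trivial σ = v.base.value hv a * v.value hv e := by
  refine (congrArg v.form (germ_restrictSection le_top _ hv σ)).symm.trans ?_
  rw [h]
  exact v.map_smul U hv a e

theorem TotalSpace.value_restrict {U : X.Opens} (v : TotalSpace L) (hv : v.base.pt ∈ U)
    (σ : Γ(L, ⊤)) :
    v.value hv (restrictSection le_top σ) = v.value (U := ⊤) trivial σ :=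
  congrArg v.form (germ_restrictSection le_top _ hv σ)

/-- A linear form on a fibre that vanishes at a frame is zero. -/
theorem TotalSpace.eq_zero_smul {U : X.Opens} (v : TotalSpace L) (hv : v.base.pt ∈ U)
    {e : Γ(L, U)} (he : IsFrame L e) (h : v.value hv e = 0) : v = (0 : ℂ) • v := by
  have key : v.form = (AddMonoidHom.mulLeft 0).comp v.form := by
    ext ℓ
    obtain ⟨W, hW, σ, rfl⟩ := L.presheaf.exists_germ_eq ℓ
    have hmem : v.base.pt ∈ W ⊓ U := ⟨hW, hv⟩
    obtain ⟨a, ha⟩ := (he (W ⊓ U) inf_le_right).2 (restrictSection inf_le_left σ)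
    have h1 : v.form (L.presheaf.germ W v.base.pt hW σ) = 0 := by
      rw [← germ_restrictSection (inf_le_left : W ⊓ U ≤ W) _ hmem, ← ha]
      dsimp only
      rw [v.map_smul _ hmem, germ_restrictSection (inf_le_right : W ⊓ U ≤ U) _ hmem]
      exact mul_eq_zero_of_right _ h
    simpa using h1
  cases v
  exact (TotalSpace.mk.injEq ..).mpr ⟨rfl, heq_of_eq key⟩

/-- A homomorphism from the ring of functions on an affine open set to `ℂ` is a complex point. -/
theorem ComplexPoint.exists_value_eq {U : X.Opens} (hU : IsAffineOpen U) (χ : Γ(X, U) →+* ℂ) :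
    ∃ (x : ComplexPoint X) (hx : x.pt ∈ U), ∀ a, x.value hx a = χ a := by
  let p : PrimeSpectrum Γ(X, U) := ⟨RingHom.ker χ, RingHom.ker_isPrime χ⟩
  let y : U := ⟨hU.fromSpec p, by
    have := hU.range_fromSpec
    exact this.le ⟨p, rfl⟩⟩
  let _ : Algebra Γ(X, U) (X.presheaf.stalk y.1) :=
    TopCat.Presheaf.algebra_section_stalk X.presheaf y
  have hp : p.asIdeal.IsPrime := p.isPrime
  have hloc : IsLocalization.AtPrime (X.presheaf.stalk y.1) p.asIdeal :=
    hU.isLocalization_stalk' p y.2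
  have hunit : ∀ a : p.asIdeal.primeCompl, IsUnit (χ a) := fun a =>
    isUnit_iff_ne_zero.mpr fun h => a.2 h
  let ev : X.presheaf.stalk y.1 →+* ℂ := IsLocalization.lift hunit
  have hev : ∀ a, ev (algebraMap Γ(X, U) (X.presheaf.stalk y.1) a) = χ a := fun a =>
    IsLocalization.lift_eq hunit a
  refine ⟨⟨y.1, ev, ⟨fun a ha => ?_⟩⟩, y.2, hev⟩
  obtain ⟨b, c, rfl⟩ := IsLocalization.exists_mk'_eq p.asIdeal.primeCompl a
  rw [IsLocalization.mk'_eq_mul_mk'_one] at ha ⊢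
  have hb : IsUnit (algebraMap Γ(X, U) (X.presheaf.stalk y.1) b) := by
    refine IsLocalization.map_units _ (⟨b, fun hb => ?_⟩ : p.asIdeal.primeCompl)
    rw [map_mul, hev, show χ b = 0 from hb, zero_mul] at ha
    exact not_isUnit_zero ha
  refine hb.mul ?_
  exact IsUnit.of_mul_eq_one (algebraMap _ _ c.1) (by
    rw [IsLocalization.mk'_spec, map_one])

/-- On the fibre of `L` at `x` there is a linear form with a prescribed value at a frame `e`. -/
theorem TotalSpace.exists_value_eq {U : X.Opens} {e : Γ(L, U)} (he : IsFrame L e)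
    (x : ComplexPoint X) (hx : x.pt ∈ U) (E : ℂ) :
    ∃ v : TotalSpace L, ∃ h : v.base = x, v.value (U := U) (h ▸ hx) e = E := by
  have ex : ∀ ℓ : L.presheaf.stalk x.pt, ∃ (W : X.Opens) (hW : W ≤ U) (hxW : x.pt ∈ W)
      (a : Γ(X, W)), L.presheaf.germ W x.pt hxW (a • restrictSection hW e) = ℓ := by
    intro ℓ
    obtain ⟨W, hW, σ, rfl⟩ := L.presheaf.exists_germ_eq ℓ
    obtain ⟨a, ha⟩ := (he (W ⊓ U) inf_le_right).2 (restrictSection inf_le_left σ)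
    refine ⟨W ⊓ U, inf_le_right, ⟨hW, hx⟩, a, ?_⟩
    rw [← germ_restrictSection (inf_le_left : W ⊓ U ≤ W) _ ⟨hW, hx⟩, ← ha]
  -- the coefficient of a germ with respect to `e` has a well-defined value at `x`
  have uniq : ∀ (W W' : X.Opens) (hW : W ≤ U) (hW' : W' ≤ U) (hxW : x.pt ∈ W) (hxW' : x.pt ∈ W')
      (a : Γ(X, W)) (a' : Γ(X, W')), L.presheaf.germ W x.pt hxW (a • restrictSection hW e) =
        L.presheaf.germ W' x.pt hxW' (a' • restrictSection hW' e) →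
      x.value hxW a = x.value hxW' a' := by
    intro W W' hW hW' hxW hxW' a a' h
    obtain ⟨W'', hx'', i, i', h'⟩ := L.presheaf.germ_eq _ _ _ _ _ h
    change restrictSection i.le _ = restrictSection i'.le _ at h'
    rw [restrictSection_smul, restrictSection_smul, restrictSection_trans,
      restrictSection_trans] at h'
    have h2 := he.injective _ h'
    have h3 := congrArg (fun b => x.ev (X.presheaf.germ W'' x.pt hx'' b)) h2
    dsimp only at h3
    rw [X.presheaf.germ_res_apply, X.presheaf.germ_res_apply] at h3
    exact h3
  choose W hW hxW a ha using ex
  have spec : ∀ (V : X.Opens) (hV : V ≤ U) (hxV : x.pt ∈ V) (b : Γ(X, V)),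
      x.value (hxW (L.presheaf.germ V x.pt hxV (b • restrictSection hV e)))
        (a (L.presheaf.germ V x.pt hxV (b • restrictSection hV e))) = x.value hxV b :=
    fun V hV hxV b => uniq _ _ (hW _) hV _ hxV _ _ (ha _)
  have rep : ∀ (V : X.Opens) (hxV : x.pt ∈ V) (σ : Γ(L, V)), ∃ b : Γ(X, V ⊓ U),
      b • restrictSection inf_le_right e = restrictSection inf_le_left σ := fun V hxV σ =>
    (he (V ⊓ U) inf_le_right).2 (restrictSection inf_le_left σ)
  let φ : L.presheaf.stalk x.pt → ℂ := fun ℓ => x.value (hxW ℓ) (a ℓ) * E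
  have hadd : ∀ ℓ ℓ', φ (ℓ + ℓ') = φ ℓ + φ ℓ' := by
    intro ℓ ℓ'
    have hm : x.pt ∈ W ℓ ⊓ W ℓ' := ⟨hxW ℓ, hxW ℓ'⟩
    let r := X.presheaf.map (homOfLE (inf_le_left : W ℓ ⊓ W ℓ' ≤ W ℓ)).op (a ℓ)
    let r' := X.presheaf.map (homOfLE (inf_le_right : W ℓ ⊓ W ℓ' ≤ W ℓ')).op (a ℓ')
    have h1 : L.presheaf.germ _ x.pt hm ((r + r') • restrictSection (inf_le_left.trans (hW ℓ)) e) =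
        ℓ + ℓ' := by
      conv_rhs => rw [← ha ℓ, ← ha ℓ',
        ← germ_restrictSection (inf_le_left : W ℓ ⊓ W ℓ' ≤ W ℓ) _ hm,
        ← germ_restrictSection (inf_le_right : W ℓ ⊓ W ℓ' ≤ W ℓ') _ hm]
      rw [restrictSection_smul, restrictSection_smul, restrictSection_trans, restrictSection_trans,
        add_smul, map_add]
    have h2 := spec _ (inf_le_left.trans (hW ℓ)) hm (r + r')
    rw [h1] at h2
    have h3 : x.value hm (r + r') = x.value (hxW ℓ) (a ℓ) + x.value (hxW ℓ') (a ℓ') := by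
      simp only [ComplexPoint.value, map_add]
      congr 2
      · exact X.presheaf.germ_res_apply _ _ _ _
      · exact X.presheaf.germ_res_apply _ _ _ _
    simp only [φ, h2, h3, add_mul]
  have hφ : ∀ (V : X.Opens) (hV : V ≤ U) (hxV : x.pt ∈ V) (b : Γ(X, V)),
      φ (L.presheaf.germ V x.pt hxV (b • restrictSection hV e)) = x.value hxV b * E :=
    fun V hV hxV b => by simp only [φ, spec]
  refine ⟨⟨x, AddMonoidHom.mk' φ hadd, ?_⟩, rfl, ?_⟩
  · intro V hxV c σ
    obtain ⟨b, hb⟩ := rep V hxV σ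
    have hm : x.pt ∈ V ⊓ U := ⟨hxV, hx⟩
    simp only [AddMonoidHom.mk'_apply]
    rw [← germ_restrictSection (inf_le_left : V ⊓ U ≤ V) _ hm,
      ← germ_restrictSection (inf_le_left : V ⊓ U ≤ V) _ hm, restrictSection_smul, ← hb, ← mul_smul,
      hφ, hφ, ← mul_assoc]
    congr 1
    simp only [ComplexPoint.value, map_mul]
    congr 2
    exact X.presheaf.germ_res_apply _ _ _ _
  · change φ _ = E
    have := hφ U le_rfl hx 1
    rw [one_smul, restrictSection_rfl] at this
    rw [this]
    simp [ComplexPoint.value]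

end Charts

/-! ### The bihomogeneous ideal of the deformation -/

section ConeIdeals

variable {N M : ℕ}

/-- The value `F(f, u g; u, 1)` of a form `F`, a polynomial in the coordinate `u` of `𝔸^1`. -/
def chartEval {A : Type*} [CommRing A] (f : Fin (N + 1) → A) (g : Fin M → A) :
    MvPolynomial (Coord N M ⊕ Fin 2) ℤ →ₐ[ℤ] Polynomial A :=
  MvPolynomial.aeval (Sum.elim (Sum.elim (fun l => Polynomial.C (f l))
    (fun l => Polynomial.C (g l) * Polynomial.X)) ![Polynomial.X, 1])

/-- The value `F(e f, e u g; ρ u, ρ)`, a polynomial in `e` and `ρ` (the variables of index `0` and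
`1`) and `u`.  Its kernel is the bihomogeneous ideal generated by the forms that `chartEval`
sends to zero. -/
def coneMap {A : Type*} [CommRing A] (f : Fin (N + 1) → A) (g : Fin M → A) :
    MvPolynomial (Coord N M ⊕ Fin 2) ℤ →ₐ[ℤ] MvPolynomial (Fin 2) (Polynomial A) :=
  MvPolynomial.aeval (Sum.elim
    (fun i => MvPolynomial.X 0 * MvPolynomial.C (Sum.elim (fun l => Polynomial.C (f l))
      (fun l => Polynomial.C (g l) * Polynomial.X) i))
    (fun i => MvPolynomial.X 1 * MvPolynomial.C ((![Polynomial.X, 1] : Fin 2 → Polynomial A) i)))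

variable {A : Type*} [CommRing A] (f : Fin (N + 1) → A) (g : Fin M → A)

theorem coneMap_of_isBihomogeneous {F : MvPolynomial (Coord N M ⊕ Fin 2) ℤ} {a b : ℕ}
    (hF : IsBihomogeneous F a b) :
    coneMap f g F = MvPolynomial.X 0 ^ a * MvPolynomial.X 1 ^ b *
      MvPolynomial.C (chartEval f g F) := by
  rw [coneMap, hF.aeval_mul, chartEval, map_aeval_int]
  congr 3
  ext1 i
  rcases i with i | i <;> rfl

/-- The component of bidegree `(a, b)` of a polynomial. -/
def bihomogeneousComponent (a b : ℕ) (F : MvPolynomial (Coord N M ⊕ Fin 2) ℤ) :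
    MvPolynomial (Coord N M ⊕ Fin 2) ℤ :=
  MvPolynomial.weightedHomogeneousComponent
    (Sum.elim (fun _ => (1, 0)) (fun _ => (0, 1)) : Coord N M ⊕ Fin 2 → ℕ × ℕ) (a, b) F

theorem isBihomogeneous_component (a b : ℕ) (F : MvPolynomial (Coord N M ⊕ Fin 2) ℤ) :
    IsBihomogeneous (bihomogeneousComponent a b F) a b :=
  MvPolynomial.weightedHomogeneousComponent_isWeightedHomogeneous _ _

theorem chartEval_component (a b : ℕ) (F : MvPolynomial (Coord N M ⊕ Fin 2) ℤ) :
    chartEval f g (bihomogeneousComponent a b F) =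
      (coneMap f g F).coeff (Finsupp.single 0 a + Finsupp.single 1 b) := by
  classical
  induction F using MvPolynomial.induction_on' with
  | monomial u c =>
    set wt : Coord N M ⊕ Fin 2 → ℕ × ℕ := Sum.elim (fun _ => (1, 0)) (fun _ => (0, 1))
    have hu : IsBihomogeneous (MvPolynomial.monomial u c) (Finsupp.weight wt u).1
        (Finsupp.weight wt u).2 := MvPolynomial.isWeightedHomogeneous_monomial _ _ _ rfl
    have hX : ∀ a b : ℕ, (MvPolynomial.X 0 ^ a * MvPolynomial.X 1 ^ b :
        MvPolynomial (Fin 2) (Polynomial A)) =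
        MvPolynomial.monomial (Finsupp.single 0 a + Finsupp.single 1 b) 1 := fun a b => by
      rw [MvPolynomial.X_pow_eq_monomial, MvPolynomial.X_pow_eq_monomial,
        MvPolynomial.monomial_mul, one_mul]
    rw [coneMap_of_isBihomogeneous f g hu, hX, mul_comm, MvPolynomial.coeff_C_mul,
      MvPolynomial.coeff_monomial, bihomogeneousComponent,
      MvPolynomial.weightedHomogeneousComponent_of_mem hu]
    have hiff : (Finsupp.single 0 (Finsupp.weight wt u).1 +
        Finsupp.single 1 (Finsupp.weight wt u).2 : Fin 2 →₀ ℕ) =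
        Finsupp.single 0 a + Finsupp.single 1 b ↔ (a, b) = Finsupp.weight wt u := by
      constructor
      · intro h
        have h0 := DFunLike.congr_fun h 0
        have h1 := DFunLike.congr_fun h 1
        simp at h0 h1
        exact Prod.ext h0.symm h1.symm
      · intro h
        rw [← h]
    by_cases h : (a, b) = Finsupp.weight wt u
    · rw [if_pos h, if_pos (hiff.mpr h), mul_one]
    · rw [if_neg h, if_neg (fun h' => h (hiff.mp h')), map_zero, mul_zero]
  | add p q hp hq =>
    rw [map_add, MvPolynomial.coeff_add, ← hp, ← hq, ← map_add]
    simp only [bihomogeneousComponent, map_add]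

end ConeIdeals

section Components

variable {N M : ℕ} {A : Fin (N + 1) → Type*} [∀ k, CommRing (A k)]
  (f : ∀ k, Fin (N + 1) → A k) (g : ∀ k, Fin M → A k)

/-- The integral bihomogeneous ideal of the deformation, computed on the charts of index `k`. -/
def coneIdeal : Ideal (MvPolynomial (Coord N M ⊕ Fin 2) ℤ) :=
  ⨅ k, RingHom.ker (coneMap (f k) (g k))

theorem mem_coneIdeal {F : MvPolynomial (Coord N M ⊕ Fin 2) ℤ} :
    F ∈ coneIdeal f g ↔ ∀ k, coneMap (f k) (g k) F = 0 := by
  simp [coneIdeal, RingHom.mem_ker]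

theorem coneIdeal_eq_span : coneIdeal f g = Ideal.span {F | (∃ a b, IsBihomogeneous F a b) ∧
    ∀ k, chartEval (f k) (g k) F = 0} := by
  apply le_antisymm
  · intro F hF
    rw [mem_coneIdeal] at hF
    rw [← MvPolynomial.finsum_weightedHomogeneousComponent
      (Sum.elim (fun _ => (1, 0)) (fun _ => (0, 1)) : Coord N M ⊕ Fin 2 → ℕ × ℕ) F]
    refine finsum_induction (· ∈ Ideal.span {F | (∃ a b, IsBihomogeneous F a b) ∧
      ∀ k, chartEval (f k) (g k) F = 0}) (zero_mem _) (fun _ _ => add_mem) ?_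
    rintro ⟨a, b⟩
    refine Ideal.subset_span ⟨⟨a, b, isBihomogeneous_component a b F⟩, fun k => ?_⟩
    have := chartEval_component (f k) (g k) a b F
    rwa [hF k, MvPolynomial.coeff_zero] at this
  · rw [Ideal.span_le]
    rintro F ⟨⟨a, b, hF⟩, h⟩
    refine (mem_coneIdeal f g).mpr fun k => ?_
    rw [coneMap_of_isBihomogeneous _ _ hF, h k, map_zero, mul_zero]

/-- `Q` is the prime ideal of an irreducible component of the complex bihomogeneous cone of the
deformation: its zero locus is stable under rescaling of `x` and of `w`, the coordinates `w_j` do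
not vanish on it, and some chart `k` is dense in it, in the sense that `x_k ∉ Q` and that `Q`
contains the relations which hold on the chart. -/
structure IsConeComponent (Q : Ideal (MvPolynomial (Coord N M ⊕ Fin 2) ℂ)) : Prop where
  isPrime : Q.IsPrime
  scale_mem : ∀ c d : ℂ, c ≠ 0 → d ≠ 0 → ∀ (x : Coord N M → ℂ) (w : Fin 2 → ℂ),
    Sum.elim x w ∈ MvPolynomial.zeroLocus ℂ Q →
      (Sum.elim (fun i => c * x i) (fun i => d * w i) : Coord N M ⊕ Fin 2 → ℂ) ∈
        MvPolynomial.zeroLocus ℂ Q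
  w_notMem : ∀ j : Fin 2, MvPolynomial.X (Sum.inr j) ∉ Q
  pivot : ∃ k, MvPolynomial.X (Sum.inl (Sum.inl k)) ∉ Q ∧ ∀ F, coneMap (f k) (g k) F = 0 →
    MvPolynomial.map (Int.castRingHom ℂ) F ∈ Q

/-- The endomorphism `X_i ↦ c_i X_i` of a polynomial ring. -/
def rescale (σ : Type*) (c : σ → ℂ) : MvPolynomial σ ℂ →ₐ[ℂ] MvPolynomial σ ℂ :=
  MvPolynomial.aeval fun i => MvPolynomial.C (c i) * MvPolynomial.X i

theorem rescale_mul {σ : Type*} (c d : σ → ℂ) :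
    rescale σ (c * d) = (rescale σ c).comp (rescale σ d) := by
  ext1 i
  simp [rescale, MvPolynomial.algHom_C, mul_comm, mul_left_comm]

theorem rescale_one {σ : Type*} : rescale σ 1 = AlgHom.id ℂ _ := by
  ext1 i
  simp [rescale]

/-- Minimal primes of a homogeneous ideal are homogeneous: a divisible group of rescalings which
preserves the ideal permutes the finitely many minimal primes, and a divisible group acts trivially
on a finite set. -/
theorem minimalPrimes_comap_rescale {σ : Type*} [Finite σ] {G : Type*} [CommGroup G]
    (hdiv : ∀ n : ℕ, n ≠ 0 → ∀ u : G, ∃ v, v ^ n = u) (χ : G →* (σ → ℂ))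
    {J : Ideal (MvPolynomial σ ℂ)} (hJ : ∀ u, J ≤ J.comap (rescale σ (χ u)))
    {Q : Ideal (MvPolynomial σ ℂ)} (hQ : Q ∈ J.minimalPrimes) (u : G) :
    Q.comap (rescale σ (χ u)) = Q := by
  have hcomp : ∀ (u v : G) (P : Ideal (MvPolynomial σ ℂ)),
      (P.comap (rescale σ (χ u))).comap (rescale σ (χ v)) = P.comap (rescale σ (χ (u * v))) := by
    intro u v P
    ext p
    rw [Ideal.mem_comap, Ideal.mem_comap, Ideal.mem_comap, map_mul, rescale_mul, AlgHom.comp_apply]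
  have hone : ∀ P : Ideal (MvPolynomial σ ℂ), P.comap (rescale σ (χ 1)) = P := by
    intro P
    ext p
    rw [Ideal.mem_comap, map_one, rescale_one, AlgHom.id_apply]
  have hprime : ∀ (u : G) (P : Ideal (MvPolynomial σ ℂ)), P.IsPrime → J ≤ P →
      (P.comap (rescale σ (χ u))).IsPrime ∧ J ≤ P.comap (rescale σ (χ u)) := fun u P hP hJP =>
    ⟨Ideal.comap_isPrime _ P, (hJ u).trans (Ideal.comap_mono hJP)⟩
  have hmin : ∀ (u : G), ∀ P ∈ J.minimalPrimes, P.comap (rescale σ (χ u)) ∈ J.minimalPrimes := by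
    intro u P hP
    refine ⟨hprime u P hP.1.1 hP.1.2, fun P' hP' hle => ?_⟩
    have h1 := hprime u⁻¹ P' hP'.1 hP'.2
    have h2 : P'.comap (rescale σ (χ u⁻¹)) ≤ P := by
      refine (Ideal.comap_mono hle).trans ?_
      rw [hcomp, mul_inv_cancel, hone]
    have h3 := hP.2 h1 h2
    refine (Ideal.comap_mono h3).trans ?_
    rw [hcomp, inv_mul_cancel, hone]
  have := (J.finite_minimalPrimes_of_isNoetherianRing).to_subtype
  let act : MulAction G J.minimalPrimes :=
    { smul := fun u P => ⟨P.1.comap (rescale σ (χ u)), hmin u P.1 P.2⟩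
      one_smul := fun P => Subtype.ext (hone P.1)
      mul_smul := fun u v P => Subtype.ext (by
        change P.1.comap (rescale σ (χ (u * v))) =
          (P.1.comap (rescale σ (χ v))).comap (rescale σ (χ u))
        rw [hcomp, mul_comm v u]) }
  obtain ⟨v, rfl⟩ := hdiv (Nat.card (Equiv.Perm J.minimalPrimes)) Nat.card_pos.ne' u
  have h1 : MulAction.toPermHom G J.minimalPrimes
      (v ^ Nat.card (Equiv.Perm J.minimalPrimes)) = 1 := by
    rw [map_pow, pow_card_eq_one']
  exact congrArg Subtype.val (Equiv.congr_fun h1 ⟨Q, hQ⟩)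

/-- A minimal prime of the kernel of `φ` consists of zero divisors modulo the kernel. -/
theorem notMem_of_isRegular {R S : Type*} [CommRing R] [CommRing S] {I : Ideal R} {p : Ideal R}
    (hp : p ∈ I.minimalPrimes) (φ : R →+* S) (h : I = RingHom.ker φ) {a : R}
    (ha : IsLeftRegular (φ a)) : a ∉ p := by
  intro hap
  obtain ⟨y, hy, hay⟩ := Ideal.exists_mul_mem_of_mem_minimalPrimes hp hap
  rw [h, RingHom.mem_ker] at hy hay
  rw [map_mul] at hay
  exact hy (ha (by simpa using hay))

attribute [local instance] MvPolynomial.algebraMvPolynomial in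
/-- The contraction of a minimal prime of the extension of `I` to complex coefficients is a minimal
prime of `I`, by going down along the flat extension `ℤ[X] → ℂ[X]`. -/
theorem comap_mem_minimalPrimes {σ : Type*} {I : Ideal (MvPolynomial σ ℤ)}
    {Q : Ideal (MvPolynomial σ ℂ)}
    (hQ : Q ∈ (I.map (MvPolynomial.map (Int.castRingHom ℂ))).minimalPrimes) :
    Q.comap (MvPolynomial.map (Int.castRingHom ℂ)) ∈ I.minimalPrimes := by
  have hflat : Module.Flat (MvPolynomial σ ℤ) (MvPolynomial σ ℂ) :=
    Module.Flat.isBaseChange ℤ _ ℂ _ (Algebra.IsPushout.out (R := ℤ) (R' := ℂ))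
  have hQp := hQ.1.1
  have halg : algebraMap (MvPolynomial σ ℤ) (MvPolynomial σ ℂ) =
    MvPolynomial.map (Int.castRingHom ℂ) := by
      rw [← RingHom.ext_int (algebraMap ℤ ℂ) (Int.castRingHom ℂ)]; rfl
  rw [← halg] at hQ ⊢
  have hle : I ≤ Q.comap (algebraMap (MvPolynomial σ ℤ) (MvPolynomial σ ℂ)) :=
    Ideal.map_le_iff_le_comap.mp hQ.1.2
  obtain ⟨q, hq, hqle⟩ := Ideal.exists_minimalPrimes_le hle
  have := hq.1.1
  obtain ⟨P, hPQ, hP, hPq⟩ := Ideal.exists_ideal_le_liesOver_of_le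
    (q := Q.under (MvPolynomial σ ℤ)) Q hqle
  have h1 : Q ≤ P := hQ.2 ⟨hP, Ideal.map_le_iff_le_comap.mpr (hq.1.2.trans hPq.over.le)⟩ hPQ
  have h2 : Q = P := le_antisymm h1 hPQ
  rw [h2, ← Ideal.under, ← hPq.over]
  exact hq

theorem isConeComponent_of_mem_minimalPrimes (hf : ∀ k, f k k = 1)
    {Q : Ideal (MvPolynomial (Coord N M ⊕ Fin 2) ℂ)}
    (hQ : Q ∈ ((coneIdeal f g).map (MvPolynomial.map (Int.castRingHom ℂ))).minimalPrimes) :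
    IsConeComponent f g Q := by
  have hq := comap_mem_minimalPrimes hQ
  have := hq.1.1
  obtain ⟨k, hk⟩ : ∃ k, RingHom.ker (coneMap (f k) (g k)) ≤
      Q.comap (MvPolynomial.map (Int.castRingHom ℂ)) := by
    have h := hq.1.2
    rw [coneIdeal, ← Finset.inf_univ_eq_iInf] at h
    obtain ⟨k, -, hk⟩ := (hq.1.1.inf_le').mp h
    exact ⟨k, hk⟩
  have hqk : Q.comap (MvPolynomial.map (Int.castRingHom ℂ)) ∈
      (RingHom.ker (coneMap (f k) (g k))).minimalPrimes :=
    ⟨⟨hq.1.1, hk⟩, fun P hP hle => hq.2 ⟨hP.1, (iInf_le _ k).trans hP.2⟩ hle⟩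
  have hX : ∀ j : Fin 2,
      IsLeftRegular (MvPolynomial.X j : MvPolynomial (Fin 2) (Polynomial (A k))) :=
    fun j => (MvPolynomial.isRegular_X (n := j)).left
  have hreg : ∀ i, IsLeftRegular (coneMap (f k) (g k) (MvPolynomial.X i)) →
      MvPolynomial.X i ∉ Q := fun i hi h => by
    refine notMem_of_isRegular hqk (coneMap (f k) (g k)).toRingHom rfl hi ?_
    simpa [Ideal.mem_comap] using h
  refine ⟨hQ.1.1, fun c d hc hd x w h p hp => ?_, fun j => hreg _ ?_, k, hreg _ ?_, fun F hF => ?_⟩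
  · let χ : ℂˣ × ℂˣ →* (Coord N M ⊕ Fin 2 → ℂ) :=
      { toFun := fun u => Sum.elim (fun _ => u.1) (fun _ => u.2)
        map_one' := by ext i; rcases i with i | i <;> rfl
        map_mul' := fun u v => by ext i; rcases i with i | i <;> simp }
    have hdiv : ∀ n : ℕ, n ≠ 0 → ∀ u : ℂˣ × ℂˣ, ∃ v, v ^ n = u := by
      have h1 : ∀ n : ℕ, n ≠ 0 → ∀ u : ℂˣ, ∃ v, v ^ n = u := fun n hn u => by
        obtain ⟨z, hz⟩ := IsAlgClosed.exists_pow_nat_eq (u : ℂ) (Nat.pos_of_ne_zero hn)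
        have hz0 : z ≠ 0 := by
          rintro rfl
          rw [zero_pow hn] at hz
          exact u.ne_zero hz.symm
        exact ⟨Units.mk0 z hz0, Units.ext hz⟩
      intro n hn u
      obtain ⟨v, hv⟩ := h1 n hn u.1
      obtain ⟨v', hv'⟩ := h1 n hn u.2
      exact ⟨(v, v'), Prod.ext hv hv'⟩
    have hJ : ∀ u, (coneIdeal f g).map (MvPolynomial.map (Int.castRingHom ℂ)) ≤
        ((coneIdeal f g).map (MvPolynomial.map (Int.castRingHom ℂ))).comap
          (rescale _ (χ u)) := by
      intro u
      rw [coneIdeal_eq_span, Ideal.map_span, Ideal.span_le]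
      rintro _ ⟨F, ⟨⟨a, b, hF⟩, hF'⟩, rfl⟩
      have h1 := hF.aeval_mul (MvPolynomial.C (u.1 : ℂ)) (MvPolynomial.C (u.2 : ℂ))
        (fun i => (MvPolynomial.X (Sum.inl i) : MvPolynomial (Coord N M ⊕ Fin 2) ℂ))
        (fun i => (MvPolynomial.X (Sum.inr i) : MvPolynomial (Coord N M ⊕ Fin 2) ℂ))
      have hm : ∀ v : Coord N M ⊕ Fin 2 → MvPolynomial (Coord N M ⊕ Fin 2) ℂ,
          MvPolynomial.aeval v (MvPolynomial.map (Int.castRingHom ℂ) F) =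
            MvPolynomial.aeval v F := by
        intro v
        rw [← RingHom.ext_int (algebraMap ℤ ℂ) (Int.castRingHom ℂ),
          MvPolynomial.aeval_map_algebraMap]
      have h2 : rescale _ (χ u) (MvPolynomial.map (Int.castRingHom ℂ) F) =
          MvPolynomial.C (u.1 : ℂ) ^ a * MvPolynomial.C (u.2 : ℂ) ^ b *
            MvPolynomial.map (Int.castRingHom ℂ) F := by
        rw [rescale, hm]
        refine Eq.trans ?_ (h1.trans ?_)
        · congr 2
          ext1 i
          rcases i with i | i <;> rfl
        · congr 1
          rw [← hm, show (Sum.elim (fun i => MvPolynomial.X (Sum.inl i))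
            (fun i => MvPolynomial.X (Sum.inr i)) : Coord N M ⊕ Fin 2 →
              MvPolynomial (Coord N M ⊕ Fin 2) ℂ) = MvPolynomial.X from by
                ext1 i; rcases i with i | i <;> rfl, MvPolynomial.aeval_X_left_apply]
      rw [SetLike.mem_coe, Ideal.mem_comap, h2]
      exact Ideal.mul_mem_left _ _ (Ideal.subset_span ⟨F, ⟨⟨a, b, hF⟩, hF'⟩, rfl⟩)
    have hinv := minimalPrimes_comap_rescale hdiv χ hJ hQ (Units.mk0 c hc, Units.mk0 d hd)
    rw [← hinv] at hp
    have := h _ hp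
    rw [rescale, MvPolynomial.comp_aeval_apply] at this
    refine Eq.trans ?_ this
    congr 2
    ext1 i
    rcases i with i | i <;> simp [χ]
  · rw [coneMap, MvPolynomial.aeval_X]
    refine (hX 1).mul ?_
    fin_cases j
    · intro p q h
      ext1 m
      have := congrArg (MvPolynomial.coeff m) h
      simp only [Fin.zero_eta, Matrix.cons_val_zero, MvPolynomial.coeff_C_mul] at this
      exact Polynomial.isRegular_X.left this
    · simpa only [Fin.mk_one, Sum.elim_inr, Matrix.cons_val_one, Matrix.cons_val_fin_one, map_one]
        using (isRegular_one (R := MvPolynomial (Fin 2) (Polynomial (A k)))).left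
  · rw [coneMap, MvPolynomial.aeval_X]
    simp [hf k]
  · exact hk hF

/-- The complex bihomogeneous cone of the deformation is covered by finitely many irreducible
components. -/
theorem exists_coneComponents (hf : ∀ k, f k k = 1) :
    ∃ 𝒬 : Set (Ideal (MvPolynomial (Coord N M ⊕ Fin 2) ℂ)), 𝒬.Finite ∧
      (∀ Q ∈ 𝒬, IsConeComponent f g Q) ∧
      ∀ ζ : Coord N M ⊕ Fin 2 → ℂ, (∀ F a b, IsBihomogeneous F a b →
        (∀ k, chartEval (f k) (g k) F = 0) → MvPolynomial.aeval ζ F = 0) →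
        ∃ Q ∈ 𝒬, ζ ∈ MvPolynomial.zeroLocus ℂ Q := by
  refine ⟨_, Ideal.finite_minimalPrimes_of_isNoetherianRing _ _,
    fun Q hQ => isConeComponent_of_mem_minimalPrimes f g hf hQ, fun ζ hζ => ?_⟩
  have hle : (coneIdeal f g).map (MvPolynomial.map (Int.castRingHom ℂ)) ≤
      RingHom.ker (MvPolynomial.aeval ζ : MvPolynomial _ ℂ →ₐ[ℂ] ℂ) := by
    rw [coneIdeal_eq_span, Ideal.map_span, Ideal.span_le]
    rintro _ ⟨F, ⟨⟨a, b, hF⟩, hF'⟩, rfl⟩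
    change MvPolynomial.aeval ζ (MvPolynomial.map (Int.castRingHom ℂ) F) = 0
    rw [← RingHom.ext_int (algebraMap ℤ ℂ) (Int.castRingHom ℂ), MvPolynomial.aeval_map_algebraMap]
    exact hζ F a b hF hF'
  have := RingHom.ker_isPrime (MvPolynomial.aeval ζ : MvPolynomial (Coord N M ⊕ Fin 2) ℂ →ₐ[ℂ] ℂ)
  obtain ⟨Q, hQ, hQle⟩ := Ideal.exists_minimalPrimes_le hle
  exact ⟨Q, hQ, fun p hp => hQle hp⟩

end Components

/-! ### Generic points of the components -/

section Fractions

/-- Clearing denominators: if `b_j = m_j / h`, then `h ^ n G(b)` is a polynomial in `h` and `m`, for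
a suitable `n`; the polynomial `H` depends on `G` only. -/
theorem MvPolynomial.exists_homogenization {ι R : Type} [CommRing R] (G : MvPolynomial ι R) :
    ∃ (n : ℕ) (H : MvPolynomial (Option ι) R), ∀ (S : Type) [CommRing S] [Algebra R S]
      (h : S) (m b : ι → S), (∀ j, b j * h = m j) →
      MvPolynomial.aeval (fun j => Option.elim j h m) H = h ^ n * MvPolynomial.aeval b G := by
  induction G using MvPolynomial.induction_on with
  | C a => exact ⟨0, MvPolynomial.C a, fun S _ _ h m b _ => by simp⟩
  | add p q hp hq =>
    obtain ⟨n, H, hH⟩ := hp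
    obtain ⟨n', H', hH'⟩ := hq
    refine ⟨n + n', MvPolynomial.X none ^ n' * H + MvPolynomial.X none ^ n * H',
      fun S _ _ h m b hb => ?_⟩
    rw [map_add, map_mul, map_mul, hH S h m b hb, hH' S h m b hb]
    simp only [map_pow, MvPolynomial.aeval_X, Option.elim_none, map_add]
    ring
  | mul_X p j hp =>
    obtain ⟨n, H, hH⟩ := hp
    refine ⟨n + 1, H * MvPolynomial.X (some j), fun S _ _ h m b hb => ?_⟩
    rw [map_mul, hH S h m b hb]
    simp only [MvPolynomial.aeval_X, Option.elim_some, map_mul, ← hb j]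
    ring

variable {N M : ℕ} {A : Fin (N + 1) → Type} [∀ k, CommRing (A k)]
  {f : ∀ k, Fin (N + 1) → A k} {g : ∀ k, Fin M → A k}

/-- A zero `(x, y, w)` of `Q` with `x_k` and `w_0` nonzero gives a complex point of the chart `k`:
the one with `f_l = x_l / x_k` and `g_l = (y_l / w_0) / (x_k / w_1)`. -/
theorem exists_chart_point {Q : Ideal (MvPolynomial (Coord N M ⊕ Fin 2) ℂ)} {k : Fin (N + 1)}
    (hk : f k k = 1)
    (hgen : ∀ a, ∃ G : MvPolynomial (Fin (N + 1)) ℤ, MvPolynomial.aeval (f k) G = a)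
    (hQ : ∀ F, coneMap (f k) (g k) F = 0 → MvPolynomial.map (Int.castRingHom ℂ) F ∈ Q)
    {x : Coord N M → ℂ} {w : Fin 2 → ℂ} (hζ : Sum.elim x w ∈ MvPolynomial.zeroLocus ℂ Q)
    (hx : x (Sum.inl k) ≠ 0) (hw : w 0 ≠ 0) :
    ∃ χ : A k →+* ℂ, (∀ l, χ (f k l) = x (Sum.inl l) / x (Sum.inl k)) ∧
      ∀ l, χ (g k l) = x (Sum.inr l) * w 1 / (x (Sum.inl k) * w 0) := by
  let hh : MvPolynomial (Coord N M ⊕ Fin 2) ℤ :=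
    MvPolynomial.X (Sum.inl (Sum.inl k)) * MvPolynomial.X (Sum.inr 0)
  let m : Fin (N + 1) ⊕ Fin M → MvPolynomial (Coord N M ⊕ Fin 2) ℤ := Sum.elim
    (fun l => MvPolynomial.X (Sum.inl (Sum.inl l)) * MvPolynomial.X (Sum.inr 0))
    (fun l => MvPolynomial.X (Sum.inl (Sum.inr l)) * MvPolynomial.X (Sum.inr 1))
  let b : Fin (N + 1) ⊕ Fin M → MvPolynomial (Fin 2) (Polynomial (A k)) := fun j =>
    MvPolynomial.C (Polynomial.C (Sum.elim (f k) (g k) j))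
  let q : Fin (N + 1) ⊕ Fin M → ℂ := Sum.elim (fun l => x (Sum.inl l) / x (Sum.inl k))
    (fun l => x (Sum.inr l) * w 1 / (x (Sum.inl k) * w 0))
  have hb : ∀ j, b j * coneMap (f k) (g k) hh = coneMap (f k) (g k) (m j) := by
    rintro (l | l)
    · simp only [b, hh, m, coneMap, Sum.elim_inl, Sum.elim_inr, map_mul, MvPolynomial.aeval_X, hk]
      simp only [map_one]
      ring
    · simp only [b, hh, m, coneMap, Sum.elim_inl, Sum.elim_inr, map_mul, MvPolynomial.aeval_X, hk]
      simp only [map_one, Matrix.cons_val_zero, Matrix.cons_val_one]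
      ring
  have hq : ∀ j, q j * (x (Sum.inl k) * w 0) =
      MvPolynomial.aeval (Sum.elim x w : Coord N M ⊕ Fin 2 → ℂ) (m j) := by
    rintro (l | l)
    · simp only [q, m, Sum.elim_inl, map_mul, MvPolynomial.aeval_X, Sum.elim_inr]
      field_simp
    · simp only [q, m, Sum.elim_inl, map_mul, MvPolynomial.aeval_X, Sum.elim_inr]
      field_simp
  have hker : ∀ G : MvPolynomial (Fin (N + 1) ⊕ Fin M) ℤ,
      MvPolynomial.aeval (Sum.elim (f k) (g k)) G = 0 → MvPolynomial.aeval q G = 0 := by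
    intro G hG
    obtain ⟨n, H, hH⟩ := G.exists_homogenization
    have h1 := hH _ _ _ _ hb
    have h2 : MvPolynomial.aeval b G = 0 := by
      rw [show b = fun j => (MvPolynomial.C.comp Polynomial.C) (Sum.elim (f k) (g k) j) from rfl,
        ← map_aeval_int, hG, map_zero]
    have h3 := hH _ _ _ _ hq
    have h4 : ∀ {B : Type} [CommRing B] [Algebra ℤ B]
        (ψ : MvPolynomial (Coord N M ⊕ Fin 2) ℤ →ₐ[ℤ] B),
        MvPolynomial.aeval (fun j => Option.elim j (ψ hh) fun j => ψ (m j)) H =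
          ψ (MvPolynomial.aeval (fun j => Option.elim j hh m) H) := by
      intro B _ _ ψ
      rw [MvPolynomial.comp_aeval_apply]
      congr 2
      ext1 j
      cases j <;> rfl
    rw [h2, mul_zero, h4] at h1
    have h5 := hζ _ (hQ _ h1)
    rw [← RingHom.ext_int (algebraMap ℤ ℂ) (Int.castRingHom ℂ),
      MvPolynomial.aeval_map_algebraMap] at h5
    have h6 := h4 (MvPolynomial.aeval (Sum.elim x w : Coord N M ⊕ Fin 2 → ℂ))
    rw [h5, show (MvPolynomial.aeval (Sum.elim x w : Coord N M ⊕ Fin 2 → ℂ)) hh =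
      x (Sum.inl k) * w 0 by simp [hh], h3] at h6
    exact (mul_eq_zero.mp h6).resolve_left (pow_ne_zero _ (mul_ne_zero hx hw))
  have hsurj : Function.Surjective (MvPolynomial.aeval (R := ℤ) (Sum.elim (f k) (g k))) := by
    intro a
    obtain ⟨G, hG⟩ := hgen a
    refine ⟨MvPolynomial.rename Sum.inl G, ?_⟩
    rw [MvPolynomial.aeval_rename, ← hG]
    rfl
  let χ := RingHom.liftOfSurjective (MvPolynomial.aeval (R := ℤ) (Sum.elim (f k) (g k))).toRingHom
    hsurj ⟨(MvPolynomial.aeval (R := ℤ) q).toRingHom, fun G hG => hker G hG⟩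
  have hχ : ∀ j, χ (Sum.elim (f k) (g k) j) = q j := fun j => by
    have := RingHom.liftOfRightInverse_comp_apply
      (MvPolynomial.aeval (R := ℤ) (Sum.elim (f k) (g k))).toRingHom _
      (Function.rightInverse_surjInv hsurj)
      ⟨(MvPolynomial.aeval (R := ℤ) q).toRingHom, fun G hG => hker G hG⟩ (MvPolynomial.X j)
    simpa [χ, MvPolynomial.aeval_X] using this
  exact ⟨χ, fun l => hχ (Sum.inl l), fun l => hχ (Sum.inr l)⟩

end Fractions

section ConeSet

variable {X : Scheme.{0}} (L : X.Modules) {N M : ℕ} (s : Fin (N + 1) → Γ(L, ⊤))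
  (t : Fin M → Γ(L, ⊤))

/-- The bihomogeneous cone of the deformation: the pairs of vectors `(x, w)`, possibly zero, at
which the bihomogeneous forms defining the deformation vanish. -/
def coneSet : Set ((Coord N M → ℂ) × (Fin 2 → ℂ)) :=
  {p | ∀ (F : MvPolynomial (Coord N M ⊕ Fin 2) ℤ) (a b : ℕ), IsBihomogeneous F a b →
    VanishesOnImage L s t F → MvPolynomial.aeval (Sum.elim p.1 p.2) F = 0}

theorem continuous_aeval_elim (F : MvPolynomial (Coord N M ⊕ Fin 2) ℤ) :
    Continuous fun p : (Coord N M → ℂ) × (Fin 2 → ℂ) =>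
      MvPolynomial.aeval (Sum.elim p.1 p.2 : Coord N M ⊕ Fin 2 → ℂ) F := by
  have h : Continuous fun p : (Coord N M → ℂ) × (Fin 2 → ℂ) =>
      (Sum.elim p.1 p.2 : Coord N M ⊕ Fin 2 → ℂ) := by
    refine continuous_pi fun i => ?_
    rcases i with i | i
    · exact (continuous_apply i).comp continuous_fst
    · exact (continuous_apply i).comp continuous_snd
  have h2 := (MvPolynomial.continuous_eval (MvPolynomial.map (algebraMap ℤ ℂ) F)).comp h
  refine h2.congr fun p => ?_
  rw [Function.comp_apply, MvPolynomial.eval_map, ← MvPolynomial.aeval_def]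

theorem isClosed_coneSet : IsClosed (coneSet L s t) := by
  simp only [coneSet, Set.ofPred_forall]
  exact isClosed_iInter fun F => isClosed_iInter fun a => isClosed_iInter fun b =>
    isClosed_iInter fun _ => isClosed_iInter fun _ =>
      isClosed_eq (continuous_aeval_elim F) continuous_const

variable {L s t}

theorem smul_mem_coneSet {p : (Coord N M → ℂ) × (Fin 2 → ℂ)} (hp : p ∈ coneSet L s t) (c d : ℂ) :
    (c • p.1, d • p.2) ∈ coneSet L s t := by
  intro F a b hF hv
  have := hF.aeval_mul c d p.1 p.2
  rw [hp F a b hF hv, mul_zero] at this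
  exact this

theorem mem_deformation_iff {x : Coord N M → ℂ} (hx : x ≠ 0) {w : Fin 2 → ℂ} (hw : w ≠ 0) :
    (Projectivization.mk ℂ x hx, Projectivization.mk ℂ w hw) ∈ deformation L s t ↔
      (x, w) ∈ coneSet L s t := by
  refine ⟨fun h F a b hF hv => h F a b hF hv x hx w hw rfl,
    fun h F a b hF hv x' hx' w' hw' he => ?_⟩
  obtain ⟨c, rfl⟩ := (Projectivization.mk_eq_mk_iff' ℂ _ _ hx' hx).mp (congrArg Prod.fst he).symm
  obtain ⟨d, rfl⟩ := (Projectivization.mk_eq_mk_iff' ℂ _ _ hw' hw).mp (congrArg Prod.snd he).symm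
  exact smul_mem_coneSet h c d F a b hF hv

variable {U : Fin (N + 1) → X.Opens} {f : ∀ k, Fin (N + 1) → Γ(X, U k)}
  {g : ∀ k, Fin M → Γ(X, U k)}

theorem VanishesOnImage.chartEval_eq_zero {F : MvPolynomial (Coord N M ⊕ Fin 2) ℤ}
    (hF : VanishesOnImage L s t F) {k : Fin (N + 1)} (hc : IsCoordChart s t k (U k) (f k) (g k)) :
    chartEval (f k) (g k) F = 0 :=
  hF (U k) _ hc.isFrame (f k) (g k) hc.s_eq hc.t_eq

theorem IsConeComponent.mem_coneSet (hc : ∀ k, IsCoordChart s t k (U k) (f k) (g k))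
    {Q : Ideal (MvPolynomial (Coord N M ⊕ Fin 2) ℂ)} (hQ : IsConeComponent f g Q)
    {x : Coord N M → ℂ} {w : Fin 2 → ℂ} (h : Sum.elim x w ∈ MvPolynomial.zeroLocus ℂ Q) :
    (x, w) ∈ coneSet L s t := by
  intro F a b hF hv
  obtain ⟨k, -, hk⟩ := hQ.pivot
  have h1 := h _ (hk F (by
    rw [coneMap_of_isBihomogeneous _ _ hF, hv.chartEval_eq_zero (hc k), map_zero, mul_zero]))
  rwa [← RingHom.ext_int (algebraMap ℤ ℂ) (Int.castRingHom ℂ),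
    MvPolynomial.aeval_map_algebraMap] at h1

theorem exists_coneComponents_coneSet (hU : ∀ x, ∃ k, x ∈ U k)
    (hc : ∀ k, IsCoordChart s t k (U k) (f k) (g k)) :
    ∃ 𝒬 : Set (Ideal (MvPolynomial (Coord N M ⊕ Fin 2) ℂ)), 𝒬.Finite ∧
      (∀ Q ∈ 𝒬, IsConeComponent f g Q) ∧
      ∀ p ∈ coneSet L s t, ∃ Q ∈ 𝒬, Sum.elim p.1 p.2 ∈ MvPolynomial.zeroLocus ℂ Q := by
  obtain ⟨𝒬, h1, h2, h3⟩ := exists_coneComponents f g fun k => (hc k).f_self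
  exact ⟨𝒬, h1, h2, fun p hp => h3 _ fun F a b hF hF' =>
    hp F a b hF (vanishesOnImage_of_forall_chart hU hc hF hF')⟩

theorem coordVec_inl (v : TotalSpace L) (l : Fin (N + 1)) :
    coordVec s t v (Sum.inl l) = v.value (U := ⊤) trivial (s l) := rfl

theorem coordVec_inr (v : TotalSpace L) (l : Fin M) :
    coordVec s t v (Sum.inr l) = v.value (U := ⊤) trivial (t l) := rfl

/-- A generic point `(x, y, w)` of a component is of the form `(w_1 φ(s), w_0 φ(t), w)` for a point
`φ` of the total space over `X`. -/
theorem IsConeComponent.exists_totalSpace (hc : ∀ k, IsCoordChart s t k (U k) (f k) (g k))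
    {Q : Ideal (MvPolynomial (Coord N M ⊕ Fin 2) ℂ)} (hQ : IsConeComponent f g Q) :
    ∃ k : Fin (N + 1), MvPolynomial.X (Sum.inl (Sum.inl k)) ∉ Q ∧
      ∀ (x : Coord N M → ℂ) (w : Fin 2 → ℂ), Sum.elim x w ∈ MvPolynomial.zeroLocus ℂ Q →
        x (Sum.inl k) ≠ 0 → w 0 ≠ 0 → w 1 ≠ 0 → ∃ v : TotalSpace L,
          (∀ l, coordVec s t v (Sum.inl l) = x (Sum.inl l) / w 1) ∧
          ∀ l, coordVec s t v (Sum.inr l) = x (Sum.inr l) / w 0 := by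
  obtain ⟨k, hk, hker⟩ := hQ.pivot
  refine ⟨k, hk, fun x w hζ hx hw0 hw1 => ?_⟩
  obtain ⟨χ, hχf, hχg⟩ := exists_chart_point (hc k).f_self (hc k).generate hker hζ hx hw0
  obtain ⟨p, hp, hpχ⟩ := ComplexPoint.exists_value_eq (hc k).isAffineOpen χ
  obtain ⟨v, rfl, hv⟩ := TotalSpace.exists_value_eq (hc k).isFrame p hp (x (Sum.inl k) / w 1)
  refine ⟨v, fun l => ?_, fun l => ?_⟩
  · rw [coordVec_inl, v.value_of_smul hp ((hc k).s_eq l), hpχ, hχf, hv]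
    field_simp
  · rw [coordVec_inr, v.value_of_smul hp ((hc k).t_eq l), hpχ, hχg, hv]
    field_simp

/-- The vector `(w_1 x, w_0 y)`.  For `(x, y) = (φ(s), φ(t))` it lies over the point of the
deformation with `[u : t] = [w_0 : w_1]` above the base point of `φ`. -/
def moveVec (w : Fin 2 → ℂ) (x : Coord N M → ℂ) : Coord N M → ℂ :=
  Sum.elim (fun l => w 1 * x (Sum.inl l)) (fun l => w 0 * x (Sum.inr l))

theorem moveVec_coordVec_mem_coneSet (hU : ∀ x, ∃ k, x ∈ U k)
    (hc : ∀ k, IsCoordChart s t k (U k) (f k) (g k)) (v : TotalSpace L) (w : Fin 2 → ℂ) :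
    (moveVec w (coordVec s t v), w) ∈ coneSet L s t := by
  have hgen : ∀ w : Fin 2 → ℂ, w 1 ≠ 0 → (moveVec w (coordVec s t v), w) ∈ coneSet L s t := by
    intro w hw F a b hF hv
    obtain ⟨k, hk⟩ := hU v.base.pt
    have h1 := hv.chartEval_eq_zero (hc k)
    let χ : Γ(X, U k) →+* ℂ := v.base.ev.comp (X.presheaf.germ (U k) v.base.pt hk).hom
    have h2 := congrArg (Polynomial.eval₂RingHom χ (w 0 / w 1)) h1
    rw [chartEval, map_aeval_int, map_zero] at h2
    have h3 := hF.aeval_mul (w 1 * v.value hk (restrictSection le_top (s k))) (w 1)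
      (fun i => Polynomial.eval₂RingHom χ (w 0 / w 1)
        (Sum.elim (fun l => Polynomial.C (f k l)) (fun l => Polynomial.C (g k l) * Polynomial.X) i))
      (fun i => Polynomial.eval₂RingHom χ (w 0 / w 1)
        ((![Polynomial.X, 1] : Fin 2 → Polynomial Γ(X, U k)) i))
    refine Eq.trans ?_ (h3.trans (mul_eq_zero_of_right _ (Eq.trans ?_ h2)))
    · congr 2
      ext1 i
      have hχ : ∀ a, χ a = v.base.value hk a := fun a => rfl
      rcases i with (l | l) | i
      · simp only [moveVec, Sum.elim_inl, coordVec_inl, v.value_of_smul hk ((hc k).s_eq l),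
          Polynomial.coe_eval₂RingHom, Polynomial.eval₂_C, hχ]
        ring
      · simp only [moveVec, Sum.elim_inl, Sum.elim_inr, coordVec_inr,
          v.value_of_smul hk ((hc k).t_eq l),
          Polynomial.coe_eval₂RingHom, Polynomial.eval₂_C, Polynomial.eval₂_mul,
          Polynomial.eval₂_X, hχ]
        field_simp
      · fin_cases i
        · simp [mul_div_cancel₀ _ hw]
        · simp
    · congr 2
      ext1 i
      rcases i with i | i <;> rfl
  -- the remaining case `w_1 = 0` follows by continuity
  have hcont : Continuous fun z : ℂ => (moveVec ![w 0, z] (coordVec s t v), ![w 0, z]) := by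
    refine Continuous.prodMk (continuous_pi fun i => ?_) (continuous_pi fun i => ?_)
    · rcases i with i | i
      · exact (continuous_id.mul continuous_const :
          Continuous fun z : ℂ => z * coordVec s t v (Sum.inl i))
      · exact (continuous_const : Continuous fun _ : ℂ => w 0 * coordVec s t v (Sum.inr i))
    · fin_cases i
      · exact (continuous_const : Continuous fun _ : ℂ => w 0)
      · exact (continuous_id : Continuous fun z : ℂ => z)
  have hcl := (isClosed_coneSet L s t).preimage hcont
  have hd : Dense {z : ℂ | z ≠ 0} := dense_compl_singleton 0
  have hsub : {z : ℂ | z ≠ 0} ⊆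
      (fun z : ℂ => (moveVec ![w 0, z] (coordVec s t v), ![w 0, z])) ⁻¹' coneSet L s t :=
    fun z hz => hgen ![w 0, z] hz
  have hall := hcl.closure_subset_iff.mpr hsub (hd (w 1))
  have hw : ![w 0, w 1] = w := by ext i; fin_cases i <;> rfl
  simpa only [Set.mem_preimage, hw] using hall

end ConeSet

/-! ### Density of generic points for the analytic topology -/

section Density

/-- Cauchy's bound for the roots of a monic polynomial. -/
theorem Polynomial.Monic.norm_le_of_isRoot {p : Polynomial ℂ} (hp : p.Monic) {ρ : ℂ}
    (hρ : p.IsRoot ρ) : ‖ρ‖ ≤ 1 + ∑ i ∈ Finset.range p.natDegree, ‖p.coeff i‖ := by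
  by_contra! hlt
  set S := ∑ i ∈ Finset.range p.natDegree, ‖p.coeff i‖
  have hS : 0 ≤ S := Finset.sum_nonneg fun _ _ => norm_nonneg _
  have h1 : 1 ≤ ‖ρ‖ := by linarith
  have heval := hρ.eq_zero
  rw [Polynomial.eval_eq_sum_range, Finset.sum_range_succ, hp.coeff_natDegree, one_mul] at heval
  have h2 : ‖ρ‖ ^ p.natDegree ≤ ∑ i ∈ Finset.range p.natDegree, ‖p.coeff i‖ * ‖ρ‖ ^ i := by
    rw [← norm_pow, ← norm_neg, ← eq_neg_of_add_eq_zero_left heval]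
    refine (norm_sum_le _ _).trans_eq (Finset.sum_congr rfl fun i _ => ?_)
    rw [norm_mul, norm_pow]
  rcases Nat.eq_zero_or_pos p.natDegree with h0 | h0
  · rw [h0] at h2
    simp at h2
    linarith
  obtain ⟨d, hd⟩ := Nat.exists_eq_succ_of_ne_zero h0.ne'
  have h3 : ∑ i ∈ Finset.range p.natDegree, ‖p.coeff i‖ * ‖ρ‖ ^ i ≤ S * ‖ρ‖ ^ d := by
    rw [Finset.sum_mul]
    refine Finset.sum_le_sum fun i hi => mul_le_mul_of_nonneg_left ?_ (norm_nonneg _)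
    refine pow_le_pow_right₀ h1 ?_
    have := Finset.mem_range.mp hi
    omega
  have h4 := h2.trans h3
  rw [hd, pow_succ'] at h4
  have := le_of_mul_le_mul_right h4 (by positivity)
  linarith

theorem Multiset.pow_card_le_norm_prod {c : ℝ} (hc : 0 ≤ c) (s : Multiset ℂ)
    (h : ∀ x ∈ s, c ≤ ‖x‖) : c ^ s.card ≤ ‖s.prod‖ := by
  induction s using Multiset.induction_on with
  | empty => simp
  | cons a s ih =>
    rw [Multiset.card_cons, Multiset.prod_cons, norm_mul, pow_succ']
    exact mul_le_mul (h a (Multiset.mem_cons_self a s))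
      (ih fun x hx => h x (Multiset.mem_cons_of_mem hx)) (by positivity) (norm_nonneg _)

/-- The smallest root is bounded in terms of the constant coefficient, up to sign the product of the
roots. -/
theorem Polynomial.Monic.exists_root_norm_pow_le {p : Polynomial ℂ} (hp : p.Monic)
    (hd : p.natDegree ≠ 0) : ∃ ρ, p.IsRoot ρ ∧ ‖ρ‖ ^ p.natDegree ≤ ‖p.coeff 0‖ := by
  have hsplit := IsAlgClosed.splits p
  have hcard : p.roots.card = p.natDegree := hsplit.natDegree_eq_card_roots.symm
  have hne : p.roots.toFinset.Nonempty := by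
    rw [Multiset.toFinset_nonempty]
    intro h0
    rw [h0, Multiset.card_zero] at hcard
    exact hd hcard.symm
  obtain ⟨ρ, hρ, hmin⟩ := p.roots.toFinset.exists_min_image (fun x => ‖x‖) hne
  refine ⟨ρ, Polynomial.isRoot_of_mem_roots (Multiset.mem_toFinset.mp hρ), ?_⟩
  have h1 := Multiset.pow_card_le_norm_prod (norm_nonneg ρ) p.roots
    (fun x hx => hmin x (Multiset.mem_toFinset.mpr hx))
  rw [hcard] at h1
  have h2 : p.coeff 0 = (-1) ^ p.natDegree * p.roots.prod :=
    hsplit.coeff_zero_eq_prod_roots_of_monic hp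
  rw [h2, norm_mul, norm_pow, norm_neg, norm_one, one_pow, one_mul]
  exact h1

theorem isTorsionFree_of_faithfulSMul (P R : Type*) [CommRing P] [CommRing R] [IsDomain R]
    [Algebra P R] [FaithfulSMul P R] : Module.IsTorsionFree P R := by
  have : IsDomain P := (FaithfulSMul.algebraMap_injective P R).isDomain (algebraMap P R)
  refine Module.IsTorsionFree.of_smul_eq_zero fun a b hab => ?_
  rw [Algebra.smul_def, mul_eq_zero] at hab
  exact hab.imp_left fun h0 => FaithfulSMul.algebraMap_injective P R (h0.trans (map_zero _).symm)

/-- Lying over with a prescribed value: if `P` is integrally closed and `R` is integral over `P`,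
every root `ρ` of the specialization of the minimal polynomial of `h` at a point of `P` is the value
of `h` at a maximal ideal of `R` above this point. -/
theorem exists_isMaximal_aeval_mem {P R k : Type} [CommRing P] [IsDomain P] [IsIntegrallyClosed P]
    [CommRing R] [IsDomain R] [Algebra P R] [FaithfulSMul P R] [Algebra.IsIntegral P R] [Field k]
    (ψ : P →+* k) (hψ : Function.Surjective ψ) (h : R) (ρ : k)
    (hρ : (minpoly P h).eval₂ ψ ρ = 0) :
    ∃ I : Ideal R, I.IsMaximal ∧
      ∀ q : Polynomial P, q.eval₂ ψ ρ = 0 → Polynomial.aeval h q ∈ I := by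
  have htf := isTorsionFree_of_faithfulSMul P R
  let φ : Polynomial P →+* R := (Polynomial.aeval h).toRingHom
  let χ : Polynomial P →+* k := Polynomial.eval₂RingHom ψ ρ
  let _ : Algebra (Polynomial P) R := φ.toAlgebra
  have : IsScalarTower P (Polynomial P) R := IsScalarTower.of_algebraMap_eq fun x => by
    change _ = Polynomial.aeval h (Polynomial.C x)
    rw [Polynomial.aeval_C]
  have hPT : Algebra.IsIntegral (Polynomial P) R := Algebra.IsIntegral.tower_top P
  have hχ : Function.Surjective χ := fun z => by
    obtain ⟨a, ha⟩ := hψ z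
    exact ⟨Polynomial.C a, by simp [χ, ha]⟩
  have hmax : (RingHom.ker χ).IsMaximal := RingHom.ker_isMaximal_of_surjective χ hχ
  obtain ⟨I, -, hI, hIc⟩ := Ideal.exists_ideal_over_prime_of_isIntegral (RingHom.ker χ)
    (⊥ : Ideal R) (by
      intro q hq
      have hq' : Polynomial.aeval h q = 0 := hq
      obtain ⟨r, rfl⟩ := minpoly.isIntegrallyClosed_dvd (Algebra.IsIntegral.isIntegral h) hq'
      rw [RingHom.mem_ker, map_mul]
      exact mul_eq_zero_of_left hρ _)
  refine ⟨I, Ideal.isMaximal_of_isIntegral_of_isMaximal_comap (R := Polynomial P) I (hIc ▸ hmax),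
    fun q hq => ?_⟩
  change q ∈ I.comap (algebraMap (Polynomial P) R)
  rw [hIc]
  exact hq

variable {σ : Type} {Q : Ideal (MvPolynomial σ ℂ)}

/-- Evaluation of the regular functions on the zero locus of `Q` at a point of it. -/
def zeroLocusEval {ζ : σ → ℂ} (hζ : ζ ∈ MvPolynomial.zeroLocus ℂ Q) :
    (MvPolynomial σ ℂ ⧸ Q) →ₐ[ℂ] ℂ :=
  Ideal.Quotient.liftₐ Q (MvPolynomial.aeval ζ) hζ

theorem zeroLocusEval_mk {ζ : σ → ℂ} (hζ : ζ ∈ MvPolynomial.zeroLocus ℂ Q)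
    (p : MvPolynomial σ ℂ) : zeroLocusEval hζ (Ideal.Quotient.mk Q p) = MvPolynomial.aeval ζ p :=
  rfl

theorem isClosed_zeroLocus (Q : Ideal (MvPolynomial σ ℂ)) :
    IsClosed (MvPolynomial.zeroLocus ℂ Q) := by
  have : MvPolynomial.zeroLocus ℂ Q = ⋂ p ∈ Q, {ζ | MvPolynomial.aeval ζ p = 0} := by
    ext ζ; simp [MvPolynomial.mem_zeroLocus_iff]
  rw [this]
  refine isClosed_biInter fun p _ => isClosed_eq ?_ continuous_const
  exact p.continuous_eval

/-- Over a polynomial ring, over which the coordinate ring of the zero locus of `Q` is integral,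
there is a point `ζ` of the zero locus above a given point `p` at which `h` takes a given value,
provided that this value is a root of the minimal polynomial of `h` specialized at `p`. -/
theorem exists_zeroLocus_lift [Finite σ] [Q.IsPrime] {τ : Type}
    [Algebra (MvPolynomial τ ℂ) (MvPolynomial σ ℂ ⧸ Q)]
    [IsScalarTower ℂ (MvPolynomial τ ℂ) (MvPolynomial σ ℂ ⧸ Q)]
    [FaithfulSMul (MvPolynomial τ ℂ) (MvPolynomial σ ℂ ⧸ Q)]
    [Algebra.IsIntegral (MvPolynomial τ ℂ) (MvPolynomial σ ℂ ⧸ Q)]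
    (h : MvPolynomial σ ℂ ⧸ Q) (p : τ → ℂ) (ρ : ℂ)
    (hρ : (minpoly (MvPolynomial τ ℂ) h).eval₂ (MvPolynomial.eval p) ρ = 0) :
    ∃ (ζ : σ → ℂ) (hζ : ζ ∈ MvPolynomial.zeroLocus ℂ Q),
      (∀ q : MvPolynomial τ ℂ,
        zeroLocusEval hζ (algebraMap _ _ q) = MvPolynomial.eval p q) ∧
      zeroLocusEval hζ h = ρ := by
  obtain ⟨I, hImax, hI⟩ := exists_isMaximal_aeval_mem (MvPolynomial.eval p)
    (fun z => ⟨MvPolynomial.C z, MvPolynomial.eval_C z⟩) h ρ hρ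
  have hImax' : (I.comap (Ideal.Quotient.mk Q)).IsMaximal :=
    Ideal.comap_isMaximal_of_surjective _ Ideal.Quotient.mk_surjective
  obtain ⟨ζ, hζI⟩ := MvPolynomial.isMaximal_iff_eq_vanishingIdeal_singleton.mp hImax'
  have hmem : ∀ q, Ideal.Quotient.mk Q q ∈ I ↔ MvPolynomial.aeval ζ q = 0 := fun q => by
    rw [← Ideal.mem_comap, hζI, MvPolynomial.mem_vanishingIdeal_singleton_iff]
  have hζ : ζ ∈ MvPolynomial.zeroLocus ℂ Q := fun q hq => by
    rw [← hmem, Ideal.Quotient.eq_zero_iff_mem.mpr hq]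
    exact zero_mem _
  have key : ∀ r : MvPolynomial σ ℂ ⧸ Q, r ∈ I → zeroLocusEval hζ r = 0 := fun r => by
    obtain ⟨q, rfl⟩ := Ideal.Quotient.mk_surjective r
    exact (hmem q).mp
  have hC : ∀ z : ℂ, algebraMap (MvPolynomial τ ℂ) (MvPolynomial σ ℂ ⧸ Q) (MvPolynomial.C z) =
      algebraMap ℂ _ z := fun z =>
    (IsScalarTower.algebraMap_apply ℂ (MvPolynomial τ ℂ) (MvPolynomial σ ℂ ⧸ Q) z).symm
  refine ⟨ζ, hζ, fun q => ?_, ?_⟩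
  · have := key _ (hI (Polynomial.C (q - MvPolynomial.C (MvPolynomial.eval p q))) (by
      rw [Polynomial.eval₂_C, map_sub, MvPolynomial.eval_C, sub_self]))
    rw [Polynomial.aeval_C, map_sub, hC, map_sub, sub_eq_zero, AlgHom.commutes] at this
    exact this
  · have := key _ (hI (Polynomial.X - Polynomial.C (MvPolynomial.C ρ)) (by
      rw [Polynomial.eval₂_sub, Polynomial.eval₂_X, Polynomial.eval₂_C, MvPolynomial.eval_C,
        sub_self]))
    rw [map_sub, Polynomial.aeval_X, Polynomial.aeval_C, hC, map_sub, sub_eq_zero,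
      AlgHom.commutes] at this
    exact this

/-- A polynomial that vanishes at `ζ₀` and at no other point of a given finite set. -/
theorem MvPolynomial.exists_aeval_separating {S : Set (σ → ℂ)} (hS : S.Finite) (ζ₀ : σ → ℂ) :
    ∃ H : MvPolynomial σ ℂ, MvPolynomial.aeval ζ₀ H = 0 ∧
      ∀ ζ ∈ S, MvPolynomial.aeval ζ H = 0 → ζ = ζ₀ := by
  classical
  have hlin : ∀ ξ : σ → ℂ, ∃ ℓ : MvPolynomial σ ℂ, ξ ≠ ζ₀ →
      MvPolynomial.aeval ζ₀ ℓ = 1 ∧ MvPolynomial.aeval ξ ℓ = 0 := by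
    intro ξ
    by_cases h : ξ = ζ₀
    · exact ⟨0, fun h' => absurd h h'⟩
    obtain ⟨i, hi⟩ := Function.ne_iff.mp h
    refine ⟨MvPolynomial.C (ζ₀ i - ξ i)⁻¹ * (MvPolynomial.X i - MvPolynomial.C (ξ i)),
      fun _ => ⟨?_, ?_⟩⟩
    · simp only [map_mul, map_sub, MvPolynomial.aeval_C, MvPolynomial.aeval_X,
        Algebra.algebraMap_self, RingHom.id_apply]
      exact inv_mul_cancel₀ (sub_ne_zero.mpr (Ne.symm hi))
    · simp
  choose ℓ hℓ using hlin
  refine ⟨1 - ∏ ξ ∈ hS.toFinset.erase ζ₀, ℓ ξ, ?_, fun ζ hζ h => ?_⟩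
  · rw [map_sub, map_one, map_prod, Finset.prod_eq_one, sub_self]
    exact fun ξ hξ => (hℓ ξ (Finset.ne_of_mem_erase hξ)).1
  · by_contra hne
    rw [map_sub, map_one, map_prod, Finset.prod_eq_zero
      (Finset.mem_erase.mpr ⟨hne, hS.mem_toFinset.mpr hζ⟩) (hℓ ζ hne).2] at h
    simp at h

theorem MapClusterPt.eq_of_tendsto {α X Y : Type*} [TopologicalSpace X] [TopologicalSpace Y]
    [T2Space Y] {l : Filter α} {u : α → X} {x : X} (h : MapClusterPt x l u) {g : X → Y}
    (hg : ContinuousAt g x) {y : Y} (hy : Filter.Tendsto (g ∘ u) l (𝓝 y)) : g x = y := by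
  have h1 : MapClusterPt (g x) l (g ∘ u) := h.continuousAt_comp hg
  have h2 : ClusterPt (g x) (𝓝 y) := ClusterPt.mono h1 hy
  exact eq_of_nhds_neBot h2

/-- The complement of a hypersurface not containing an irreducible affine variety is dense in it,
for the analytic topology.  Noether normalization gives a finite map `π` to an affine space.  On a
generic line through `π ζ₀` the hypersurface is met at finitely many points only, and the points of
the line near `π ζ₀` can be lifted to points near `ζ₀`: one prescribes the value at the lift of a
function `H` isolating `ζ₀` in its fibre to be the smallest root of the minimal polynomial of
`H`. -/
theorem mem_closure_zeroLocus_aeval_ne_zero [Finite σ] [Q.IsPrime] {Δ : MvPolynomial σ ℂ}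
    (hΔ : Δ ∉ Q) {ζ₀ : σ → ℂ} (hζ₀ : ζ₀ ∈ MvPolynomial.zeroLocus ℂ Q) :
    ζ₀ ∈ closure {ζ | ζ ∈ MvPolynomial.zeroLocus ℂ Q ∧ MvPolynomial.aeval ζ Δ ≠ 0} := by
  have := Fintype.ofFinite σ
  obtain ⟨n, γ, hinj, hint⟩ := exists_integral_inj_algHom_of_fg ℂ (MvPolynomial σ ℂ ⧸ Q)
  let _ : Algebra (MvPolynomial (Fin n) ℂ) (MvPolynomial σ ℂ ⧸ Q) := γ.toAlgebra
  have hγ : ∀ q, algebraMap (MvPolynomial (Fin n) ℂ) (MvPolynomial σ ℂ ⧸ Q) q = γ q := fun _ => rfl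
  have : IsScalarTower ℂ (MvPolynomial (Fin n) ℂ) (MvPolynomial σ ℂ ⧸ Q) :=
    IsScalarTower.of_algebraMap_eq fun z => (γ.commutes z).symm
  have : FaithfulSMul (MvPolynomial (Fin n) ℂ) (MvPolynomial σ ℂ ⧸ Q) :=
    (faithfulSMul_iff_algebraMap_injective _ _).mpr hinj
  have : Algebra.IsIntegral (MvPolynomial (Fin n) ℂ) (MvPolynomial σ ℂ ⧸ Q) := ⟨hint⟩
  choose Y hY using fun i => Ideal.Quotient.mk_surjective (γ (MvPolynomial.X i))
  -- the projection to affine space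
  let π : (σ → ℂ) → Fin n → ℂ := fun ζ i => MvPolynomial.aeval ζ (Y i)
  have hπc : Continuous π := continuous_pi fun i => (Y i).continuous_eval
  have hπ : ∀ {ζ} (hζ : ζ ∈ MvPolynomial.zeroLocus ℂ Q) (q : MvPolynomial (Fin n) ℂ),
      zeroLocusEval hζ (algebraMap _ _ q) = MvPolynomial.eval (π ζ) q := by
    intro ζ hζ q
    have : (zeroLocusEval hζ).comp γ = MvPolynomial.aeval (π ζ) := by
      refine MvPolynomial.algHom_ext fun i => ?_
      rw [AlgHom.comp_apply, ← hY, zeroLocusEval_mk, MvPolynomial.aeval_X]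
    rw [hγ, ← AlgHom.comp_apply, this, MvPolynomial.aeval_eq_eval]
  have hroot : ∀ {ζ} (hζ : ζ ∈ MvPolynomial.zeroLocus ℂ Q) (h : MvPolynomial σ ℂ ⧸ Q),
      ((minpoly (MvPolynomial (Fin n) ℂ) h).map (MvPolynomial.eval (π ζ))).IsRoot
        (zeroLocusEval hζ h) := by
    intro ζ hζ h
    have h1 := congrArg (zeroLocusEval hζ) (minpoly.aeval (MvPolynomial (Fin n) ℂ) h)
    rw [map_zero, Polynomial.aeval_def] at h1
    have h2 := Polynomial.hom_eval₂ (minpoly (MvPolynomial (Fin n) ℂ) h)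
      (algebraMap _ _) (zeroLocusEval hζ : (MvPolynomial σ ℂ ⧸ Q) →+* ℂ) h
    rw [RingHom.coe_coe, h1] at h2
    rw [Polynomial.IsRoot, Polynomial.eval_map, h2]
    congr 1
    exact RingHom.ext fun q => (hπ hζ q).symm
  have hmonic : ∀ (h : MvPolynomial σ ℂ ⧸ Q), (minpoly (MvPolynomial (Fin n) ℂ) h).Monic :=
    fun h => minpoly.monic (Algebra.IsIntegral.isIntegral h)
  -- the base points in a direction in which the hypersurface is avoided
  have hΔ' : Ideal.Quotient.mk Q Δ ≠ 0 := fun h => hΔ (Ideal.Quotient.eq_zero_iff_mem.mp h)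
  obtain ⟨c, hc0, hcΔ⟩ := IsAlgebraic.exists_nonzero_dvd (R := MvPolynomial (Fin n) ℂ)
    (Algebra.IsIntegral.isIntegral (Ideal.Quotient.mk Q Δ)).isAlgebraic
    (mem_nonZeroDivisors_of_ne_zero hΔ')
  obtain ⟨p₁, hp₁⟩ : ∃ p₁, MvPolynomial.eval p₁ c ≠ 0 := by
    by_contra! h
    exact hc0 (MvPolynomial.funext fun x => by rw [h x, map_zero])
  let p : ℂ → Fin n → ℂ := fun z i => π ζ₀ i + z * (p₁ i - π ζ₀ i)
  have hpc : Continuous p := by fun_prop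
  have hp0 : p 0 = π ζ₀ := by ext i; simp [p]
  have hcp : ∀ᶠ z in 𝓝[≠] 0, MvPolynomial.eval (p z) c ≠ 0 := by
    let c₁ : Polynomial ℂ := MvPolynomial.aeval
      (fun i => Polynomial.C (π ζ₀ i) + Polynomial.X * Polynomial.C (p₁ i - π ζ₀ i)) c
    have hc₁ : ∀ z, c₁.eval z = MvPolynomial.eval (p z) c := by
      intro z
      have : (Polynomial.aeval z).comp (MvPolynomial.aeval
          (fun i => Polynomial.C (π ζ₀ i) + Polynomial.X * Polynomial.C (p₁ i - π ζ₀ i))) =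
          MvPolynomial.aeval (R := ℂ) (p z) := by
        refine MvPolynomial.algHom_ext fun i => ?_
        simp [p]
      have := congrArg (fun F => F c) this
      simpa [c₁, MvPolynomial.aeval_eq_eval] using this
    have hc₁0 : c₁ ≠ 0 := by
      intro h
      apply hp₁
      have := hc₁ 1
      rw [h, Polynomial.eval_zero] at this
      rw [this]
      congr 2
      ext i
      simp [p]
    have hfin : ((c₁.roots.toFinset : Set ℂ) \ {0}).Finite := (Finset.finite_toSet _).sdiff
    have := hfin.isClosed.isOpen_compl.mem_nhds (x := (0 : ℂ)) (by simp)
    filter_upwards [mem_nhdsWithin_of_mem_nhds this, self_mem_nhdsWithin] with z hz hz0 h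
    refine hz ⟨?_, hz0⟩
    rw [← hc₁] at h
    simpa [hc₁0] using h
  -- a function that isolates `ζ₀` in its fibre
  have hfibre : {ζ | ζ ∈ MvPolynomial.zeroLocus ℂ Q ∧ π ζ = π ζ₀}.Finite := by
    refine (Set.Finite.pi' (t := fun i : σ => {a | ((minpoly (MvPolynomial (Fin n) ℂ)
      (Ideal.Quotient.mk Q (MvPolynomial.X i))).map (MvPolynomial.eval (π ζ₀))).IsRoot a})
      fun i => ?_).subset ?_
    · exact Polynomial.finite_setOfPred_isRoot ((hmonic _).map _).ne_zero
    · rintro ζ ⟨hζ, hζπ⟩ i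
      have := hroot hζ (Ideal.Quotient.mk Q (MvPolynomial.X i))
      rw [hζπ, zeroLocusEval_mk, MvPolynomial.aeval_X] at this
      exact this
  obtain ⟨H, hH0, hH⟩ := MvPolynomial.exists_aeval_separating hfibre ζ₀
  -- the smallest root of the minimal polynomial `m` of `H` tends to `0 = H ζ₀`
  set m := minpoly (MvPolynomial (Fin n) ℂ) (Ideal.Quotient.mk Q H)
  have hm : m.Monic := hmonic _
  have hdeg : m.natDegree ≠ 0 :=
    (minpoly.natDegree_pos (Algebra.IsIntegral.isIntegral _)).ne'
  have hroots : ∀ z, ∃ ρ, (m.map (MvPolynomial.eval (p z))).IsRoot ρ ∧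
      ‖ρ‖ ^ m.natDegree ≤ ‖MvPolynomial.eval (p z) (m.coeff 0)‖ := by
    intro z
    obtain ⟨ρ, h1, h2⟩ := (hm.map (MvPolynomial.eval (p z))).exists_root_norm_pow_le
      (by rwa [hm.natDegree_map])
    rw [hm.natDegree_map, Polynomial.coeff_map] at h2
    exact ⟨ρ, h1, h2⟩
  choose ρ hρroot hρle using hroots
  have hρ0 : Filter.Tendsto ρ (𝓝 0) (𝓝 0) := by
    have h1 : MvPolynomial.eval (p 0) (m.coeff 0) = 0 := by
      have := hroot hζ₀ (Ideal.Quotient.mk Q H)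
      rw [zeroLocusEval_mk, hH0, Polynomial.IsRoot, ← Polynomial.coeff_zero_eq_eval_zero,
        Polynomial.coeff_map, ← hp0] at this
      exact this
    have h2 : Filter.Tendsto (fun z => ‖MvPolynomial.eval (p z) (m.coeff 0)‖) (𝓝 0) (𝓝 0) := by
      have : Continuous fun z => ‖MvPolynomial.eval (p z) (m.coeff 0)‖ :=
        ((m.coeff 0).continuous_eval.comp hpc).norm
      simpa [h1] using this.tendsto 0
    have h3 := squeeze_zero (fun z => by positivity) hρle h2
    rw [tendsto_zero_iff_norm_tendsto_zero]
    have h4 := h3.rpow_const (p := ((m.natDegree : ℝ)⁻¹)) (Or.inr (by positivity))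
    rw [Real.zero_rpow (by positivity)] at h4
    refine h4.congr fun z => ?_
    exact Real.pow_rpow_inv_natCast (norm_nonneg _) hdeg
  have hlift : ∀ z, ∃ ζ, ∃ hζ : ζ ∈ MvPolynomial.zeroLocus ℂ Q, π ζ = p z ∧
      MvPolynomial.aeval ζ H = ρ z := by
    intro z
    obtain ⟨ζ, hζ, h1, h2⟩ := exists_zeroLocus_lift (Ideal.Quotient.mk Q H) (p z) (ρ z) (by
      have := hρroot z
      rwa [Polynomial.IsRoot, Polynomial.eval_map] at this)
    refine ⟨ζ, hζ, ?_, h2⟩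
    ext i
    have := h1 (MvPolynomial.X i)
    rwa [hπ, MvPolynomial.eval_X, MvPolynomial.eval_X] at this
  choose ζ hζ hζπ hζH using hlift
  -- the lifts stay bounded and can accumulate only at `ζ₀`
  have hbound : ∀ i, ∃ B : ℝ, ∀ z, ‖z‖ ≤ 1 → ‖ζ z i‖ ≤ B := by
    intro i
    set μ := minpoly (MvPolynomial (Fin n) ℂ) (Ideal.Quotient.mk Q (MvPolynomial.X i))
    have hcont : Continuous fun z =>
        1 + ∑ j ∈ Finset.range μ.natDegree, ‖MvPolynomial.eval (p z) (μ.coeff j)‖ :=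
      continuous_const.add (continuous_finsetSum _ fun j _ =>
        ((μ.coeff j).continuous_eval.comp hpc).norm)
    obtain ⟨B, hB⟩ := (isCompact_closedBall (0 : ℂ) 1).bddAbove_image hcont.continuousOn
    refine ⟨B, fun z hz => ?_⟩
    have h1 := hroot (hζ z) (Ideal.Quotient.mk Q (MvPolynomial.X i))
    rw [zeroLocusEval_mk, MvPolynomial.aeval_X, hζπ] at h1
    have h2 := ((hmonic _).map _).norm_le_of_isRoot h1
    simp only [(hmonic _).natDegree_map, Polynomial.coeff_map] at h2
    exact h2.trans (hB ⟨z, by simpa using hz, rfl⟩)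
  choose B hB using hbound
  have htend : Filter.Tendsto ζ (𝓝[≠] 0) (𝓝 ζ₀) := by
    have hK : IsCompact (Set.pi Set.univ fun i => Metric.closedBall (0 : ℂ) (B i)) :=
      isCompact_univ_pi fun i => isCompact_closedBall _ _
    refine hK.le_nhds_of_unique_clusterPt ?_ ?_
    · have : Metric.closedBall (0 : ℂ) 1 ∈ 𝓝[≠] 0 :=
        mem_nhdsWithin_of_mem_nhds (Metric.closedBall_mem_nhds _ one_pos)
      refine Filter.mem_map.mpr ?_
      filter_upwards [this] with z hz i _
      simpa using hB i z (by simpa using hz)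
    · intro y _ hy
      have hy' : MapClusterPt y (𝓝[≠] 0) ζ := hy
      have h1 : y ∈ MvPolynomial.zeroLocus ℂ Q :=
        (isClosed_zeroLocus Q).mem_of_mapClusterPt hy' (Filter.Eventually.of_forall hζ)
      have h2 : π y = π ζ₀ := hy'.eq_of_tendsto hπc.continuousAt (by
        have : π ∘ ζ = p := funext hζπ
        rw [this, ← hp0]
        exact hpc.continuousAt.mono_left nhdsWithin_le_nhds)
      have h3 : MvPolynomial.aeval y H = 0 :=
        hy'.eq_of_tendsto (g := fun y => MvPolynomial.aeval y H) H.continuous_eval.continuousAt (by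
        have : (fun y => MvPolynomial.aeval y H) ∘ ζ = ρ := funext hζH
        rw [this]
        exact hρ0.mono_left nhdsWithin_le_nhds)
      exact hH y ⟨h1, h2⟩ h3
  refine mem_closure_of_tendsto htend ?_
  filter_upwards [hcp] with z hz
  refine ⟨hζ z, fun h => hz ?_⟩
  obtain ⟨b, hb⟩ := hcΔ
  rw [← hζπ z, ← hπ (hζ z), hb, map_mul, zeroLocusEval_mk, h, zero_mul]

end Density

/-! ### Projection of a component near `w₁ = 0` -/

section Projection

theorem MvPolynomial.exists_eval_ne_zero_of_not_X_dvd {σ : Type*} {F : MvPolynomial σ ℂ} {i j : σ}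
    (hij : j ≠ i) (hF : ¬ MvPolynomial.X i ∣ F) :
    ∃ p : σ → ℂ, p i = 0 ∧ p j ≠ 0 ∧ MvPolynomial.eval p F ≠ 0 := by
  classical
  let S : MvPolynomial σ ℂ →ₐ[ℂ] MvPolynomial σ ℂ :=
    MvPolynomial.aeval fun k => if k = i then 0 else MvPolynomial.X k
  have hS : S F ≠ 0 := by
    intro h0
    apply hF
    rw [← Ideal.mem_span_singleton, ← Ideal.Quotient.eq_zero_iff_mem]
    have : (Ideal.Quotient.mkₐ ℂ (Ideal.span {(MvPolynomial.X i : MvPolynomial σ ℂ)})).comp S =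
        Ideal.Quotient.mkₐ ℂ _ := by
      refine MvPolynomial.algHom_ext fun k => ?_
      rw [AlgHom.comp_apply, MvPolynomial.aeval_X]
      split_ifs with h
      · rw [map_zero, h]
        exact (Ideal.Quotient.eq_zero_iff_mem.mpr (Ideal.mem_span_singleton_self _)).symm
      · rfl
    have := congrArg (fun G => G F) this
    rw [AlgHom.comp_apply, h0, map_zero] at this
    exact this.symm
  obtain ⟨p, hp⟩ : ∃ p, MvPolynomial.eval p (S F * MvPolynomial.X j) ≠ 0 := by
    by_contra! h
    exact mul_ne_zero hS (MvPolynomial.X_ne_zero j)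
      (MvPolynomial.funext fun x => by rw [h x, map_zero])
  rw [map_mul, MvPolynomial.eval_X] at hp
  refine ⟨Function.update p i 0, Function.update_self .., ?_, ?_⟩
  · rw [Function.update_of_ne hij]
    exact right_ne_zero_of_mul hp
  · have : (MvPolynomial.aeval p).comp S = MvPolynomial.aeval (R := ℂ) (Function.update p i 0) := by
      refine MvPolynomial.algHom_ext fun k => ?_
      rw [AlgHom.comp_apply, MvPolynomial.aeval_X, MvPolynomial.aeval_X]
      split_ifs with h
      · rw [h, map_zero, Function.update_self]
      · rw [MvPolynomial.aeval_X, Function.update_of_ne h]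
    have := congrArg (fun G => G F) this
    rw [AlgHom.comp_apply, MvPolynomial.aeval_eq_eval, MvPolynomial.aeval_eq_eval] at this
    change MvPolynomial.eval p (S F) = MvPolynomial.eval _ F at this
    rw [← this]
    exact left_ne_zero_of_mul hp

theorem MvPolynomial.eval_homogeneousComponent_eq_zero {σ : Type*} {G : MvPolynomial σ ℂ}
    {a : σ → ℂ} (h : ∀ c : ℂ, c ≠ 0 → MvPolynomial.eval (fun i => c * a i) G = 0) (D : ℕ) :
    MvPolynomial.eval a (MvPolynomial.homogeneousComponent D G) = 0 := by
  let g : Polynomial ℂ := ∑ k ∈ Finset.range (G.totalDegree + 1),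
    Polynomial.C (MvPolynomial.eval a (MvPolynomial.homogeneousComponent k G)) * Polynomial.X ^ k
  have hg : ∀ c : ℂ, g.eval c = MvPolynomial.eval (fun i => c * a i) G := by
    intro c
    conv_rhs => rw [← MvPolynomial.sum_homogeneousComponent G]
    rw [Polynomial.eval_finsetSum, map_sum]
    refine Finset.sum_congr rfl fun k _ => ?_
    have := (MvPolynomial.homogeneousComponent_isHomogeneous k G).aeval_mul c a
    rw [MvPolynomial.aeval_eq_eval, MvPolynomial.aeval_eq_eval] at this
    change MvPolynomial.eval _ _ = _ * MvPolynomial.eval _ _ at this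
    rw [this, Polynomial.eval_mul, Polynomial.eval_C, Polynomial.eval_pow, Polynomial.eval_X,
      mul_comm]
  have hg0 : g = 0 := by
    refine Polynomial.eq_zero_of_infinite_isRoot g
      ((Set.finite_singleton (0 : ℂ)).infinite_compl.mono fun c hc => ?_)
    exact (hg c).trans (h c hc)
  have := congrArg (fun q => Polynomial.coeff q D) hg0
  simp only [g, Polynomial.finsetSum_coeff, Polynomial.coeff_C_mul_X_pow,
    Polynomial.coeff_zero] at this
  by_cases hD : D ∈ Finset.range (G.totalDegree + 1)
  · rwa [Finset.sum_ite_eq, if_pos hD] at this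
  · rw [MvPolynomial.homogeneousComponent_eq_zero, map_zero]
    simp at hD
    omega

/-- A linear map to a space of dimension one less whose kernel is contained in the line spanned by
`a`. -/
theorem exists_linearMap_ker_eq_span {d : ℕ} {a : Fin (d + 1) → ℂ} (ha : a ≠ 0) :
    ∃ q : (Fin (d + 1) → ℂ) →ₗ[ℂ] (Fin d → ℂ), ∀ b, q b = 0 → ∃ c : ℂ, b = fun i => c * a i := by
  obtain ⟨j, hj⟩ := Function.ne_iff.mp ha
  refine ⟨LinearMap.pi fun i => LinearMap.proj (j.succAbove i) -
    (a (j.succAbove i) / a j) • LinearMap.proj j, fun b hb => ⟨b j / a j, ?_⟩⟩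
  ext k
  rcases Fin.eq_self_or_eq_succAbove j k with rfl | ⟨i, rfl⟩
  · exact (div_mul_cancel₀ _ hj).symm
  · have := congrFun hb i
    simp only [LinearMap.pi_apply, LinearMap.sub_apply, LinearMap.smul_apply, LinearMap.proj_apply,
      Pi.zero_apply, sub_eq_zero, smul_eq_mul] at this
    rw [this]
    ring

/-- The linear form `l` in the variables of index `e k`, as a polynomial. -/
def linearPolynomial {σ : Type*} {ι : Type*} [Fintype ι] [DecidableEq ι] (e : ι → σ)
    (l : (ι → ℂ) →ₗ[ℂ] ℂ) : MvPolynomial σ ℂ :=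
  ∑ k, MvPolynomial.C (l (Pi.single k 1)) * MvPolynomial.X (e k)

theorem aeval_linearPolynomial {σ : Type*} {ι : Type*} [Fintype ι] [DecidableEq ι] (e : ι → σ)
    (l : (ι → ℂ) →ₗ[ℂ] ℂ) (ζ : σ → ℂ) :
    MvPolynomial.aeval ζ (linearPolynomial e l) = l (fun k => ζ (e k)) := by
  rw [linearPolynomial, map_sum, LinearMap.pi_apply_eq_sum_univ l]
  refine Finset.sum_congr rfl fun k _ => ?_
  rw [map_mul, MvPolynomial.aeval_C, MvPolynomial.aeval_X, smul_eq_mul, mul_comm]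
  have : (Pi.single k 1 : ι → ℂ) = fun j => if k = j then 1 else 0 := by
    ext i
    simp [Pi.single_apply, eq_comm]
  rw [this]
  rfl

variable {N M : ℕ} {X : Scheme.{0}} {U : Fin (N + 1) → X.Opens}
    {f : ∀ k, Fin (N + 1) → Γ(X, U k)} {g : ∀ k, Fin M → Γ(X, U k)}
    {Q : Ideal (MvPolynomial (Coord N M ⊕ Fin 2) ℂ)}

theorem IsConeComponent.zero_mem (hQ : IsConeComponent f g Q) {z : Coord N M → ℂ} {w : Fin 2 → ℂ}
    (h : Sum.elim z w ∈ MvPolynomial.zeroLocus ℂ Q) :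
    (Sum.elim 0 w : Coord N M ⊕ Fin 2 → ℂ) ∈ MvPolynomial.zeroLocus ℂ Q := by
  have hcont : Continuous fun c : ℂ =>
      (Sum.elim (fun i => c * z i) (fun i => 1 * w i) : Coord N M ⊕ Fin 2 → ℂ) :=
    continuous_pi (by rintro (i | i) <;> simp <;> fun_prop)
  have h1 : ∀ᶠ c in 𝓝[≠] (0 : ℂ),
      (Sum.elim (fun i => c * z i) (fun i => 1 * w i) : Coord N M ⊕ Fin 2 → ℂ) ∈
        MvPolynomial.zeroLocus ℂ Q := by
    filter_upwards [self_mem_nhdsWithin] with c hc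
    exact hQ.scale_mem c 1 hc one_ne_zero z w h
  have h2 := (isClosed_zeroLocus Q).mem_of_tendsto
    ((hcont.tendsto 0).mono_left nhdsWithin_le_nhds) h1
  convert h2 using 2
  · ext i; simp
  · ext i; simp

theorem IsConeComponent.normalize (hQ : IsConeComponent f g Q) {z : Coord N M → ℂ} {w : Fin 2 → ℂ}
    (h : Sum.elim z w ∈ MvPolynomial.zeroLocus ℂ Q) (hw : w 0 ≠ 0) {c : ℂ} (hc : c ≠ 0) {u : ℂ}
    (hu : u ≠ 0) :
    (Sum.elim (fun i => c * z i) ![u, u * w 1 / w 0] : Coord N M ⊕ Fin 2 → ℂ) ∈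
      MvPolynomial.zeroLocus ℂ Q := by
  convert hQ.scale_mem c (u / w 0) hc (div_ne_zero hu hw) z w h using 2
  ext i
  fin_cases i
  · simp [hw]
  · simp; ring

/-- On a component without points over `[1 : 0]` the ratio `w₀ / w₁` is bounded. -/
theorem IsConeComponent.exists_norm_le_of_forall_ne (hQ : IsConeComponent f g Q)
    (h0 : ∀ z w, Sum.elim z w ∈ MvPolynomial.zeroLocus ℂ Q → w 1 = 0 → w 0 = 0) :
    ∃ r : ℝ, 0 < r ∧ ∀ z w, Sum.elim z w ∈ MvPolynomial.zeroLocus ℂ Q → r * ‖w 0‖ ≤ ‖w 1‖ := by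
  let φ : ℂ → (Coord N M ⊕ Fin 2 → ℂ) := fun u => Sum.elim 0 ![1, u]
  have hφ : Continuous φ := continuous_pi (by
    rintro (i | i)
    · simp [φ]; fun_prop
    · fin_cases i <;> simp [φ] <;> fun_prop)
  have hopen : IsOpen (φ ⁻¹' MvPolynomial.zeroLocus ℂ Q)ᶜ :=
    ((isClosed_zeroLocus Q).preimage hφ).isOpen_compl
  have hmem : (0 : ℂ) ∈ (φ ⁻¹' MvPolynomial.zeroLocus ℂ Q)ᶜ := fun h => by
    have := h0 _ _ h rfl
    simp at this
  obtain ⟨r, hr, hball⟩ := Metric.isOpen_iff.mp hopen 0 hmem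
  refine ⟨r, hr, fun z w h => ?_⟩
  by_cases hw : w 0 = 0
  · rw [hw, norm_zero, mul_zero]
    exact norm_nonneg _
  by_contra! hlt
  have h1 := hQ.zero_mem (hQ.normalize h hw one_ne_zero one_ne_zero)
  refine hball (a := 1 * w 1 / w 0) ?_ h1
  rw [mem_ball_zero_iff, one_mul, norm_div, div_lt_iff₀ (norm_pos_iff.mpr hw)]
  exact hlt

/-- If the linear forms `α` have no common nontrivial zero `z` on the part of the component over
`[1 : 0]`, then `‖z‖` is bounded by a multiple of `‖α z‖` near this part, by compactness. -/
theorem IsConeComponent.exists_norm_le_of_ker (hQ : IsConeComponent f g Q) {d : ℕ}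
    (α : (Coord N M → ℂ) →ₗ[ℂ] (Fin d → ℂ))
    (hα : ∀ z w, Sum.elim z w ∈ MvPolynomial.zeroLocus ℂ Q → w 1 = 0 → w 0 ≠ 0 → α z = 0 → z = 0) :
    ∃ r A : ℝ, 0 < r ∧ 0 < A ∧ ∀ z w, Sum.elim z w ∈ MvPolynomial.zeroLocus ℂ Q → w 0 ≠ 0 →
      ‖w 1‖ ≤ r * ‖w 0‖ → ‖z‖ ≤ A * ‖α z‖ := by
  let φ : (Coord N M → ℂ) × ℂ → (Coord N M ⊕ Fin 2 → ℂ) := fun p => Sum.elim p.1 ![1, p.2]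
  have hφ : Continuous φ := continuous_pi (by
    rintro (i | i)
    · simp [φ]; fun_prop
    · fin_cases i <;> simp [φ] <;> fun_prop)
  let S : Set ((Coord N M → ℂ) × ℂ) :=
    (Metric.sphere 0 1 ×ˢ Metric.closedBall 0 1) ∩ φ ⁻¹' MvPolynomial.zeroLocus ℂ Q
  have hS : IsCompact S := ((isCompact_sphere _ _).prod (isCompact_closedBall _ _)).inter_right
    ((isClosed_zeroLocus Q).preimage hφ)
  have hcont : Continuous fun p : (Coord N M → ℂ) × ℂ => max ‖α p.1‖ ‖p.2‖ := by
    have := α.continuous_of_finiteDimensional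
    fun_prop
  obtain ⟨m, hm, hmS⟩ : ∃ m : ℝ, 0 < m ∧ ∀ p ∈ S, m ≤ max ‖α p.1‖ ‖p.2‖ := by
    rcases S.eq_empty_or_nonempty with he | hne
    · exact ⟨1, one_pos, by simp [he]⟩
    obtain ⟨p, hp, hmin⟩ := hS.exists_isMinOn hne hcont.continuousOn
    refine ⟨max ‖α p.1‖ ‖p.2‖, ?_, fun q hq => hmin hq⟩
    by_contra! hle
    have h1 : ‖α p.1‖ ≤ 0 := (le_max_left _ _).trans hle
    have h2 : ‖p.2‖ ≤ 0 := (le_max_right _ _).trans hle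
    have := hα p.1 ![1, p.2] hp.2 (by simpa using h2) (by simp) (by simpa using h1)
    have h3 := hp.1.1
    simp [this] at h3
  refine ⟨min 1 (m / 2), m⁻¹, by positivity, by positivity, fun z w h hw hle => ?_⟩
  by_cases hz : z = 0
  · simp [hz]
  have hz' : 0 < ‖z‖ := norm_pos_iff.mpr hz
  have hle' : ‖1 * w 1 / w 0‖ ≤ min 1 (m / 2) := by
    rw [one_mul, norm_div]
    exact (div_le_iff₀ (norm_pos_iff.mpr hw)).mpr hle
  have h1 := hmS ((‖z‖ : ℂ)⁻¹ • z, 1 * w 1 / w 0) ⟨⟨?_, ?_⟩,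
    hQ.normalize h hw (inv_ne_zero (by exact_mod_cast hz'.ne')) one_ne_zero⟩
  · rcases le_max_iff.mp h1 with h2 | h2
    · simp only [map_smul, norm_smul, norm_inv, Complex.norm_real, norm_norm] at h2
      rw [inv_mul_eq_div, le_div_iff₀ hm]
      rw [inv_mul_eq_div, le_div_iff₀ hz'] at h2
      linarith
    · have h3 := h2.trans (hle'.trans (min_le_right _ _))
      linarith
  · simp [norm_smul, hz'.ne']
  · simpa using hle'.trans (min_le_left _ _)

/-- The functions `w₀, w₁, α₁, …, α_d` on the zero locus of `Q`. -/
def projectionFamily (Q : Ideal (MvPolynomial (Coord N M ⊕ Fin 2) ℂ)) {d : ℕ}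
    (α : (Coord N M → ℂ) →ₗ[ℂ] (Fin d → ℂ)) :
    Fin 2 ⊕ Fin d → MvPolynomial (Coord N M ⊕ Fin 2) ℂ ⧸ Q := fun j =>
  Ideal.Quotient.mk Q (Sum.elim (fun i => MvPolynomial.X (Sum.inr i))
    (fun i => linearPolynomial Sum.inl (LinearMap.proj i ∘ₗ α)) j)

theorem zeroLocusEval_aeval_projectionFamily {d : ℕ} (α : (Coord N M → ℂ) →ₗ[ℂ] (Fin d → ℂ))
    {z : Coord N M → ℂ} {w : Fin 2 → ℂ} (h : Sum.elim z w ∈ MvPolynomial.zeroLocus ℂ Q)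
    (F : MvPolynomial (Fin 2 ⊕ Fin d) ℂ) :
    zeroLocusEval h (MvPolynomial.aeval (projectionFamily Q α) F) =
      MvPolynomial.eval (Sum.elim w (α z)) F := by
  have : (zeroLocusEval h).comp (MvPolynomial.aeval (projectionFamily Q α)) =
      MvPolynomial.aeval (R := ℂ) (Sum.elim w (α z)) := by
    refine MvPolynomial.algHom_ext fun j => ?_
    rw [AlgHom.comp_apply, MvPolynomial.aeval_X, MvPolynomial.aeval_X, projectionFamily,
      zeroLocusEval_mk]
    rcases j with j | j
    · exact MvPolynomial.aeval_X _ _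
    · exact aeval_linearPolynomial _ _ _
  rw [← AlgHom.comp_apply, this, MvPolynomial.aeval_eq_eval]

/-- If the functions `w₀, w₁, α₁, …, α_d` satisfy a relation not divisible by `w₁`, then fewer
linear forms suffice: the homogeneous components in `α` of the restriction of the relation to
`w₁ = 0` vanish on the values of `α` over `[1 : 0]`, so that these values avoid the line through
some point `a`, along which one can project. -/
theorem IsConeComponent.exists_linearMap_of_relation (hQ : IsConeComponent f g Q) {d : ℕ}
    (α : (Coord N M → ℂ) →ₗ[ℂ] (Fin d → ℂ))
    (hα : ∀ z w, Sum.elim z w ∈ MvPolynomial.zeroLocus ℂ Q → w 1 = 0 → w 0 ≠ 0 → α z = 0 → z = 0)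
    (hne : ∃ z w, Sum.elim z w ∈ MvPolynomial.zeroLocus ℂ Q ∧ w 1 = 0 ∧ w 0 ≠ 0)
    {F : MvPolynomial (Fin 2 ⊕ Fin d) ℂ} (hF : ¬ MvPolynomial.X (Sum.inl 1) ∣ F)
    (h0 : MvPolynomial.aeval (projectionFamily Q α) F = 0) :
    ∃ d', d' < d ∧ ∃ β : (Coord N M → ℂ) →ₗ[ℂ] (Fin d' → ℂ), ∀ z w,
      Sum.elim z w ∈ MvPolynomial.zeroLocus ℂ Q → w 1 = 0 → w 0 ≠ 0 → β z = 0 → z = 0 := by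
  obtain ⟨p, hp1, hp0, hpF⟩ := MvPolynomial.exists_eval_ne_zero_of_not_X_dvd
    (j := Sum.inl 0) (by simp) hF
  -- the restriction of the relation to `w = (u, 0)`
  let G : MvPolynomial (Fin d) ℂ := MvPolynomial.aeval
    (Sum.elim (fun i => MvPolynomial.C (p (Sum.inl i))) MvPolynomial.X) F
  have hG : ∀ a, MvPolynomial.eval a G =
      MvPolynomial.eval (Sum.elim (fun i => p (Sum.inl i)) a) F := by
    intro a
    have : (MvPolynomial.aeval a).comp (MvPolynomial.aeval
        (Sum.elim (fun i => MvPolynomial.C (p (Sum.inl i))) MvPolynomial.X)) =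
        MvPolynomial.aeval (R := ℂ) (Sum.elim (fun i => p (Sum.inl i)) a) := by
      refine MvPolynomial.algHom_ext fun k => ?_
      rcases k with k | k <;> simp
    have := congrArg (fun H => H F) this
    rw [AlgHom.comp_apply, MvPolynomial.aeval_eq_eval, MvPolynomial.aeval_eq_eval] at this
    exact this
  have hG0 : G ≠ 0 := by
    intro h
    apply hpF
    have := hG fun i => p (Sum.inr i)
    rw [h, map_zero] at this
    rw [this]
    congr 2
    ext (k | k) <;> rfl
  obtain ⟨D, hD⟩ : ∃ D, MvPolynomial.homogeneousComponent D G ≠ 0 := by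
    by_contra! h
    apply hG0
    rw [← MvPolynomial.sum_homogeneousComponent G]
    exact Finset.sum_eq_zero fun k _ => h k
  set G' := MvPolynomial.homogeneousComponent D G
  have hG' : ∀ (c : ℂ) (a : Fin d → ℂ), MvPolynomial.eval (fun i => c * a i) G' =
      c ^ D * MvPolynomial.eval a G' := by
    intro c a
    have := (MvPolynomial.homogeneousComponent_isHomogeneous D G).aeval_mul c a
    rw [MvPolynomial.aeval_eq_eval, MvPolynomial.aeval_eq_eval] at this
    exact this
  have hvan : ∀ z w, Sum.elim z w ∈ MvPolynomial.zeroLocus ℂ Q → w 1 = 0 → w 0 ≠ 0 →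
      MvPolynomial.eval (α z) G' = 0 := by
    intro z w h hw1 hw0
    refine MvPolynomial.eval_homogeneousComponent_eq_zero (fun c hc => ?_) D
    have h1 := zeroLocusEval_aeval_projectionFamily α (hQ.normalize h hw0 hc hp0) F
    rw [h0, map_zero] at h1
    rw [hG, h1]
    congr 2
    ext (k | k)
    · fin_cases k
      · simp
      · simp [hp1, hw1]
    · have : (fun i => c * z i) = c • z := rfl
      simp [this]
  obtain ⟨a, ha⟩ : ∃ a, MvPolynomial.eval a G' ≠ 0 := by
    by_contra! h
    exact hD (MvPolynomial.funext fun x => by rw [h x, map_zero])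
  have hD0 : D ≠ 0 := by
    rintro rfl
    obtain ⟨z, w, hz, hw1, hw0⟩ := hne
    have h1 := hG' 0 a
    have h2 := hG' 0 (α z)
    rw [hvan z w hz hw1 hw0] at h2
    simp only [zero_mul, pow_zero, one_mul] at h1 h2
    exact ha (h1.symm.trans h2)
  have ha0 : a ≠ 0 := by
    rintro rfl
    have := hG' 0 0
    simp only [Pi.zero_apply, mul_zero, zero_pow hD0, zero_mul] at this
    exact ha this
  obtain ⟨d', rfl⟩ : ∃ d', d = d' + 1 := by
    cases d with
    | zero => exact absurd (Subsingleton.elim a 0) ha0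
    | succ d' => exact ⟨d', rfl⟩
  obtain ⟨q, hq⟩ := exists_linearMap_ker_eq_span ha0
  refine ⟨d', Nat.lt_succ_self _, q ∘ₗ α, fun z w h hw1 hw0 hz => hα z w h hw1 hw0 ?_⟩
  obtain ⟨c, hc⟩ := hq (α z) hz
  have h1 := hvan z w h hw1 hw0
  rw [hc, hG'] at h1
  have h2 : c = 0 := by
    by_contra hc0
    exact mul_ne_zero (pow_ne_zero _ hc0) ha h1
  rw [hc, h2]
  ext i
  simp

/-- A minimal family of linear forms without a common nontrivial zero on the part of the component
over `[1 : 0]` is algebraically independent of `w₀` and `w₁`. -/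
theorem IsConeComponent.exists_projection (hQ : IsConeComponent f g Q)
    (hne : ∃ z w, Sum.elim z w ∈ MvPolynomial.zeroLocus ℂ Q ∧ w 1 = 0 ∧ w 0 ≠ 0) :
    ∃ (d : ℕ) (α : (Coord N M → ℂ) →ₗ[ℂ] (Fin d → ℂ)),
      AlgebraicIndependent ℂ (projectionFamily Q α) ∧
      ∀ z w, Sum.elim z w ∈ MvPolynomial.zeroLocus ℂ Q → w 1 = 0 → w 0 ≠ 0 → α z = 0 → z = 0 := by
  classical
  have hQp := hQ.isPrime
  have hex : ∃ d, ∃ α : (Coord N M → ℂ) →ₗ[ℂ] (Fin d → ℂ), ∀ z w,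
      Sum.elim z w ∈ MvPolynomial.zeroLocus ℂ Q → w 1 = 0 → w 0 ≠ 0 → α z = 0 → z = 0 := by
    let e := Fintype.equivFin (Coord N M)
    refine ⟨Fintype.card (Coord N M), LinearMap.funLeft ℂ ℂ e.symm, fun z w _ _ _ h => ?_⟩
    exact LinearMap.funLeft_injective_of_surjective ℂ ℂ _ e.symm.surjective
      (h.trans (map_zero _).symm)
  obtain ⟨α, hα⟩ := Nat.find_spec hex
  refine ⟨Nat.find hex, α, ?_, hα⟩
  rw [algebraicIndependent_iff]
  intro F
  induction hn : F.totalDegree using Nat.strong_induction_on generalizing F with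
  | _ n ih =>
    intro h0
    -- as `w₁` is not a zero divisor, a factor `w₁` of a relation can be cancelled
    by_cases hdvd : MvPolynomial.X (Sum.inl 1) ∣ F
    · obtain ⟨F', rfl⟩ := hdvd
      by_cases hF' : F' = 0
      · rw [hF', mul_zero]
      rw [map_mul, MvPolynomial.aeval_X] at h0
      have h1 : MvPolynomial.aeval (projectionFamily Q α) F' = 0 := by
        refine (mul_eq_zero.mp h0).resolve_left fun h => hQ.w_notMem 1 ?_
        exact Ideal.Quotient.eq_zero_iff_mem.mp h
      refine absurd (ih F'.totalDegree ?_ F' rfl h1) hF'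
      rw [← hn, MvPolynomial.totalDegree_mul_of_isDomain (MvPolynomial.X_ne_zero _) hF',
        MvPolynomial.totalDegree_X]
      omega
    · obtain ⟨d', hd', hβ⟩ := hQ.exists_linearMap_of_relation α hα hne hdvd h0
      exact absurd hβ (Nat.find_min hex hd')

/-- A form of Noether normalization near `w₁ = 0`: the coordinates `w₀` and `w₁` are part of a
transcendence basis `y`, and for `|w₁| ≤ r |w₀|` the norm of `z` is bounded by the values of the
functions in the basis other than `w₁`. -/
theorem IsConeComponent.exists_transcendenceBasis (hQ : IsConeComponent f g Q)
    (hne : ∃ z w, Sum.elim z w ∈ MvPolynomial.zeroLocus ℂ Q ∧ w 1 = 0 ∧ w 0 ≠ 0) :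
    ∃ (τ : Type) (_ : Fintype τ) (y : τ → MvPolynomial (Coord N M ⊕ Fin 2) ℂ ⧸ Q) (i₀ i₁ : τ)
      (r A : ℝ),
      i₀ ≠ i₁ ∧ IsTranscendenceBasis ℂ y ∧
      y i₀ = Ideal.Quotient.mk Q (MvPolynomial.X (Sum.inr 0)) ∧
      y i₁ = Ideal.Quotient.mk Q (MvPolynomial.X (Sum.inr 1)) ∧ 0 < r ∧ 0 < A ∧
      ∀ z w z' w' (h : Sum.elim z w ∈ MvPolynomial.zeroLocus ℂ Q)
        (h' : Sum.elim z' w' ∈ MvPolynomial.zeroLocus ℂ Q), w' 0 ≠ 0 → ‖w' 1‖ ≤ r * ‖w' 0‖ →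
        (∀ j, j ≠ i₁ → zeroLocusEval h' (y j) = zeroLocusEval h (y j)) → ‖z'‖ ≤ A * ‖z‖ := by
  classical
  have hQp := hQ.isPrime
  obtain ⟨d, α, hind, hα⟩ := hQ.exists_projection hne
  obtain ⟨r, A, hr, hA, hbound⟩ := hQ.exists_norm_le_of_ker α hα
  let s := Set.range (projectionFamily Q α)
  let t := s ∪ Set.range fun i => Ideal.Quotient.mk Q (MvPolynomial.X i)
  have ht : Algebra.adjoin ℂ t = ⊤ := by
    rw [eq_top_iff]
    rintro x -
    obtain ⟨p, rfl⟩ := Ideal.Quotient.mk_surjective x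
    have : (⊤ : Subalgebra ℂ (MvPolynomial (Coord N M ⊕ Fin 2) ℂ)).map
        (Ideal.Quotient.mkₐ ℂ Q) ≤ Algebra.adjoin ℂ t := by
      rw [← MvPolynomial.adjoin_range_X, AlgHom.map_adjoin, ← Set.range_comp]
      exact Algebra.adjoin_mono Set.subset_union_right
    exact this ⟨p, trivial, rfl⟩
  have halg : Algebra.IsAlgebraic (Algebra.adjoin ℂ t)
      (MvPolynomial (Coord N M ⊕ Fin 2) ℂ ⧸ Q) := by
    refine ⟨fun x => ?_⟩
    exact isAlgebraic_algebraMap (⟨x, ht ▸ trivial⟩ : Algebra.adjoin ℂ t)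
  obtain ⟨u, hsu, hut, hu⟩ := exists_isTranscendenceBasis_between s t Set.subset_union_left
    hind.to_subtype_range
  have hufin : u.Finite := ((Set.finite_range _).union (Set.finite_range _)).subset hut
  let k : Fin 2 ⊕ Fin d → u := fun j => ⟨projectionFamily Q α j, hsu ⟨j, rfl⟩⟩
  have hk : Function.Injective k := fun a b h => hind.injective (congrArg Subtype.val h)
  let α' := LinearMap.toContinuousLinearMap α
  refine ⟨u, hufin.fintype, Subtype.val, k (Sum.inl 0), k (Sum.inl 1), r, A * (‖α'‖ + 1),
    fun h => ?_, hu, rfl, rfl, hr, by positivity, fun z w z' w' h h' hw hle heq => ?_⟩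
  · have := hk h
    simp at this
  · have h1 : α z' = α z := by
      ext i
      have h2 := zeroLocusEval_aeval_projectionFamily α h (MvPolynomial.X (Sum.inr i))
      have h3 := zeroLocusEval_aeval_projectionFamily α h' (MvPolynomial.X (Sum.inr i))
      rw [MvPolynomial.aeval_X, MvPolynomial.eval_X] at h2 h3
      have h4 := heq (k (Sum.inr i)) fun h => by simpa using hk h
      rw [h2, h3] at h4
      exact h4
    refine (hbound z' w' h' hw hle).trans ?_
    rw [mul_assoc, h1]
    refine mul_le_mul_of_nonneg_left ((α'.le_opNorm z).trans ?_) hA.le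
    nlinarith [norm_nonneg z]

end Projection

/-! ### Analytic sections at generic points -/

section LocalSection

/-- Primitive element theorem with cleared denominators: finitely many elements `x i` of an
algebraic extension `R` of `P` are, up to a common denominator `D` in `P`, polynomials in an
integral element `θ` of `R`. -/
theorem exists_integral_primitive_element {P R σ : Type} [CommRing P] [IsDomain P] [CharZero P]
    [CommRing R] [IsDomain R] [Algebra P R] [FaithfulSMul P R]
    [Algebra.IsAlgebraic P R] [Finite σ] (x : σ → R) :
    ∃ (θ : R) (D : P) (Ψ : σ → Polynomial P), IsIntegral P θ ∧ D ≠ 0 ∧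
      ∀ i, D • x i = Polynomial.aeval θ (Ψ i) := by
  classical
  have := Fintype.ofFinite σ
  have htf := isTorsionFree_of_faithfulSMul P R
  let K := FractionRing P
  let L := FractionRing R
  let _ : Algebra K L := FractionRing.liftAlgebra P L
  have hKL : Algebra.IsAlgebraic K L := by
    have : Algebra.IsAlgebraic P L := (IsFractionRing.isAlgebraic_iff' P R L).mp inferInstance
    exact ⟨fun a => (IsFractionRing.isAlgebraic_iff P K L).mp (Algebra.IsAlgebraic.isAlgebraic a)⟩
  have hcz : CharZero K := charZero_of_injective_algebraMap (IsFractionRing.injective P K)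
  let E := IntermediateField.adjoin K (Set.range fun i => algebraMap R L (x i))
  have hE : FiniteDimensional K E := by
    have : Finite (Set.range fun i => algebraMap R L (x i)) := Set.finite_range _
    exact IntermediateField.finiteDimensional_adjoin fun a _ => (hKL.isAlgebraic a).isIntegral
  obtain ⟨θ', hθ'⟩ := Field.exists_primitive_element K E
  obtain ⟨a, b, hb, hab⟩ := IsFractionRing.div_surjective (A := R) (θ' : L)
  obtain ⟨c, hc0, b', hb'⟩ := IsAlgebraic.exists_nonzero_dvd (R := P)
    (Algebra.IsAlgebraic.isAlgebraic b) hb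
  obtain ⟨c', hc'0, hc'⟩ :=
    (Algebra.IsAlgebraic.isAlgebraic (R := P) (b' * a)).exists_integral_multiple
  have hinj : Function.Injective (algebraMap P L) := by
    rw [IsScalarTower.algebraMap_eq P R L]
    exact (IsFractionRing.injective R L).comp (FaithfulSMul.algebraMap_injective P R)
  have hcc : algebraMap P L (c' * c) ≠ 0 := fun h => mul_ne_zero hc'0 hc0
    (hinj (h.trans (map_zero _).symm))
  -- `θ` is a multiple of the primitive element
  have hθ : algebraMap R L (c' • (b' * a)) = algebraMap P L (c' * c) * θ' := by
    have hb0 : algebraMap R L b ≠ 0 := fun h => nonZeroDivisors.ne_zero hb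
      (IsFractionRing.injective R L (h.trans (map_zero _).symm))
    rw [← hab, map_mul, IsScalarTower.algebraMap_apply P R L c, hb', Algebra.smul_def, map_mul,
      map_mul, map_mul, ← IsScalarTower.algebraMap_apply]
    rw [mul_assoc, mul_assoc, mul_div_assoc', mul_comm (algebraMap R L b),
      div_mul_cancel₀ _ hb0]
  set θ := c' • (b' * a)
  have hpoly : ∀ i, ∃ q : Polynomial K,
      algebraMap R L (x i) = Polynomial.aeval (algebraMap R L θ) q := by
    intro i
    have h1 : (⟨algebraMap R L (x i), IntermediateField.subset_adjoin _ _ ⟨i, rfl⟩⟩ : E) ∈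
        IntermediateField.adjoin K {θ'} := hθ' ▸ IntermediateField.mem_top
    have h2 : (⟨algebraMap R L (x i), IntermediateField.subset_adjoin _ _ ⟨i, rfl⟩⟩ : E) ∈
        Algebra.adjoin K {θ'} := by
      rw [← IntermediateField.adjoin_simple_toSubalgebra_of_isAlgebraic
        (Algebra.IsAlgebraic.isAlgebraic θ')]
      exact h1
    rw [Algebra.adjoin_singleton_eq_range_aeval] at h2
    obtain ⟨q, hq⟩ := h2
    have h3 : algebraMap R L (x i) = Polynomial.aeval (θ' : L) q := by
      have := congrArg (algebraMap E L) hq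
      change algebraMap E L (Polynomial.aeval θ' q) = _ at this
      rw [← Polynomial.aeval_algebraMap_apply] at this
      exact this.symm
    refine ⟨q.comp (Polynomial.C (algebraMap P K (c' * c))⁻¹ * Polynomial.X), ?_⟩
    rw [h3, Polynomial.aeval_comp]
    congr 1
    rw [map_mul, Polynomial.aeval_C, Polynomial.aeval_X, hθ, map_inv₀,
      ← IsScalarTower.algebraMap_apply, inv_mul_cancel_left₀ hcc]
  choose q hq using hpoly
  have hnorm : ∀ i, ∃ D : P, D ≠ 0 ∧ ∃ Ψ : Polynomial P, D • x i = Polynomial.aeval θ Ψ := by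
    intro i
    obtain ⟨D, hD, h⟩ := IsLocalization.integerNormalization_spec (nonZeroDivisors P) (q i)
    refine ⟨D, nonZeroDivisors.ne_zero hD,
      IsLocalization.integerNormalization (nonZeroDivisors P) (q i), ?_⟩
    apply IsFractionRing.injective R L
    rw [← Polynomial.aeval_algebraMap_apply, ← Polynomial.aeval_map_algebraMap K, h,
      Algebra.smul_def, map_mul, hq i, Algebra.smul_def, map_mul, ← IsScalarTower.algebraMap_apply]
    congr 1
    rw [IsScalarTower.algebraMap_apply P K (Polynomial K), Polynomial.algebraMap_apply]
    simp
    rw [← IsScalarTower.algebraMap_apply]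
  choose D hD0 Ψ hΨ using hnorm
  refine ⟨θ, ∏ i, D i, fun i => Polynomial.C (∏ j ∈ Finset.univ.erase i, D j) * Ψ i, hc',
    Finset.prod_ne_zero_iff.mpr fun i _ => hD0 i, fun i => ?_⟩
  rw [map_mul, Polynomial.aeval_C, ← hΨ, ← Finset.mul_prod_erase _ _ (Finset.mem_univ i),
    Algebra.smul_def, Algebra.smul_def, map_mul]
  ring

theorem aeval_derivative_minpoly_ne_zero {P R : Type} [CommRing P] [IsDomain P] [CharZero P]
    [IsIntegrallyClosed P] [CommRing R] [IsDomain R] [Algebra P R] [FaithfulSMul P R] {θ : R}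
    (hθ : IsIntegral P θ) :
    Polynomial.aeval θ (Polynomial.derivative (minpoly P θ)) ≠ 0 := by
  have htf := isTorsionFree_of_faithfulSMul P R
  intro h
  have hdvd := minpoly.isIntegrallyClosed_dvd hθ h
  have h1 := minpoly.natDegree_pos hθ
  have h2 : Polynomial.derivative (minpoly P θ) ≠ 0 := fun h0 => by
    have := Polynomial.derivative_eq_zero.mp h0
    omega
  have h3 := Polynomial.natDegree_le_of_dvd hdvd h2
  have h4 := Polynomial.natDegree_derivative_lt (p := minpoly P θ) h1.ne'
  omega

variable {σ τ : Type} {Q : Ideal (MvPolynomial σ ℂ)}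

/-- If the coordinates are `Ψ_i(θ) / D`, a relation `F = q` modulo `Q`, with `q` in the base ring,
is preserved when `θ` is specialized to a root `T` of its minimal polynomial at a point `p` of the
base with `D(p) ≠ 0`. -/
theorem aeval_eq_eval_of_root [Q.IsPrime]
    [Algebra (MvPolynomial τ ℂ) (MvPolynomial σ ℂ ⧸ Q)]
    [IsScalarTower ℂ (MvPolynomial τ ℂ) (MvPolynomial σ ℂ ⧸ Q)]
    [FaithfulSMul (MvPolynomial τ ℂ) (MvPolynomial σ ℂ ⧸ Q)]
    {θ : MvPolynomial σ ℂ ⧸ Q} {D : MvPolynomial τ ℂ} {Ψ : σ → Polynomial (MvPolynomial τ ℂ)}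
    (hθ : IsIntegral (MvPolynomial τ ℂ) θ)
    (hΨ : ∀ i, D • Ideal.Quotient.mk Q (MvPolynomial.X i) = Polynomial.aeval θ (Ψ i))
    {p : τ → ℂ} (hp : MvPolynomial.eval p D ≠ 0) {T : ℂ}
    (hT : (minpoly (MvPolynomial τ ℂ) θ).eval₂ (MvPolynomial.eval p) T = 0)
    {F : MvPolynomial σ ℂ} {q : MvPolynomial τ ℂ}
    (hF : Ideal.Quotient.mk Q F = algebraMap (MvPolynomial τ ℂ) _ q) :
    MvPolynomial.aeval (fun i => (Ψ i).eval₂ (MvPolynomial.eval p) T / MvPolynomial.eval p D) F =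
      MvPolynomial.eval p q := by
  have htf := isTorsionFree_of_faithfulSMul (MvPolynomial τ ℂ) (MvPolynomial σ ℂ ⧸ Q)
  obtain ⟨n, H, hH⟩ := MvPolynomial.exists_homogenization F
  let W : Polynomial (MvPolynomial τ ℂ) := MvPolynomial.aeval
    (fun j => Option.elim j (Polynomial.C D) Ψ) H - Polynomial.C (D ^ n * q)
  have hW : Polynomial.aeval θ W = 0 := by
    have h1 := hH (MvPolynomial σ ℂ ⧸ Q) (algebraMap _ _ D) (fun i => Polynomial.aeval θ (Ψ i))
      (fun i => Ideal.Quotient.mk Q (MvPolynomial.X i)) (fun i => by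
        rw [← hΨ, Algebra.smul_def, mul_comm])
    have h2 : MvPolynomial.aeval (fun i => Ideal.Quotient.mk Q (MvPolynomial.X i)) F =
        Ideal.Quotient.mk Q F := by
      have : MvPolynomial.aeval (fun i => Ideal.Quotient.mk Q (MvPolynomial.X i)) =
          Ideal.Quotient.mkₐ ℂ Q := MvPolynomial.algHom_ext fun i => by simp
      rw [this]
      rfl
    have h3 : ((Polynomial.aeval θ).restrictScalars ℂ : Polynomial (MvPolynomial τ ℂ) →ₐ[ℂ] _).comp
        (MvPolynomial.aeval (fun j => Option.elim j (Polynomial.C D) Ψ)) =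
        MvPolynomial.aeval (fun j => Option.elim j (algebraMap _ _ D)
          fun i => Polynomial.aeval θ (Ψ i)) := MvPolynomial.algHom_ext fun j => by
      cases j <;> simp
    have h4 := congrArg (fun G => G H) h3
    rw [AlgHom.comp_apply, h1, h2, hF] at h4
    rw [map_sub, Polynomial.aeval_C, map_mul, map_pow, sub_eq_zero]
    exact h4
  obtain ⟨W', hW'⟩ := minpoly.isIntegrallyClosed_dvd hθ hW
  have h5 : W.eval₂ (MvPolynomial.eval p) T = 0 := by
    rw [hW', Polynomial.eval₂_mul, hT, zero_mul]
  have h6 := hH ℂ (MvPolynomial.eval p D) (fun i => (Ψ i).eval₂ (MvPolynomial.eval p) T)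
    (fun i => (Ψ i).eval₂ (MvPolynomial.eval p) T / MvPolynomial.eval p D)
    (fun i => div_mul_cancel₀ _ hp)
  have h7 : Polynomial.eval₂RingHom (MvPolynomial.eval p) T (MvPolynomial.aeval
        (fun j => Option.elim j (Polynomial.C D) Ψ) H) =
      MvPolynomial.aeval (fun j => Option.elim j (MvPolynomial.eval p D)
        fun i => (Ψ i).eval₂ (MvPolynomial.eval p) T) H := by
    rw [MvPolynomial.map_aeval, MvPolynomial.aeval_def, MvPolynomial.coe_eval₂Hom]
    congr 1
    · ext z
      simp [MvPolynomial.algebraMap_eq, IsScalarTower.algebraMap_apply ℂ (MvPolynomial τ ℂ)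
        (Polynomial (MvPolynomial τ ℂ))]
    · ext j
      cases j <;> simp
  rw [h6] at h7
  rw [Polynomial.eval₂_sub, Polynomial.eval₂_C, map_mul, map_pow, sub_eq_zero] at h5
  exact mul_left_cancel₀ (pow_ne_zero n hp) (h7.symm.trans h5)

/-- Let `y` be a transcendence basis of the coordinate ring of the zero locus of `Q`.  Through a
generic point `ζ₀` there passes an analytic arc `ξ` along which `y i₁` is the parameter and the
other functions of the basis are constant.  It is obtained from the implicit function theorem,
applied to the minimal polynomial of a primitive element `θ`; the polynomial `Δ` is a multiple of
the common denominator and of the discriminant. -/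
theorem exists_analytic_section [Fintype σ] [Q.IsPrime] [Fintype τ] [DecidableEq τ]
    {y : τ → MvPolynomial σ ℂ ⧸ Q} (hy : IsTranscendenceBasis ℂ y) (i₁ : τ) :
    ∃ Δ : MvPolynomial τ ℂ, Δ ≠ 0 ∧ ∀ (ζ₀ : σ → ℂ) (h₀ : ζ₀ ∈ MvPolynomial.zeroLocus ℂ Q),
      MvPolynomial.eval (fun j => zeroLocusEval h₀ (y j)) Δ ≠ 0 →
      ∃ ξ : ℂ → σ → ℂ, ξ (zeroLocusEval h₀ (y i₁)) = ζ₀ ∧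
        AnalyticAt ℂ ξ (zeroLocusEval h₀ (y i₁)) ∧
        ∀ᶠ c in 𝓝 (zeroLocusEval h₀ (y i₁)), ∃ h : ξ c ∈ MvPolynomial.zeroLocus ℂ Q,
          ∀ j, zeroLocusEval h (y j) =
            Function.update (fun j => zeroLocusEval h₀ (y j)) i₁ c j := by
  let _ : Algebra (MvPolynomial τ ℂ) (MvPolynomial σ ℂ ⧸ Q) :=
    (MvPolynomial.aeval y : MvPolynomial τ ℂ →ₐ[ℂ] _).toAlgebra
  have halgMap : ∀ q, algebraMap (MvPolynomial τ ℂ) (MvPolynomial σ ℂ ⧸ Q) q =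
      MvPolynomial.aeval y q := fun _ => rfl
  have : IsScalarTower ℂ (MvPolynomial τ ℂ) (MvPolynomial σ ℂ ⧸ Q) :=
    IsScalarTower.of_algebraMap_eq fun z =>
      ((MvPolynomial.aeval y : MvPolynomial τ ℂ →ₐ[ℂ] _).commutes z).symm
  have : FaithfulSMul (MvPolynomial τ ℂ) (MvPolynomial σ ℂ ⧸ Q) :=
    (faithfulSMul_iff_algebraMap_injective _ _).mpr hy.1
  have hAlg : Algebra.IsAlgebraic (MvPolynomial τ ℂ) (MvPolynomial σ ℂ ⧸ Q) := by
    have := hy.isAlgebraic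
    refine Algebra.IsAlgebraic.of_ringHom_of_comp_eq (S := Algebra.adjoin ℂ (Set.range y))
      (B := MvPolynomial σ ℂ ⧸ Q) hy.1.aevalEquiv (RingHom.id _) hy.1.aevalEquiv.surjective
      Function.injective_id ?_
    exact RingHom.ext fun q => hy.1.algebraMap_aevalEquiv q
  obtain ⟨θ, D, Ψ, hθ, hD, hΨ⟩ := exists_integral_primitive_element (P := MvPolynomial τ ℂ)
    fun i : σ => Ideal.Quotient.mk Q (MvPolynomial.X i)
  obtain ⟨e, he0, b, hb⟩ := IsAlgebraic.exists_nonzero_dvd (R := MvPolynomial τ ℂ)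
    (Algebra.IsAlgebraic.isAlgebraic _)
    (mem_nonZeroDivisors_of_ne_zero (aeval_derivative_minpoly_ne_zero hθ))
  refine ⟨D * e, mul_ne_zero hD he0, fun ζ₀ h₀ hne => ?_⟩
  set p₀ : τ → ℂ := fun j => zeroLocusEval h₀ (y j) with hp₀
  set T₀ := zeroLocusEval h₀ θ
  rw [map_mul] at hne
  have hev : ∀ q,
      zeroLocusEval h₀ (algebraMap (MvPolynomial τ ℂ) _ q) = MvPolynomial.eval p₀ q := by
    intro q
    have : (zeroLocusEval h₀).comp (MvPolynomial.aeval y) = MvPolynomial.aeval p₀ :=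
      MvPolynomial.algHom_ext fun j => by
        rw [AlgHom.comp_apply, MvPolynomial.aeval_X, MvPolynomial.aeval_X]
    rw [halgMap, ← AlgHom.comp_apply, this, MvPolynomial.aeval_eq_eval]
  have hev' : ∀ q : Polynomial (MvPolynomial τ ℂ),
      zeroLocusEval h₀ (Polynomial.aeval θ q) = q.eval₂ (MvPolynomial.eval p₀) T₀ := by
    intro q
    have := Polynomial.hom_eval₂ q (algebraMap (MvPolynomial τ ℂ) (MvPolynomial σ ℂ ⧸ Q))
      (zeroLocusEval h₀ : (MvPolynomial σ ℂ ⧸ Q) →+* ℂ) θ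
    rw [← Polynomial.aeval_def, RingHom.coe_coe] at this
    rw [this]
    congr 1
    exact RingHom.ext hev
  have hder : (Polynomial.derivative (minpoly (MvPolynomial τ ℂ) θ)).eval₂
      (MvPolynomial.eval p₀) T₀ ≠ 0 := by
    intro h
    have := congrArg (zeroLocusEval h₀) hb
    rw [hev, map_mul, hev', h, zero_mul] at this
    exact right_ne_zero_of_mul hne this
  -- the minimal polynomial along the path `γ` in the base
  let γ : ℂ → τ → ℂ := fun c => Function.update p₀ i₁ c
  have hγ : ∀ j, Differentiable ℂ fun c => γ c j := by
    intro j
    by_cases h : j = i₁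
    · subst h; simp only [γ, Function.update_self]; fun_prop
    · simp only [γ, Function.update_of_ne h]; fun_prop
  have hγ₀ : γ (p₀ i₁) = p₀ := Function.update_eq_self ..
  have hcoef : ∀ (q : MvPolynomial τ ℂ) {E : Type} [NormedAddCommGroup E] [NormedSpace ℂ E]
      {φ : E → ℂ} {u : E}, AnalyticAt ℂ φ u →
      AnalyticAt ℂ (fun v => MvPolynomial.eval (γ (φ v)) q) u := by
    intro q E _ _ φ u hφ
    have h1 := AnalyticAt.aeval_mvPolynomial (f := fun v j => γ (φ v) j) (z := u)
      (fun j => ((hγ j).analyticAt (φ u)).comp hφ) q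
    simpa only [MvPolynomial.aeval_eq_eval] using h1
  have hpoly : ∀ (q : Polynomial (MvPolynomial τ ℂ)) {E : Type} [NormedAddCommGroup E]
      [NormedSpace ℂ E] {φ ψ : E → ℂ} {u : E}, AnalyticAt ℂ φ u → AnalyticAt ℂ ψ u →
      AnalyticAt ℂ (fun v => q.eval₂ (MvPolynomial.eval (γ (φ v))) (ψ v)) u := by
    intro q E _ _ φ ψ u hφ hψ
    simp only [Polynomial.eval₂_eq_sum_range]
    exact Finset.analyticAt_fun_sum _ fun k _ => (hcoef _ hφ).mul (hψ.pow k)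
  let F : ℂ × ℂ → ℂ := fun u =>
    (minpoly (MvPolynomial τ ℂ) θ).eval₂ (MvPolynomial.eval (γ u.1)) u.2
  have hF : AnalyticAt ℂ F (p₀ i₁, T₀) := hpoly _ analyticAt_fst analyticAt_snd
  have hF₀ : F (p₀ i₁, T₀) = 0 := by
    change (minpoly (MvPolynomial τ ℂ) θ).eval₂ (MvPolynomial.eval (γ (p₀ i₁))) T₀ = 0
    rw [hγ₀, ← hev', minpoly.aeval, map_zero]
  have cdf : ContDiffAt ℂ ⊤ F (p₀ i₁, T₀) := hF.contDiffAt
  have hinv : (fderiv ℂ F (p₀ i₁, T₀) ∘L .inr ℂ ℂ ℂ).IsInvertible := by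
    have h1 : HasFDerivAt (fun T => F (p₀ i₁, T)) (fderiv ℂ F (p₀ i₁, T₀) ∘L .inr ℂ ℂ ℂ) T₀ :=
      hF.differentiableAt.hasFDerivAt.comp T₀ (hasFDerivAt_prodMk_right (p₀ i₁) T₀)
    have h2 : HasDerivAt (fun T => F (p₀ i₁, T)) ((Polynomial.derivative
        (minpoly (MvPolynomial τ ℂ) θ)).eval₂ (MvPolynomial.eval p₀) T₀) T₀ := by
      have := ((minpoly (MvPolynomial τ ℂ) θ).map (MvPolynomial.eval p₀)).hasDerivAt T₀
      rw [Polynomial.derivative_map, Polynomial.eval_map] at this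
      refine this.congr_of_eventuallyEq (Filter.Eventually.of_forall fun T => ?_)
      change (minpoly (MvPolynomial τ ℂ) θ).eval₂ (MvPolynomial.eval (γ (p₀ i₁))) T = _
      rw [hγ₀]
      exact (Polynomial.eval_map ..).symm
    rw [h1.unique h2.hasFDerivAt]
    refine ⟨ContinuousLinearEquiv.unitsEquivAut ℂ (Units.mk0 _ hder), ?_⟩
    ext
    simp
  have hw : (⊤ : WithTop ℕ∞) ≠ 0 := by simp
  set T := cdf.implicitFunction hw hinv
  have hT₀ : T (p₀ i₁) = T₀ := cdf.implicitFunction_apply_self hw hinv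
  have hT : AnalyticAt ℂ T (p₀ i₁) :=
    (cdf.contDiffAt_implicitFunction hw hinv).analyticAt
  have hDne : ∀ᶠ c in 𝓝 (p₀ i₁), MvPolynomial.eval (γ c) D ≠ 0 := by
    refine (hcoef D analyticAt_id).continuousAt.eventually_ne ?_
    simp only [id, hγ₀]
    exact left_ne_zero_of_mul hne
  refine ⟨fun c i => (Ψ i).eval₂ (MvPolynomial.eval (γ c)) (T c) / MvPolynomial.eval (γ c) D,
    ?_, ?_, ?_⟩
  · ext i
    change (Ψ i).eval₂ (MvPolynomial.eval (γ (p₀ i₁))) (T (p₀ i₁)) / MvPolynomial.eval (γ (p₀ i₁)) D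
      = _
    rw [hγ₀, hT₀, div_eq_iff (left_ne_zero_of_mul hne), ← hev', ← hΨ, Algebra.smul_def, map_mul,
      hev, zeroLocusEval_mk, MvPolynomial.aeval_X, mul_comm]
  · refine AnalyticAt.pi fun i => (hpoly _ analyticAt_id hT).div (hcoef D analyticAt_id) ?_
    change MvPolynomial.eval (γ (p₀ i₁)) D ≠ 0
    rw [hγ₀]
    exact left_ne_zero_of_mul hne
  · filter_upwards [cdf.eventually_apply_implicitFunction hw hinv, hDne] with c hc hDc
    rw [hF₀] at hc
    have hmem :
        (fun i => (Ψ i).eval₂ (MvPolynomial.eval (γ c)) (T c) / MvPolynomial.eval (γ c) D) ∈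
        MvPolynomial.zeroLocus ℂ Q := fun F hFQ => by
      have := aeval_eq_eval_of_root hθ hΨ hDc hc (F := F) (q := 0)
        (by rw [map_zero, Ideal.Quotient.eq_zero_iff_mem.mpr hFQ])
      rwa [map_zero] at this
    refine ⟨hmem, fun j => ?_⟩
    obtain ⟨Y, hY⟩ := Ideal.Quotient.mk_surjective (y j)
    rw [← hY, zeroLocusEval_mk]
    have := aeval_eq_eval_of_root hθ hΨ hDc hc (F := Y) (q := MvPolynomial.X j)
      (by rw [hY, halgMap, MvPolynomial.aeval_X])
    rw [this, MvPolynomial.eval_X]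

end LocalSection

/-! ### The maximum principle on curves -/

section MaximumPrinciple

/-- The function `Φ` is locally on `G` the restriction of an analytic function. -/
def IsAnalyticRestriction {E : Type*} [NormedAddCommGroup E] [NormedSpace ℂ E] (G : Set E)
    (Φ : E → ℂ) : Prop :=
  ∀ ζ ∈ G, ∃ Ψ : E → ℂ, AnalyticAt ℂ Ψ ζ ∧ Φ =ᶠ[𝓝[G] ζ] Ψ

theorem IsAnalyticRestriction.continuousOn {E : Type*} [NormedAddCommGroup E] [NormedSpace ℂ E]
    {G : Set E} {Φ : E → ℂ} (h : IsAnalyticRestriction G Φ) : ContinuousOn Φ G := by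
  intro ζ hζ
  obtain ⟨Ψ, hΨ, he⟩ := h ζ hζ
  exact hΨ.continuousAt.continuousWithinAt.congr_of_eventuallyEq he (he.self_of_nhdsWithin hζ)

theorem IsAnalyticRestriction.analyticAt_comp {E E' : Type*} [NormedAddCommGroup E]
    [NormedSpace ℂ E] [NormedAddCommGroup E'] [NormedSpace ℂ E'] {G : Set E} {Φ : E → ℂ}
    (h : IsAnalyticRestriction G Φ) {ξ : E' → E} {c : E'} (hξ : AnalyticAt ℂ ξ c) (hc : ξ c ∈ G)
    (hG : ∀ᶠ c' in 𝓝 c, ξ c' ∈ G) : AnalyticAt ℂ (fun c' => Φ (ξ c')) c := by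
  obtain ⟨Ψ, hΨ, he⟩ := h _ hc
  have h1 : Filter.Tendsto ξ (𝓝 c) (𝓝[G] (ξ c)) :=
    tendsto_nhdsWithin_iff.mpr ⟨hξ.continuousAt, hG⟩
  exact (hΨ.comp hξ).congr (Filter.EventuallyEq.symm (h1.eventually he))

theorem le_of_forall_pow_mul_le {a C s S : ℝ} (hC : 0 ≤ C) (hs : 0 < s)
    (h : ∀ n : ℕ, a ^ n * s ≤ C ^ n * S) : a ≤ C := by
  by_contra! hlt
  have ha : 0 < a := hC.trans_lt hlt
  have h1 : Filter.Tendsto (fun n : ℕ => (C / a) ^ n * S) Filter.atTop (𝓝 (0 * S)) :=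
    (tendsto_pow_atTop_nhds_zero_of_lt_one (by positivity) ((div_lt_one ha).mpr hlt)).mul_const S
  have h2 : s ≤ 0 * S := ge_of_tendsto' h1 fun n => by
    rw [div_pow, div_mul_eq_mul_div, le_div_iff₀ (by positivity), mul_comm]
    exact h n
  linarith

/-- Every complex number is a limit of complex numbers of larger modulus. -/
theorem Complex.frequently_norm_lt_norm (c : ℂ) : ∃ᶠ z in 𝓝 c, ‖c‖ < ‖z‖ := by
  let φ : ℝ → ℂ := fun t => if c = 0 then (t : ℂ) else (1 + t) * c
  have hφ : Filter.Tendsto φ (𝓝[>] 0) (𝓝 c) := by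
    have hcont : Continuous φ := by
      by_cases hc : c = 0 <;> simp only [φ, hc, if_true, if_false] <;> fun_prop
    have h0 : φ 0 = c := by by_cases hc : c = 0 <;> simp [φ, hc]
    exact (h0 ▸ hcont.tendsto 0).mono_left nhdsWithin_le_nhds
  refine hφ.frequently (Filter.Eventually.frequently ?_)
  filter_upwards [self_mem_nhdsWithin] with t (ht : 0 < t)
  by_cases hc : c = 0
  · simp [φ, hc, ht.ne']
  · have : ‖(1 + t : ℂ)‖ = 1 + t := by
      rw [← Complex.ofReal_one, ← Complex.ofReal_add, Complex.norm_real, Real.norm_of_nonneg]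
      positivity
    simp only [φ, hc, if_false, norm_mul, this]
    have := norm_pos_iff.mpr hc
    nlinarith

variable {σ τ : Type} {Q : Ideal (MvPolynomial σ ℂ)}

/-- The maximum principle on the curves of the zero locus of `Q` on which all functions of the
transcendence basis `y` but `y i₁` are constant.  If the part `|y i₁| ≤ ρ` of such a curve is
bounded and a function `Φ` which is analytic on it is bounded by `C` for `|y i₁| = ρ`, then it is
bounded by `C` at the points at which `Δ` does not vanish.  As the curve need not be the graph of
an analytic function of `y i₁` at the finitely many zeros of `Δ`, the maximum principle is applied
to the product of `Φ ^ n` and `Δ`, and `n` tends to infinity. -/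
theorem norm_le_of_norm_le_boundary [Fintype σ] [Q.IsPrime] [Fintype τ] [DecidableEq τ]
    {y : τ → MvPolynomial σ ℂ ⧸ Q} (hy : IsTranscendenceBasis ℂ y) (i₁ : τ) :
    ∃ Δ : MvPolynomial τ ℂ, Δ ≠ 0 ∧ ∀ (G : Set (σ → ℂ)) (Φ : (σ → ℂ) → ℂ),
      IsAnalyticRestriction G Φ → ∀ (ρ C B : ℝ), 0 ≤ C →
      ∀ (ζ₀ : σ → ℂ) (h₀ : ζ₀ ∈ MvPolynomial.zeroLocus ℂ Q),
        MvPolynomial.eval (fun j => zeroLocusEval h₀ (y j)) Δ ≠ 0 →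
        ‖zeroLocusEval h₀ (y i₁)‖ ≤ ρ →
        (∀ (ζ : σ → ℂ) (h : ζ ∈ MvPolynomial.zeroLocus ℂ Q),
          (∀ j, j ≠ i₁ → zeroLocusEval h (y j) = zeroLocusEval h₀ (y j)) →
          ‖zeroLocusEval h (y i₁)‖ ≤ ρ →
          ‖ζ‖ ≤ B ∧ ζ ∈ G ∧ (‖zeroLocusEval h (y i₁)‖ = ρ → ‖Φ ζ‖ ≤ C)) →
        ‖Φ ζ₀‖ ≤ C := by
  obtain ⟨Δ, hΔ, hsec⟩ := exists_analytic_section hy i₁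
  refine ⟨Δ, hΔ, fun G Φ hΦ ρ C B hC ζ₀ h₀ hΔ₀ hρ hZ => ?_⟩
  choose Y hY using fun j => Ideal.Quotient.mk_surjective (y j)
  have hYe : ∀ {ζ} (h : ζ ∈ MvPolynomial.zeroLocus ℂ Q) j,
      zeroLocusEval h (y j) = MvPolynomial.aeval ζ (Y j) := fun h j => by
    rw [← hY, zeroLocusEval_mk]
  simp only [hYe] at hsec hΔ₀ hρ hZ
  set p₀ : τ → ℂ := fun j => MvPolynomial.aeval ζ₀ (Y j)
  let u : (σ → ℂ) → ℂ := fun ζ => MvPolynomial.aeval ζ (Y i₁)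
  have hu : Continuous u := (Y i₁).continuous_eval
  let q : ℂ → ℂ := fun c => MvPolynomial.eval (Function.update p₀ i₁ c) Δ
  have hq : ∀ c, AnalyticAt ℂ q c := fun c => by
    have := AnalyticAt.aeval_mvPolynomial (𝕜 := ℂ)
      (f := fun (c : ℂ) j => Function.update p₀ i₁ c j) (z := c)
      (fun j => by
        by_cases h : j = i₁
        · subst h; simp only [Function.update_self]; exact analyticAt_id
        · simp only [Function.update_of_ne h]; exact analyticAt_const) Δ
    simpa only [MvPolynomial.aeval_eq_eval] using this
  have hqc : Continuous q := continuous_iff_continuousAt.mpr fun c => (hq c).continuousAt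
  let K : Set (σ → ℂ) := {ζ | ζ ∈ MvPolynomial.zeroLocus ℂ Q ∧
    (∀ j, j ≠ i₁ → MvPolynomial.aeval ζ (Y j) = p₀ j) ∧ ‖u ζ‖ ≤ ρ}
  have hKG : K ⊆ G := fun ζ hζ => (hZ ζ hζ.1 hζ.2.1 hζ.2.2).2.1
  have hK : IsCompact K := by
    refine Metric.isCompact_of_isClosed_isBounded ?_ ?_
    · refine (isClosed_zeroLocus Q).and (IsClosed.and ?_ (isClosed_le hu.norm continuous_const))
      have : {ζ : σ → ℂ | ∀ j, j ≠ i₁ → MvPolynomial.aeval ζ (Y j) = p₀ j} =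
          ⋂ j, ⋂ (_ : j ≠ i₁), {ζ | MvPolynomial.aeval ζ (Y j) = p₀ j} := by
        ext ζ
        simp
      rw [this]
      exact isClosed_iInter fun j => isClosed_iInter fun _ =>
        isClosed_eq (Y j).continuous_eval continuous_const
    · exact (Metric.isBounded_closedBall (x := 0) (r := B)).subset fun ζ hζ =>
        mem_closedBall_zero_iff.mpr (hZ ζ hζ.1 hζ.2.1 hζ.2.2).1
  have hmem₀ : ζ₀ ∈ K := ⟨h₀, fun _ _ => rfl, hρ⟩
  have hpt : ∀ ζ ∈ K, (fun j => MvPolynomial.aeval ζ (Y j)) = Function.update p₀ i₁ (u ζ) := by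
    intro ζ hζ
    ext j
    by_cases h : j = i₁
    · subst h; rw [Function.update_self]
    · rw [Function.update_of_ne h, hζ.2.1 j h]
  obtain ⟨S, hS⟩ := ((isCompact_closedBall (0 : ℂ) ρ).image hqc.norm).bddAbove
  have hq₀ : 0 < ‖q (u ζ₀)‖ := by
    rw [norm_pos_iff]
    change MvPolynomial.eval (Function.update p₀ i₁ (u ζ₀)) Δ ≠ 0
    rwa [← hpt ζ₀ hmem₀]
  refine le_of_forall_pow_mul_le hC hq₀ (S := S) fun n => ?_
  let g : (σ → ℂ) → ℂ := fun ζ => Φ ζ ^ n * q (u ζ)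
  have hg : ContinuousOn g K := ((hΦ.continuousOn.mono hKG).pow n).mul
    (hqc.comp hu).continuousOn
  obtain ⟨ζ₁, hζ₁, hmax⟩ := hK.exists_isMaxOn ⟨ζ₀, hmem₀⟩ hg.norm
  have hmax' : ∀ ζ ∈ K, ‖g ζ‖ ≤ ‖g ζ₁‖ := fun ζ hζ => hmax hζ
  have hle : ‖Φ ζ₀‖ ^ n * ‖q (u ζ₀)‖ ≤ ‖g ζ₁‖ := by
    have := hmax' ζ₀ hmem₀
    rwa [norm_mul, norm_pow] at this
  have hSnn : 0 ≤ S := (norm_nonneg _).trans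
    (hS ⟨u ζ₀, mem_closedBall_zero_iff.mpr hρ, rfl⟩)
  refine hle.trans ?_
  rcases eq_or_ne (g ζ₁) 0 with h0 | h0
  · rw [h0, norm_zero]
    positivity
  -- among the points where the maximum is attained, choose one with `|u|` as large as possible
  have hKm : IsCompact (K ∩ {ζ | ‖g ζ‖ = ‖g ζ₁‖}) := by
    have := hg.norm.preimage_isClosed_of_isClosed hK.isClosed (isClosed_singleton (x := ‖g ζ₁‖))
    exact hK.of_isClosed_subset this Set.inter_subset_left
  obtain ⟨ζ₂, ⟨hζ₂, hgζ₂⟩, hmax₂⟩ := hKm.exists_isMaxOn ⟨ζ₁, hζ₁, rfl⟩ hu.norm.continuousOn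
  have hgζ₂' : ‖g ζ₂‖ = ‖g ζ₁‖ := hgζ₂
  -- this point lies on the boundary: otherwise `g` is constant near it on an arc of the curve, and
  -- `|u|` increases in some direction on the arc
  have hbd : ‖u ζ₂‖ = ρ := by
    by_contra hne
    have hlt : ‖u ζ₂‖ < ρ := lt_of_le_of_ne hζ₂.2.2 hne
    have hg₂ : g ζ₂ ≠ 0 := by
      rw [← norm_ne_zero_iff, hgζ₂']
      exact norm_ne_zero_iff.mpr h0
    have hq₂ : MvPolynomial.eval (fun j => MvPolynomial.aeval ζ₂ (Y j)) Δ ≠ 0 := by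
      rw [hpt ζ₂ hζ₂]
      exact right_ne_zero_of_mul hg₂
    obtain ⟨ξ, hξ₂, hξ, hξV⟩ := hsec ζ₂ hζ₂.1 hq₂
    have hξK : ∀ᶠ c in 𝓝 (u ζ₂), ξ c ∈ K ∧ u (ξ c) = c := by
      have h1 : ∀ᶠ c in 𝓝 (u ζ₂), ‖c‖ < ρ := continuous_norm.continuousAt.eventually_lt_const hlt
      filter_upwards [hξV, h1] with c hc hcρ
      obtain ⟨hcV, hcY⟩ := hc
      have hcu : u (ξ c) = c := by
        have := hcY i₁
        rwa [Function.update_self] at this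
      refine ⟨⟨hcV, fun j hj => ?_, hcu.symm ▸ hcρ.le⟩, hcu⟩
      rw [hcY j, Function.update_of_ne hj]
      exact hζ₂.2.1 j hj
    have han : AnalyticAt ℂ (fun c => g (ξ c)) (u ζ₂) := by
      have h1 : AnalyticAt ℂ (fun c => Φ (ξ c)) (u ζ₂) :=
        hΦ.analyticAt_comp hξ (by rw [hξ₂]; exact hKG hζ₂) (hξK.mono fun c hc => hKG hc.1)
      refine ((h1.pow n).mul (hq (u ζ₂))).congr ?_
      filter_upwards [hξK] with c hc
      change _ = Φ (ξ c) ^ n * q (u (ξ c))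
      rw [hc.2]
      rfl
    have hlocmax : IsLocalMax (norm ∘ fun c => g (ξ c)) (u ζ₂) := by
      filter_upwards [hξK] with c hc
      change ‖g (ξ c)‖ ≤ ‖g (ξ (u ζ₂))‖
      have h3 : ξ (u ζ₂) = ζ₂ := hξ₂
      rw [h3, hgζ₂']
      exact hmax' _ hc.1
    have hconst := Complex.eventually_eq_of_isLocalMax_norm
      (han.eventually_analyticAt.mono fun c hc => hc.differentiableAt) hlocmax
    obtain ⟨c, hcn, hcK, hcg⟩ :=
      ((Complex.frequently_norm_lt_norm (u ζ₂)).and_eventually (hξK.and hconst)).exists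
    have h3 : ξ (u ζ₂) = ζ₂ := hξ₂
    have h4 : ‖u (ξ c)‖ ≤ ‖u ζ₂‖ := hmax₂ ⟨hcK.1, by
      change ‖g (ξ c)‖ = _
      rw [hcg, h3, hgζ₂']⟩
    rw [hcK.2] at h4
    linarith
  rw [← hgζ₂', norm_mul, norm_pow]
  refine mul_le_mul ?_ (hS ⟨u ζ₂, mem_closedBall_zero_iff.mpr hζ₂.2.2, rfl⟩) (norm_nonneg _)
    (by positivity)
  exact pow_le_pow_left₀ (norm_nonneg _) ((hZ ζ₂ hζ₂.1 hζ₂.2.1 hζ₂.2.2).2.2 hbd) n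

end MaximumPrinciple

/-! ### Homogeneous coordinates on the total space of the deformation -/

section Lift

variable {X : Scheme.{0}} {L : X.Modules} {N M : ℕ} {s : Fin (N + 1) → Γ(L, ⊤)}
  {t : Fin M → Γ(L, ⊤)}

/-- The space of the triples `(x, w, μ)`, the homogeneous coordinates of the points
`([x], [w], μ x ⊗ w)`. -/
abbrev HomCoord (N M : ℕ) : Type := (Coord N M → ℂ) × (Fin 2 → ℂ) × ℂ

variable (L s t) in
/-- The triples `(x, w, μ)` which are homogeneous coordinates of a point of the total space. -/
def coordSet : Set (HomCoord N M) := {q | q.1 ≠ 0 ∧ q.2.1 ≠ 0 ∧ (q.1, q.2.1) ∈ coneSet L s t}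

/-- The point with given homogeneous coordinates. -/
def coordPoint (q : HomCoord N M) (hq : q ∈ coordSet L s t) : DeformationTotalSpace L s t :=
  ⟨SegreTotalSpace.mk q.1 hq.1 q.2.1 hq.2.1 q.2.2, (mem_deformation_iff hq.1 hq.2.1).mpr hq.2.2⟩

theorem exists_coordPoint_eq (z : DeformationTotalSpace L s t) :
    ∃ q, ∃ hq : q ∈ coordSet L s t, z = coordPoint q hq := by
  obtain ⟨⟨_, x, hx, w, hw, μ, rfl⟩, hz⟩ := z
  exact ⟨(x, w, μ), ⟨hx, hw, (mem_deformation_iff hx hw).mp hz⟩, rfl⟩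

theorem coordPoint_congr {q q' : HomCoord N M} (hq : q ∈ coordSet L s t)
    (hq' : q' ∈ coordSet L s t) {a b : ℂ} (ha : a ≠ 0) (hb : b ≠ 0) (h1 : q'.1 = a • q.1)
    (h2 : q'.2.1 = b • q.2.1) (h3 : q.2.2 = a * b * q'.2.2) :
    coordPoint q hq = coordPoint q' hq' := by
  obtain ⟨x, w, μ⟩ := q
  obtain ⟨x', w', μ'⟩ := q'
  dsimp only at h1 h2 h3
  subst h1 h2 h3
  refine Subtype.ext (Subtype.ext (Prod.ext ?_ (Prod.ext ?_ ?_)))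
  · exact (Projectivization.mk_eq_mk_iff' ℂ _ _ _ _).mpr ⟨a⁻¹, inv_smul_smul₀ ha x⟩
  · exact (Projectivization.mk_eq_mk_iff' ℂ _ _ _ _).mpr ⟨b⁻¹, inv_smul_smul₀ hb w⟩
  · ext i j
    simp only [coordPoint, SegreTotalSpace.mk, Matrix.smul_apply, Matrix.vecMulVec_apply,
      Pi.smul_apply, smul_eq_mul]
    ring

open Classical in
/-- A function on the total space in terms of homogeneous coordinates, extended by zero. -/
def coordLift (f : DeformationTotalSpace L s t → ℂ) (q : HomCoord N M) : ℂ :=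
  if hq : q ∈ coordSet L s t then f (coordPoint q hq) else 0

theorem coordLift_of_mem (f : DeformationTotalSpace L s t → ℂ) {q : HomCoord N M}
    (hq : q ∈ coordSet L s t) : coordLift f q = f (coordPoint q hq) := dif_pos hq

theorem coordLift_congr (f : DeformationTotalSpace L s t → ℂ) {q q' : HomCoord N M}
    (hq : q ∈ coordSet L s t) (hq' : q' ∈ coordSet L s t) {a b : ℂ} (ha : a ≠ 0) (hb : b ≠ 0)
    (h1 : q'.1 = a • q.1) (h2 : q'.2.1 = b • q.2.1) (h3 : q.2.2 = a * b * q'.2.2) :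
    coordLift f q = coordLift f q' := by
  rw [coordLift_of_mem f hq, coordLift_of_mem f hq', coordPoint_congr hq hq' ha hb h1 h2 h3]

theorem mem_holomorphic_iff {f : DeformationTotalSpace L s t → ℂ} :
    f ∈ DeformationTotalSpace.holomorphic L s t ↔
      IsAnalyticRestriction (coordSet L s t) (coordLift f) := by
  constructor
  · rintro h ⟨x, w, μ⟩ hq
    obtain ⟨G, hG, he⟩ := h x hq.1 w hq.2.1 μ ((mem_deformation_iff hq.1 hq.2.1).mpr hq.2.2)
    refine ⟨G, hG, ?_⟩
    filter_upwards [mem_nhdsWithin_of_mem_nhds he, self_mem_nhdsWithin] with q' h1 h2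
    rw [coordLift_of_mem f h2]
    exact h1 h2.1 h2.2.1 _
  · intro h x hx w hw μ hmem
    obtain ⟨G, hG, he⟩ := h (x, w, μ) ⟨hx, hw, (mem_deformation_iff hx hw).mp hmem⟩
    refine ⟨G, hG, ?_⟩
    filter_upwards [eventually_nhdsWithin_iff.mp he] with q' h1 hx' hw' hmem'
    have hq' : q' ∈ coordSet L s t := ⟨hx', hw', (mem_deformation_iff hx' hw').mp hmem'⟩
    rw [← h1 hq', coordLift_of_mem f hq']
    rfl

end Lift

/-! ### Estimates from discs bounded by the orbit -/

section UnitOrbit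

variable {X : Scheme.{0}} {L : X.Modules} {N M : ℕ} {s : Fin (N + 1) → Γ(L, ⊤)}
  {t : Fin M → Γ(L, ⊤)}

theorem coordVec_smul (c : ℂ) (v : TotalSpace L) : coordVec s t (c • v) = c • coordVec s t v := by
  ext (i | i) <;> rfl

/-- For `|w₀| = |w₁| = 1` the point is the translate, by `w₀ / w₁`, of the point `w₁² v` of the
tube. -/
theorem mem_unitOrbit_of_norm_eq_one
    (hmove : ∀ (v : TotalSpace L) w, (moveVec w (coordVec s t v), w) ∈ coneSet L s t)
    {T : Set (TotalSpace L)} (hT : ∀ c : ℂ, ‖c‖ ≤ 1 → ∀ v ∈ T, c • v ∈ T)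
    {v : TotalSpace L} (hv : v ∈ T)
    (hs : coordVec s t v ≠ 0) {w : Fin 2 → ℂ} (h0 : ‖w 0‖ = 1) (h1 : ‖w 1‖ = 1)
    (hq : (moveVec w (coordVec s t v), w, (1 : ℂ)) ∈ coordSet L s t) :
    coordPoint _ hq ∈ unitOrbit s t T := by
  have hw0 : w 0 ≠ 0 := norm_ne_zero_iff.mp (h0 ▸ one_ne_zero)
  have hw1 : w 1 ≠ 0 := norm_ne_zero_iff.mp (h1 ▸ one_ne_zero)
  set c := w 0 / w 1
  have hc : c ≠ 0 := div_ne_zero hw0 hw1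
  set v' := (w 1 ^ 2) • v
  have hv' : v' ∈ T := hT _ (by rw [norm_pow, h1, one_pow]) v hv
  have hcv : coordVec s t v' = (w 1 ^ 2) • coordVec s t v := coordVec_smul _ _
  have hv0 : coordVec s t v' ≠ 0 := by
    rw [hcv]
    exact smul_ne_zero (pow_ne_zero _ hw1) hs
  have h11 : moveVec ![1, 1] (coordVec s t v') = coordVec s t v' := by
    ext (i | i) <;> simp [moveVec]
  have hz : (coordVec s t v', ![1, 1], (1 : ℂ)) ∈ coordSet L s t :=
    ⟨hv0, pair_one_ne_zero, by
      have := hmove v' ![1, 1]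
      rwa [h11] at this⟩
  have hmv : ∀ w', moveVec w' (coordVec s t v) =
      Sum.elim (fun i => w' 1 * coordVec s t v (Sum.inl i))
        (fun i => w' 0 * coordVec s t v (Sum.inr i)) := fun w' => by
    ext (i | i) <;> simp [moveVec]
  -- the coordinates of the translate of `v'` by `w₀ / w₁`
  have hx' : (Sum.elim (fun i => coordVec s t v' (Sum.inl i))
      (c • fun i => coordVec s t v' (Sum.inr i)) : Coord N M → ℂ) =
      w 1 • moveVec w (coordVec s t v) := by
    rw [hmv, hcv]
    ext (i | i)
    · simp only [Sum.elim_inl, Pi.smul_apply, smul_eq_mul]; ring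
    · simp only [Sum.elim_inr, Pi.smul_apply, smul_eq_mul, c]; field_simp
  have hw' : (![c * (![1, 1] : Fin 2 → ℂ) 0, (![1, 1] : Fin 2 → ℂ) 1] : Fin 2 → ℂ) =
      (w 1)⁻¹ • w := by
    ext i
    fin_cases i
    · simp [c, div_eq_inv_mul]
    · simp [hw1]
  have hwne : (![c * (![1, 1] : Fin 2 → ℂ) 0, (![1, 1] : Fin 2 → ℂ) 1] : Fin 2 → ℂ) ≠ 0 := by
    rw [hw']
    exact smul_ne_zero (inv_ne_zero hw1) hq.2.1
  have hxne : (Sum.elim (fun i => coordVec s t v' (Sum.inl i))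
      (c • fun i => coordVec s t v' (Sum.inr i)) : Coord N M → ℂ) ≠ 0 := by
    rw [hx']
    exact smul_ne_zero hw1 hq.1
  have hel : (Sum.elim (fun i => coordVec s t v' (Sum.inl i))
      (fun i => coordVec s t v' (Sum.inr i)) : Coord N M → ℂ) = coordVec s t v' :=
    Sum.elim_comp_inl_inr _
  refine ⟨c, by rw [norm_div, h0, h1, div_one], coordPoint _ hz, ⟨v', hv', v', rfl, hv0, ?_⟩,
    fun i => coordVec s t v' (Sum.inl i), fun i => coordVec s t v' (Sum.inr i), ![1, 1], 1,
    by rwa [hel], pair_one_ne_zero, hxne, hwne, ?_, ?_⟩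
  · refine Prod.ext rfl (Prod.ext rfl ?_)
    exact one_smul ℂ _
  · simp only [hel]
    rfl
  · have hq' : (Sum.elim (fun i => coordVec s t v' (Sum.inl i))
      (c • fun i => coordVec s t v' (Sum.inr i)),
      ![c * (![1, 1] : Fin 2 → ℂ) 0, (![1, 1] : Fin 2 → ℂ) 1], (1 : ℂ)) ∈ coordSet L s t := by
      refine ⟨hxne, hwne, ?_⟩
      simp only [hx', hw']
      exact smul_mem_coneSet hq.2.2 _ _
    exact congrArg Subtype.val (coordPoint_congr hq hq' hw1 (inv_ne_zero hw1) hx' hw'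
      (by simp [hw1]))

/-- The maximum principle on a disc. -/
theorem norm_le_of_differentiable_of_norm_eq_one {g : ℂ → ℂ} (hg : Differentiable ℂ g) {C : ℝ}
    (hC : ∀ c, ‖c‖ = 1 → ‖g c‖ ≤ C) {c : ℂ} (hc : ‖c‖ ≤ 1) : ‖g c‖ ≤ C := by
  refine Complex.norm_le_of_forall_mem_frontier_norm_le (U := Metric.ball (0 : ℂ) 1)
    Metric.isBounded_ball hg.diffContOnCl (fun z hz => hC z ?_) ?_
  · rw [frontier_ball _ one_ne_zero] at hz
    exact mem_sphere_zero_iff_norm.mp hz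
  · rw [closure_ball _ one_ne_zero]
    exact mem_closedBall_zero_iff.mpr hc

theorem IsAnalyticRestriction.differentiable_comp {E : Type*} [NormedAddCommGroup E]
    [NormedSpace ℂ E] {G : Set E} {Φ : E → ℂ} (h : IsAnalyticRestriction G Φ) {ξ : ℂ → E}
    (hξ : ∀ c, AnalyticAt ℂ ξ c) (hG : ∀ c, ξ c ∈ G) : Differentiable ℂ fun c => Φ (ξ c) :=
  fun c => (h.analyticAt_comp (hξ c) (hG c) (Filter.Eventually.of_forall hG)).differentiableAt

/-- A holomorphic function bounded by `C` on the orbit is bounded by `C` at the points above `φ`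
in the tube with `max(|w₀|, |w₁|) = 1`: one of the coordinates `w₀` and `w₁` is varied in the unit
disc, the boundary of which gives points of the orbit. -/
theorem norm_coordLift_le
    (hmove : ∀ (v : TotalSpace L) w, (moveVec w (coordVec s t v), w) ∈ coneSet L s t)
    {T : Set (TotalSpace L)} (hT : ∀ c : ℂ, ‖c‖ ≤ 1 → ∀ v ∈ T, c • v ∈ T)
    {f : DeformationTotalSpace L s t → ℂ} (hf : f ∈ DeformationTotalSpace.holomorphic L s t)
    {C : ℝ} (hC : ∀ z ∈ unitOrbit s t T, ‖f z‖ ≤ C) {v : TotalSpace L} (hv : v ∈ T)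
    {k : Fin (N + 1)} (hk : coordVec s t v (Sum.inl k) ≠ 0) {w : Fin 2 → ℂ} (h0 : w 0 ≠ 0)
    (h1 : w 1 ≠ 0) (hw : ‖w 0‖ ≤ 1 ∧ ‖w 1‖ = 1 ∨ ‖w 0‖ = 1 ∧ ‖w 1‖ ≤ 1) :
    ‖coordLift f (moveVec w (coordVec s t v), w, 1)‖ ≤ C := by
  rw [mem_holomorphic_iff] at hf
  have hcv : coordVec s t v ≠ 0 := fun h => hk (congrFun h _)
  have hcircle : ∀ w : Fin 2 → ℂ, ‖w 0‖ = 1 → ‖w 1‖ = 1 →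
      ∃ hq : (moveVec w (coordVec s t v), w, (1 : ℂ)) ∈ coordSet L s t,
      ‖coordLift f (moveVec w (coordVec s t v), w, 1)‖ ≤ C := by
    intro w h0 h1
    have hw1 : w 1 ≠ 0 := norm_ne_zero_iff.mp (h1 ▸ one_ne_zero)
    have hq : (moveVec w (coordVec s t v), w, (1 : ℂ)) ∈ coordSet L s t :=
      ⟨fun h => mul_ne_zero hw1 hk (congrFun h (Sum.inl k)), fun h => hw1 (congrFun h 1),
        hmove v w⟩
    exact ⟨hq, by
      rw [coordLift_of_mem f hq]
      exact hC _ (mem_unitOrbit_of_norm_eq_one hmove hT hv hcv h0 h1 hq)⟩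
  have hvec : ∀ a b : ℂ, (![a, b] : Fin 2 → ℂ) 0 = a ∧ (![a, b] : Fin 2 → ℂ) 1 = b :=
    fun _ _ => ⟨rfl, rfl⟩
  have hww : ![w 0, w 1] = w := by ext i; fin_cases i <;> rfl
  have hmvan : ∀ {α β : ℂ → ℂ} {c : ℂ}, AnalyticAt ℂ α c → AnalyticAt ℂ β c →
      AnalyticAt ℂ (fun c => (moveVec ![α c, β c] (coordVec s t v), ![α c, β c], (1 : ℂ))) c := by
    intro α β c hα hβ
    refine AnalyticAt.prod (AnalyticAt.pi ?_) (AnalyticAt.prod (AnalyticAt.pi ?_) analyticAt_const)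
    · rintro (i | i)
      · exact hβ.mul analyticAt_const
      · exact hα.mul analyticAt_const
    · intro i
      fin_cases i
      · exact hα
      · exact hβ
  rcases hw with ⟨hw0, hw1⟩ | ⟨hw0, hw1⟩
  · have hG : ∀ c : ℂ, (moveVec ![c, w 1] (coordVec s t v), ![c, w 1], (1 : ℂ)) ∈ coordSet L s t :=
      fun c => ⟨fun h => mul_ne_zero h1 hk (congrFun h (Sum.inl k)), fun h => h1 (congrFun h 1),
        hmove v _⟩
    have hd := hf.differentiable_comp (fun c => hmvan analyticAt_id analyticAt_const) hG
    have := norm_le_of_differentiable_of_norm_eq_one hd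
      (fun c hc => (hcircle ![c, w 1] hc hw1).2) hw0
    simpa only [id, hww] using this
  · by_cases ht : ∀ l, coordVec s t v (Sum.inr l) = 0
    · -- if all `φ(t_l)` vanish, the factor `w₁` of the first coordinates is put into `μ`
      let x : Coord N M → ℂ := coordVec s t v
      have hmx : ∀ w : Fin 2 → ℂ, moveVec w (coordVec s t v) = w 1 • x := by
        intro w
        ext (i | i)
        · rfl
        · simp [moveVec, x, ht i]
      have hG : ∀ c : ℂ, (x, ![w 0, c], c) ∈ coordSet L s t := by
        intro c
        refine ⟨hcv, fun h => h0 (congrFun h 0), ?_⟩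
        have hcl : IsClosed {c : ℂ | (x, ![w 0, c]) ∈ coneSet L s t} := by
          refine (isClosed_coneSet L s t).preimage ?_
          refine continuous_const.prodMk (continuous_pi fun i => ?_)
          fin_cases i
          · exact continuous_const
          · exact continuous_id
        have hsub : {c : ℂ | c ≠ 0} ⊆ {c : ℂ | (x, ![w 0, c]) ∈ coneSet L s t} := by
          intro c hc
          have := smul_mem_coneSet (hmove v ![w 0, c]) c⁻¹ 1
          rw [hmx, one_smul, (hvec _ _).2, inv_smul_smul₀ hc] at this
          exact this
        exact (hcl.closure_subset_iff.mpr hsub) ((dense_compl_singleton (0 : ℂ)) c)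
      have hd := hf.differentiable_comp (ξ := fun c => (x, ![w 0, c], c)) (fun c => by
        refine AnalyticAt.prod analyticAt_const (AnalyticAt.prod (AnalyticAt.pi fun i => ?_)
          analyticAt_id)
        fin_cases i
        · exact analyticAt_const
        · exact analyticAt_id) hG
      have hcg : ∀ c : ℂ, c ≠ 0 → coordLift f (x, ![w 0, c], c) =
          coordLift f (moveVec ![w 0, c] (coordVec s t v), ![w 0, c], 1) := by
        intro c hc
        refine coordLift_congr f (hG c) ⟨fun h => mul_ne_zero hc hk (congrFun h (Sum.inl k)),
          fun h => h0 (congrFun h 0), hmove v _⟩ hc one_ne_zero (hmx _) (one_smul _ _).symm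
          (by ring)
      have := norm_le_of_differentiable_of_norm_eq_one hd (fun c hc => by
        rw [hcg c (norm_ne_zero_iff.mp (hc ▸ one_ne_zero))]
        exact (hcircle ![w 0, c] hw0 hc).2) hw1
      rw [hcg _ h1] at this
      simpa only [id, hww] using this
    · push Not at ht
      obtain ⟨l, hl⟩ := ht
      have hG : ∀ c : ℂ, (moveVec ![w 0, c] (coordVec s t v), ![w 0, c], (1 : ℂ)) ∈
          coordSet L s t :=
        fun c => ⟨fun h => mul_ne_zero h0 hl (congrFun h (Sum.inr l)), fun h => h0 (congrFun h 0),
          hmove v _⟩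
      have hd := hf.differentiable_comp (fun c => hmvan analyticAt_const analyticAt_id) hG
      have := norm_le_of_differentiable_of_norm_eq_one hd
        (fun c hc => (hcircle ![w 0, c] hw0 hc).2) hw1
      simpa only [id, hww] using this

end UnitOrbit

/-! ### Small vectors in a uniformly definite tube -/

section SmallVectors

variable {X : Scheme.{0}} {L : X.Modules} {N M : ℕ} {s : Fin (N + 1) → Γ(L, ⊤)}
  {t : Fin M → Γ(L, ⊤)} {U : Fin (N + 1) → X.Opens}
    {f : ∀ k, Fin (N + 1) → Γ(X, U k)} {g : ∀ k, Fin M → Γ(X, U k)}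

theorem TotalSpace.continuous_value (σ : Γ(L, ⊤)) :
    Continuous fun v : TotalSpace L => v.value (U := ⊤) trivial σ := by
  refine continuous_def.mpr fun W hW => TopologicalSpace.isOpen_generateFrom_of_mem (Or.inr ?_)
  exact ⟨⊤, σ, W, hW, Set.ext fun v => ⟨fun h => ⟨trivial, h⟩, fun ⟨_, h⟩ => h⟩⟩

theorem eq_zero_smul_of_coordVec_eq_zero (hU : ∀ x, ∃ k, x ∈ U k)
    (hc : ∀ k, IsCoordChart s t k (U k) (f k) (g k)) {v : TotalSpace L}
    (h : ∀ k, coordVec s t v (Sum.inl k) = 0) : v = (0 : ℂ) • v := by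
  obtain ⟨k, hk⟩ := hU v.base.pt
  refine v.eq_zero_smul hk (hc k).isFrame ?_
  rw [v.value_restrict hk]
  exact h k

/-- A uniformly definite tube contains all vectors `φ` for which the values `φ(s_k)` are small. -/
theorem IsAnalyticTube.exists_forall_norm_le_mem {T : Set (TotalSpace L)} (hT : IsAnalyticTube T)
    (hdef : IsUniformlyDefinite T) (hU : ∀ x, ∃ k, x ∈ U k)
    (hc : ∀ k, IsCoordChart s t k (U k) (f k) (g k)) :
    ∃ ε : ℝ, 0 < ε ∧ ∀ v : TotalSpace L, (∀ k, ‖coordVec s t v (Sum.inl k)‖ ≤ ε) → v ∈ T := by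
  obtain ⟨n, hn, hnT⟩ := hdef
  have hS : IsCompact {v | n v = 1} := hT.isCompact.of_isClosed_subset
    (isClosed_eq hn.continuous continuous_const) fun v (hv : n v = 1) => hnT hv.le
  let F : TotalSpace L → (Fin (N + 1) → ℂ) := fun v k => coordVec s t v (Sum.inl k)
  have hF : Continuous F := continuous_pi fun k => TotalSpace.continuous_value (s k)
  have hFc : ∀ (c : ℂ) v, F (c • v) = c • F v := fun _ _ => rfl
  obtain ⟨m, hm, hmS⟩ : ∃ m : ℝ, 0 < m ∧ ∀ v, n v = 1 → m ≤ ‖F v‖ := by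
    rcases Set.eq_empty_or_nonempty {v | n v = 1} with he | hne
    · exact ⟨1, one_pos, fun v hv => absurd hv (Set.eq_empty_iff_forall_notMem.mp he v)⟩
    obtain ⟨v, hv, hmin⟩ := hS.exists_isMinOn hne hF.norm.continuousOn
    refine ⟨‖F v‖, ?_, fun v' hv' => hmin hv'⟩
    rw [norm_pos_iff]
    intro h0
    have h1 := eq_zero_smul_of_coordVec_eq_zero hU hc (fun k => congrFun h0 k)
    have h2 : n v = 1 := hv
    rw [h1, hn.map_smul, norm_zero, zero_mul] at h2
    exact zero_ne_one h2
  refine ⟨m, hm, fun v hv => hnT ?_⟩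
  have hle : ‖F v‖ ≤ m := (pi_norm_le_iff_of_nonneg hm.le).mpr hv
  change n v ≤ 1
  by_contra! hlt
  have hpos : 0 < n v := one_pos.trans hlt
  have h1 := hmS ((((n v)⁻¹ : ℝ) : ℂ) • v) (by
    rw [hn.map_smul, Complex.norm_real, Real.norm_of_nonneg (by positivity),
      inv_mul_cancel₀ hpos.ne'])
  rw [hFc, norm_smul, Complex.norm_real, Real.norm_of_nonneg (by positivity), inv_mul_eq_div,
    le_div_iff₀ hpos] at h1
  nlinarith

end SmallVectors

/-! ### The estimate on a component -/

section Estimate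

variable {X : Scheme.{0}} {L : X.Modules} {N M : ℕ} {s : Fin (N + 1) → Γ(L, ⊤)}
  {t : Fin M → Γ(L, ⊤)} {U : Fin (N + 1) → X.Opens}
    {f : ∀ k, Fin (N + 1) → Γ(X, U k)} {g : ∀ k, Fin M → Γ(X, U k)}
    {Q : Ideal (MvPolynomial (Coord N M ⊕ Fin 2) ℂ)}

theorem IsAnalyticRestriction.comp {E E' : Type*} [NormedAddCommGroup E]
    [NormedSpace ℂ E] [NormedAddCommGroup E'] [NormedSpace ℂ E'] {G : Set E} {Φ : E → ℂ}
    (h : IsAnalyticRestriction G Φ) {ξ : E' → E} (hξ : ∀ c, AnalyticAt ℂ ξ c) :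
    IsAnalyticRestriction (ξ ⁻¹' G) fun c => Φ (ξ c) := by
  intro c hc
  obtain ⟨Ψ, hΨ, he⟩ := h _ hc
  refine ⟨fun c => Ψ (ξ c), hΨ.comp (hξ c), ?_⟩
  have h1 : Filter.Tendsto ξ (𝓝[ξ ⁻¹' G] c) (𝓝[G] (ξ c)) :=
    (hξ c).continuousAt.continuousWithinAt.tendsto_nhdsWithin fun _ h => h
  exact h1.eventually he

/-- The homogeneous coordinates `(x, w, 1)` attached to a pair `ζ = (x, w)`. -/
def coneCoord (ζ : Coord N M ⊕ Fin 2 → ℂ) : HomCoord N M := (ζ ∘ Sum.inl, ζ ∘ Sum.inr, 1)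

theorem analyticAt_coneCoord (ζ : Coord N M ⊕ Fin 2 → ℂ) : AnalyticAt ℂ coneCoord ζ := by
  refine AnalyticAt.prod (AnalyticAt.pi fun i => ?_) (AnalyticAt.prod (AnalyticAt.pi fun i => ?_)
    analyticAt_const)
  · exact (ContinuousLinearMap.proj (R := ℂ) (φ := fun _ : Coord N M ⊕ Fin 2 => ℂ)
      (Sum.inl i)).analyticAt ζ
  · exact (ContinuousLinearMap.proj (R := ℂ) (φ := fun _ : Coord N M ⊕ Fin 2 => ℂ)
      (Sum.inr i)).analyticAt ζ

theorem IsConeComponent.coneCoord_mem (hQ : IsConeComponent f g Q)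
    (hc : ∀ k, IsCoordChart s t k (U k) (f k) (g k)) {ζ : Coord N M ⊕ Fin 2 → ℂ}
    (h : ζ ∈ MvPolynomial.zeroLocus ℂ Q) (hz : ζ ∘ Sum.inl ≠ 0) (hw : ζ ∘ Sum.inr ≠ 0) :
    coneCoord ζ ∈ coordSet L s t :=
  ⟨hz, hw, IsConeComponent.mem_coneSet hc hQ (by
    change Sum.elim (ζ ∘ Sum.inl) (ζ ∘ Sum.inr) ∈ _
    rwa [Sum.elim_comp_inl_inr])⟩

/-- An estimate at generic points of a component extends to all points. -/
theorem IsConeComponent.norm_coordLift_le_of_generic (hQ : IsConeComponent f g Q)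
    (hc : ∀ k, IsCoordChart s t k (U k) (f k) (g k))
    {F : DeformationTotalSpace L s t → ℂ} (hF : F ∈ DeformationTotalSpace.holomorphic L s t)
    {Δ : MvPolynomial (Coord N M ⊕ Fin 2) ℂ} (hΔ : Δ ∉ Q) {O : Set (Coord N M ⊕ Fin 2 → ℂ)}
    (hO : IsOpen O) {C : ℝ}
    (hC : ∀ ζ ∈ MvPolynomial.zeroLocus ℂ Q, ζ ∈ O → ζ ∘ Sum.inl ≠ 0 → ζ ∘ Sum.inr ≠ 0 →
      MvPolynomial.aeval ζ Δ ≠ 0 → ‖coordLift F (coneCoord ζ)‖ ≤ C)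
    {ζ : Coord N M ⊕ Fin 2 → ℂ} (h : ζ ∈ MvPolynomial.zeroLocus ℂ Q) (hζO : ζ ∈ O)
    (hz : ζ ∘ Sum.inl ≠ 0) (hw : ζ ∘ Sum.inr ≠ 0) : ‖coordLift F (coneCoord ζ)‖ ≤ C := by
  have hQp := hQ.isPrime
  have hcl := mem_closure_zeroLocus_aeval_ne_zero hΔ h
  have hne : (𝓝[{ζ | ζ ∈ MvPolynomial.zeroLocus ℂ Q ∧ MvPolynomial.aeval ζ Δ ≠ 0}] ζ).NeBot :=
    mem_closure_iff_nhdsWithin_neBot.mp hcl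
  have hO' : IsOpen (O ∩ {ζ | ζ ∘ Sum.inl ≠ 0} ∩ {ζ | ζ ∘ Sum.inr ≠ 0}) := by
    refine (hO.inter ?_).inter ?_
    · exact isOpen_ne_fun (continuous_pi fun i => continuous_apply _) continuous_const
    · exact isOpen_ne_fun (continuous_pi fun i => continuous_apply _) continuous_const
  have hev : ∀ᶠ ζ' in 𝓝[{ζ | ζ ∈ MvPolynomial.zeroLocus ℂ Q ∧ MvPolynomial.aeval ζ Δ ≠ 0}] ζ,
      coneCoord ζ' ∈ coordSet L s t ∧ ‖coordLift F (coneCoord ζ')‖ ≤ C := by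
    filter_upwards [mem_nhdsWithin_of_mem_nhds (hO'.mem_nhds ⟨⟨hζO, hz⟩, hw⟩),
      self_mem_nhdsWithin] with ζ' h1 h2
    exact ⟨hQ.coneCoord_mem hc h2.1 h1.1.2 h1.2, hC ζ' h2.1 h1.1.1 h1.1.2 h1.2 h2.2⟩
  have hcont := ((mem_holomorphic_iff.mp hF).comp analyticAt_coneCoord).continuousOn ζ
    (hQ.coneCoord_mem hc h hz hw)
  have htend : Filter.Tendsto (fun ζ => coordLift F (coneCoord ζ))
      (𝓝[{ζ | ζ ∈ MvPolynomial.zeroLocus ℂ Q ∧ MvPolynomial.aeval ζ Δ ≠ 0}] ζ)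
      (𝓝 (coordLift F (coneCoord ζ))) :=
    hcont.mono_left (le_inf nhdsWithin_le_nhds
      (Filter.le_principal_iff.mpr (hev.mono fun _ h => h.1)))
  exact le_of_tendsto htend.norm (hev.mono fun _ h => h.2)

theorem IsConeComponent.scale_coneCoord (hQ : IsConeComponent f g Q)
    (hc : ∀ k, IsCoordChart s t k (U k) (f k) (g k)) (F : DeformationTotalSpace L s t → ℂ)
    {ζ : Coord N M ⊕ Fin 2 → ℂ} (h : ζ ∈ MvPolynomial.zeroLocus ℂ Q) (hz : ζ ∘ Sum.inl ≠ 0)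
    (hw : ζ ∘ Sum.inr ≠ 0) {a : ℂ} (ha : a ≠ 0) :
    (Sum.elim (a • ζ ∘ Sum.inl) (a⁻¹ • ζ ∘ Sum.inr) : Coord N M ⊕ Fin 2 → ℂ) ∈
        MvPolynomial.zeroLocus ℂ Q ∧
      coordLift F (coneCoord ζ) =
        coordLift F (coneCoord (Sum.elim (a • ζ ∘ Sum.inl) (a⁻¹ • ζ ∘ Sum.inr))) := by
  have h1 : (Sum.elim (a • ζ ∘ Sum.inl) (a⁻¹ • ζ ∘ Sum.inr) : Coord N M ⊕ Fin 2 → ℂ) ∈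
      MvPolynomial.zeroLocus ℂ Q :=
    hQ.scale_mem a a⁻¹ ha (inv_ne_zero ha) (ζ ∘ Sum.inl) (ζ ∘ Sum.inr)
      (by rwa [Sum.elim_comp_inl_inr])
  refine ⟨h1, coordLift_congr F (hQ.coneCoord_mem hc h hz hw) (hQ.coneCoord_mem hc h1 ?_ ?_) ha
    (inv_ne_zero ha) ?_ ?_ ?_⟩
  · rw [Sum.elim_comp_inl]; exact smul_ne_zero ha hz
  · rw [Sum.elim_comp_inr]; exact smul_ne_zero (inv_ne_zero ha) hw
  · rfl
  · rfl
  · simp [coneCoord, ha]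

/-- The estimate from discs, at generic points of a component: such points lie above vectors `φ`,
and `φ` belongs to the tube as soon as `x = w₁ φ(s)` is small compared with `w₁`. -/
theorem IsConeComponent.exists_pivot_norm_coordLift_le (hQ : IsConeComponent f g Q)
    (hU : ∀ x, ∃ k, x ∈ U k) (hc : ∀ k, IsCoordChart s t k (U k) (f k) (g k))
    {T : Set (TotalSpace L)} (hT : ∀ c : ℂ, ‖c‖ ≤ 1 → ∀ v ∈ T, c • v ∈ T) {ε : ℝ}
    (hεT : ∀ v : TotalSpace L, (∀ k, ‖coordVec s t v (Sum.inl k)‖ ≤ ε) → v ∈ T) :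
    ∃ k : Fin (N + 1), MvPolynomial.X (Sum.inl (Sum.inl k)) ∉ Q ∧
      ∀ (F : DeformationTotalSpace L s t → ℂ), F ∈ DeformationTotalSpace.holomorphic L s t →
      ∀ C : ℝ, (∀ z ∈ unitOrbit s t T, ‖F z‖ ≤ C) → ∀ ζ ∈ MvPolynomial.zeroLocus ℂ Q,
        ζ (Sum.inl (Sum.inl k)) ≠ 0 → ζ (Sum.inr 0) ≠ 0 → ζ (Sum.inr 1) ≠ 0 →
        (‖ζ (Sum.inr 0)‖ ≤ 1 ∧ ‖ζ (Sum.inr 1)‖ = 1 ∨ ‖ζ (Sum.inr 0)‖ = 1 ∧ ‖ζ (Sum.inr 1)‖ ≤ 1) →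
        ‖ζ ∘ Sum.inl‖ ≤ ε * ‖ζ (Sum.inr 1)‖ → ‖coordLift F (coneCoord ζ)‖ ≤ C := by
  obtain ⟨k, hk, hv⟩ := hQ.exists_totalSpace hc
  refine ⟨k, hk, fun F hF C hC ζ hζ hζk h0 h1 hn hle => ?_⟩
  obtain ⟨v, hvs, hvt⟩ := hv (ζ ∘ Sum.inl) (ζ ∘ Sum.inr) (by rwa [Sum.elim_comp_inl_inr]) hζk h0 h1
  have hvT : v ∈ T := hεT v fun l => by
    rw [hvs, norm_div]
    refine (div_le_iff₀ (norm_pos_iff.mpr h1)).mpr ?_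
    exact (norm_le_pi_norm (ζ ∘ Sum.inl) (Sum.inl l)).trans hle
  have := norm_coordLift_le (moveVec_coordVec_mem_coneSet hU hc) hT hF hC hvT (k := k)
    (by rw [hvs]; exact div_ne_zero hζk h1) (w := ζ ∘ Sum.inr) h0 h1 hn
  have hm : moveVec (ζ ∘ Sum.inr) (coordVec s t v) = ζ ∘ Sum.inl := by
    ext (i | i)
    · simp only [moveVec, Sum.elim_inl, hvs]
      exact mul_div_cancel₀ _ h1
    · simp only [moveVec, Sum.elim_inr, hvt]
      exact mul_div_cancel₀ _ h0
  rwa [hm] at this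

theorem IsConeComponent.unitOrbit_nonempty (hQ : IsConeComponent f g Q)
    (hU : ∀ x, ∃ k, x ∈ U k) (hc : ∀ k, IsCoordChart s t k (U k) (f k) (g k))
    {T : Set (TotalSpace L)} (hT : ∀ c : ℂ, ‖c‖ ≤ 1 → ∀ v ∈ T, c • v ∈ T) {ε : ℝ} (hε : 0 < ε)
    (hεT : ∀ v : TotalSpace L, (∀ k, ‖coordVec s t v (Sum.inl k)‖ ≤ ε) → v ∈ T)
    {ζ : Coord N M ⊕ Fin 2 → ℂ} (h : ζ ∈ MvPolynomial.zeroLocus ℂ Q) :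
    (unitOrbit s t T).Nonempty := by
  have hQp := hQ.isPrime
  obtain ⟨k, hk, hv⟩ := hQ.exists_totalSpace hc
  have hΔ : (MvPolynomial.X (Sum.inl (Sum.inl k)) * (MvPolynomial.X (Sum.inr 0) *
      MvPolynomial.X (Sum.inr 1)) : MvPolynomial (Coord N M ⊕ Fin 2) ℂ) ∉ Q := fun h0 =>
    (hQp.mem_or_mem h0).elim hk fun h0 => (hQp.mem_or_mem h0).elim (hQ.w_notMem 0) (hQ.w_notMem 1)
  obtain ⟨ζ', hζ', hne⟩ := closure_nonempty_iff.mp ⟨ζ, mem_closure_zeroLocus_aeval_ne_zero hΔ h⟩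
  simp only [map_mul, MvPolynomial.aeval_X] at hne
  have h0 := left_ne_zero_of_mul (right_ne_zero_of_mul hne)
  have h1 := right_ne_zero_of_mul (right_ne_zero_of_mul hne)
  have h2 := left_ne_zero_of_mul hne
  obtain ⟨v, hvs, -⟩ := hv (ζ' ∘ Sum.inl) (ζ' ∘ Sum.inr) (by rwa [Sum.elim_comp_inl_inr]) h2 h0 h1
  have hvk : coordVec s t v (Sum.inl k) ≠ 0 := by rw [hvs]; exact div_ne_zero h2 h1
  have hpos : 0 < ‖coordVec s t v‖ := norm_pos_iff.mpr fun h => hvk (congrFun h _)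
  set c : ℂ := ((ε / ‖coordVec s t v‖ : ℝ) : ℂ)
  have hc0 : c ≠ 0 := by
    simp only [c, ne_eq, Complex.ofReal_eq_zero]
    positivity
  have hcT : c • v ∈ T := hεT _ fun l => by
    rw [coordVec_smul, Pi.smul_apply, norm_smul, Complex.norm_real,
      Real.norm_of_nonneg (by positivity), div_mul_eq_mul_div, div_le_iff₀ hpos]
    exact mul_le_mul_of_nonneg_left (norm_le_pi_norm _ _) hε.le
  have hcv : coordVec s t (c • v) (Sum.inl k) ≠ 0 := by
    rw [coordVec_smul]
    exact mul_ne_zero hc0 hvk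
  have hq : (moveVec ![1, 1] (coordVec s t (c • v)), ![1, 1], (1 : ℂ)) ∈ coordSet L s t :=
    ⟨fun h => mul_ne_zero one_ne_zero hcv (congrFun h (Sum.inl k)), pair_one_ne_zero,
      moveVec_coordVec_mem_coneSet hU hc _ _⟩
  exact ⟨_, mem_unitOrbit_of_norm_eq_one (moveVec_coordVec_mem_coneSet hU hc) hT hcT
    (fun h => hcv (congrFun h _)) (by simp) (by simp) hq⟩

/-- The estimate in the region `|w₁| > r |w₀|`: rescaling reduces to `max(|w₀|, |w₁|) = 1`. -/
theorem IsConeComponent.norm_coordLift_le_of_lt (hQ : IsConeComponent f g Q)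
    (hU : ∀ x, ∃ k, x ∈ U k) (hc : ∀ k, IsCoordChart s t k (U k) (f k) (g k))
    {T : Set (TotalSpace L)} (hT : ∀ c : ℂ, ‖c‖ ≤ 1 → ∀ v ∈ T, c • v ∈ T) {ε : ℝ} (hε : 0 < ε)
    (hεT : ∀ v : TotalSpace L, (∀ k, ‖coordVec s t v (Sum.inl k)‖ ≤ ε) → v ∈ T)
    {F : DeformationTotalSpace L s t → ℂ} (hF : F ∈ DeformationTotalSpace.holomorphic L s t)
    {C : ℝ} (hC : ∀ z ∈ unitOrbit s t T, ‖F z‖ ≤ C) {r : ℝ} (hr1 : r ≤ 1)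
    {ζ : Coord N M ⊕ Fin 2 → ℂ} (h : ζ ∈ MvPolynomial.zeroLocus ℂ Q) (hz : ζ ∘ Sum.inl ≠ 0)
    (hw : ζ ∘ Sum.inr ≠ 0) (hlt : r * ‖ζ (Sum.inr 0)‖ < ‖ζ (Sum.inr 1)‖)
    (hle : ‖ζ ∘ Sum.inl‖ * ‖ζ ∘ Sum.inr‖ < ε * r) : ‖coordLift F (coneCoord ζ)‖ ≤ C := by
  have hQp := hQ.isPrime
  obtain ⟨k, hk, hest⟩ := hQ.exists_pivot_norm_coordLift_le hU hc hT hεT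
  have hΔ : (MvPolynomial.X (Sum.inl (Sum.inl k)) * (MvPolynomial.X (Sum.inr 0) *
      MvPolynomial.X (Sum.inr 1)) : MvPolynomial (Coord N M ⊕ Fin 2) ℂ) ∉ Q := fun h0 =>
    (hQp.mem_or_mem h0).elim hk fun h0 => (hQp.mem_or_mem h0).elim (hQ.w_notMem 0) (hQ.w_notMem 1)
  have hcl : Continuous fun ζ : Coord N M ⊕ Fin 2 → ℂ => ‖ζ ∘ Sum.inl‖ * ‖ζ ∘ Sum.inr‖ :=
    (continuous_pi fun i => continuous_apply _).norm.mul
      (continuous_pi fun i => continuous_apply _).norm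
  have hO₁ : IsOpen {ζ : Coord N M ⊕ Fin 2 → ℂ | r * ‖ζ (Sum.inr 0)‖ < ‖ζ (Sum.inr 1)‖} :=
    isOpen_lt (by fun_prop) (by fun_prop)
  have hO : IsOpen {ζ : Coord N M ⊕ Fin 2 → ℂ | r * ‖ζ (Sum.inr 0)‖ < ‖ζ (Sum.inr 1)‖ ∧
      ‖ζ ∘ Sum.inl‖ * ‖ζ ∘ Sum.inr‖ < ε * r} :=
    hO₁.and (isOpen_lt hcl continuous_const)
  refine hQ.norm_coordLift_le_of_generic hc hF hΔ hO ?_ h ⟨hlt, hle⟩ hz hw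
  clear hz hw hlt hle h ζ
  intro ζ h hζO hz hw hne
  obtain ⟨hlt, hle⟩ := hζO
  simp only [map_mul, MvPolynomial.aeval_X] at hne
  have h0 := left_ne_zero_of_mul (right_ne_zero_of_mul hne)
  have h1 := right_ne_zero_of_mul (right_ne_zero_of_mul hne)
  have h2 := left_ne_zero_of_mul hne
  have key : ∀ a : ℂ, a ≠ 0 → ‖a‖ ≤ ‖ζ ∘ Sum.inr‖ → r ≤ ‖ζ (Sum.inr 1)‖ / ‖a‖ →
      (‖ζ (Sum.inr 0)‖ / ‖a‖ ≤ 1 ∧ ‖ζ (Sum.inr 1)‖ / ‖a‖ = 1 ∨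
        ‖ζ (Sum.inr 0)‖ / ‖a‖ = 1 ∧ ‖ζ (Sum.inr 1)‖ / ‖a‖ ≤ 1) →
      ‖coordLift F (coneCoord ζ)‖ ≤ C := by
    intro a ha haw hra hor
    obtain ⟨hm, he⟩ := hQ.scale_coneCoord hc F h hz hw ha
    rw [he]
    have hnorm : ∀ j : Fin 2, ‖(Sum.elim (a • ζ ∘ Sum.inl) (a⁻¹ • ζ ∘ Sum.inr) :
        Coord N M ⊕ Fin 2 → ℂ) (Sum.inr j)‖ = ‖ζ (Sum.inr j)‖ / ‖a‖ := fun j => by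
      simp [div_eq_inv_mul]
    refine hest F hF C hC _ hm (mul_ne_zero ha h2) (mul_ne_zero (inv_ne_zero ha) h0)
      (mul_ne_zero (inv_ne_zero ha) h1) ?_ ?_
    · rw [hnorm, hnorm]
      exact hor
    · rw [hnorm, Sum.elim_comp_inl, norm_smul]
      have h3 : ‖a‖ * ‖ζ ∘ Sum.inl‖ ≤ ‖ζ ∘ Sum.inl‖ * ‖ζ ∘ Sum.inr‖ := by
        rw [mul_comm]
        exact mul_le_mul_of_nonneg_left haw (norm_nonneg _)
      exact h3.trans (hle.le.trans (mul_le_mul_of_nonneg_left hra hε.le))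
  rcases le_total ‖ζ (Sum.inr 0)‖ ‖ζ (Sum.inr 1)‖ with hc01 | hc01
  · have hp := norm_pos_iff.mpr h1
    refine key (ζ (Sum.inr 1)) h1 (norm_le_pi_norm (ζ ∘ Sum.inr) 1) ?_ (Or.inl ⟨?_, ?_⟩)
    · rwa [div_self hp.ne']
    · exact (div_le_one hp).mpr hc01
    · exact div_self hp.ne'
  · have hp := norm_pos_iff.mpr h0
    refine key (ζ (Sum.inr 0)) h0 (norm_le_pi_norm (ζ ∘ Sum.inr) 0) ?_ (Or.inr ⟨?_, ?_⟩)
    · rw [le_div_iff₀ hp]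
      exact hlt.le
    · exact div_self hp.ne'
    · exact (div_le_one hp).mpr hc01

/-- The estimate in the region `|w₁| ≥ r |w₀|`, which for `w ≠ 0` is contained in the open region
`|w₁| > (r / 2) |w₀|`. -/
theorem IsConeComponent.norm_coordLift_le_of_le (hQ : IsConeComponent f g Q)
    (hU : ∀ x, ∃ k, x ∈ U k) (hc : ∀ k, IsCoordChart s t k (U k) (f k) (g k))
    {T : Set (TotalSpace L)} (hT : ∀ c : ℂ, ‖c‖ ≤ 1 → ∀ v ∈ T, c • v ∈ T) {ε : ℝ} (hε : 0 < ε)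
    (hεT : ∀ v : TotalSpace L, (∀ k, ‖coordVec s t v (Sum.inl k)‖ ≤ ε) → v ∈ T)
    {F : DeformationTotalSpace L s t → ℂ} (hF : F ∈ DeformationTotalSpace.holomorphic L s t)
    {C : ℝ} (hC : ∀ z ∈ unitOrbit s t T, ‖F z‖ ≤ C) {r : ℝ} (hr : 0 < r)
    {ζ : Coord N M ⊕ Fin 2 → ℂ} (h : ζ ∈ MvPolynomial.zeroLocus ℂ Q) (hz : ζ ∘ Sum.inl ≠ 0)
    (hw : ζ ∘ Sum.inr ≠ 0) (h1 : r * ‖ζ (Sum.inr 0)‖ ≤ ‖ζ (Sum.inr 1)‖)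
    (hlt : ‖ζ ∘ Sum.inl‖ * ‖ζ ∘ Sum.inr‖ < ε * min 1 (r / 2)) :
    ‖coordLift F (coneCoord ζ)‖ ≤ C := by
  refine hQ.norm_coordLift_le_of_lt hU hc hT hε hεT hF hC (min_le_left _ _) h hz hw ?_ hlt
  have h2 : min 1 (r / 2) * ‖ζ (Sum.inr 0)‖ ≤ r / 2 * ‖ζ (Sum.inr 0)‖ :=
    mul_le_mul_of_nonneg_right (min_le_right _ _) (norm_nonneg _)
  by_cases h0 : ζ (Sum.inr 0) = 0
  · rw [h0, norm_zero, mul_zero, norm_pos_iff]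
    intro h3
    apply hw
    ext i
    fin_cases i
    · exact h0
    · exact h3
  · have := norm_pos_iff.mpr h0
    nlinarith

theorem norm_pair_le {w : Fin 2 → ℂ} {r : ℝ} (h : ‖w 1‖ ≤ r * ‖w 0‖) :
    ‖w‖ ≤ max 1 r * ‖w 0‖ := by
  have h1 : 0 ≤ max 1 r := le_max_of_le_left zero_le_one
  refine (pi_norm_le_iff_of_nonneg (by positivity)).mpr fun i => ?_
  fin_cases i
  · exact le_mul_of_one_le_left (norm_nonneg _) (le_max_left _ _)
  · exact h.trans (mul_le_mul_of_nonneg_right (le_max_right _ _) (norm_nonneg _))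

theorem isAnalyticRestriction_coordLift_coneCoord
    {F : DeformationTotalSpace L s t → ℂ}
    (hF : F ∈ DeformationTotalSpace.holomorphic L s t) :
    IsAnalyticRestriction (coneCoord ⁻¹' coordSet L s t) fun ζ => coordLift F (coneCoord ζ) :=
  (mem_holomorphic_iff.mp hF).comp analyticAt_coneCoord

/-- A holomorphic function bounded by `C` on the orbit is bounded by `C` at the points of a
component with small `‖x‖ ‖w‖`.  Away from `w₁ = 0` this follows from discs.  A generic point with
`|w₁| < r |w₀|` lies on a curve on which the functions of a transcendence basis other than `w₁`
are constant; the boundary `|w₁| = r |w₀|` of the curve is in the region already treated, and the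
maximum principle applies. -/
theorem IsConeComponent.exists_norm_coordLift_le (hQ : IsConeComponent f g Q)
    (hU : ∀ x, ∃ k, x ∈ U k) (hc : ∀ k, IsCoordChart s t k (U k) (f k) (g k))
    {T : Set (TotalSpace L)} (hT : ∀ c : ℂ, ‖c‖ ≤ 1 → ∀ v ∈ T, c • v ∈ T) {ε : ℝ} (hε : 0 < ε)
    (hεT : ∀ v : TotalSpace L, (∀ k, ‖coordVec s t v (Sum.inl k)‖ ≤ ε) → v ∈ T) :
    ∃ δ : ℝ, 0 < δ ∧ ∀ F ∈ DeformationTotalSpace.holomorphic L s t, ∀ C : ℝ,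
      (∀ z ∈ unitOrbit s t T, ‖F z‖ ≤ C) → ∀ ζ ∈ MvPolynomial.zeroLocus ℂ Q, ζ ∘ Sum.inl ≠ 0 →
        ζ ∘ Sum.inr ≠ 0 → ‖ζ ∘ Sum.inl‖ * ‖ζ ∘ Sum.inr‖ < δ → ‖coordLift F (coneCoord ζ)‖ ≤ C := by
  classical
  have hQp := hQ.isPrime
  by_cases hne : ∃ z w, Sum.elim z w ∈ MvPolynomial.zeroLocus ℂ Q ∧ w 1 = 0 ∧ w 0 ≠ 0
  swap
  · push Not at hne
    obtain ⟨r, hr, hrle⟩ := hQ.exists_norm_le_of_forall_ne hne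
    have hr' : 0 < min 1 (r / 2) := by positivity
    exact ⟨ε * min 1 (r / 2), by positivity, fun F hF C hC ζ h hz hw hlt =>
      hQ.norm_coordLift_le_of_le hU hc hT hε hεT hF hC hr h hz hw
        (hrle (ζ ∘ Sum.inl) (ζ ∘ Sum.inr) (by rwa [Sum.elim_comp_inl_inr])) hlt⟩
  obtain ⟨τ, _, y, i₀, i₁, r, A, hi, hy, hy₀, hy₁, hr, hA, hbound⟩ :=
    hQ.exists_transcendenceBasis hne
  obtain ⟨Δ, hΔ0, hmax⟩ := norm_le_of_norm_le_boundary hy i₁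
  obtain ⟨D, hD⟩ := Ideal.Quotient.mk_surjective (MvPolynomial.aeval y Δ)
  have hDQ : D ∉ Q := fun h => by
    rw [Ideal.Quotient.eq_zero_iff_mem.mpr h] at hD
    exact hΔ0 (hy.1 (hD.symm.trans (map_zero _).symm))
  have hDev : ∀ {ζ} (h : ζ ∈ MvPolynomial.zeroLocus ℂ Q), MvPolynomial.aeval ζ D =
      MvPolynomial.eval (fun j => zeroLocusEval h (y j)) Δ := by
    intro ζ h
    have : (zeroLocusEval h).comp (MvPolynomial.aeval y) =
        MvPolynomial.aeval (R := ℂ) fun j => zeroLocusEval h (y j) :=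
      MvPolynomial.algHom_ext fun j => by
        rw [AlgHom.comp_apply, MvPolynomial.aeval_X, MvPolynomial.aeval_X]
    rw [← zeroLocusEval_mk h, hD, ← AlgHom.comp_apply, this, MvPolynomial.aeval_eq_eval]
  have hev₀ : ∀ {ζ} (h : ζ ∈ MvPolynomial.zeroLocus ℂ Q), zeroLocusEval h (y i₀) = ζ (Sum.inr 0) :=
    fun h => by rw [hy₀, zeroLocusEval_mk, MvPolynomial.aeval_X]
  have hev₁ : ∀ {ζ} (h : ζ ∈ MvPolynomial.zeroLocus ℂ Q), zeroLocusEval h (y i₁) = ζ (Sum.inr 1) :=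
    fun h => by rw [hy₁, zeroLocusEval_mk, MvPolynomial.aeval_X]
  have hr' : 0 < min 1 (r / 2) := by positivity
  set ε₂ := ε * min 1 (r / 2)
  have hε₂ : 0 < ε₂ := by positivity
  have hrm : 0 < max 1 r := lt_max_of_lt_left one_pos
  have hcl : Continuous fun ζ : Coord N M ⊕ Fin 2 → ℂ => ‖ζ ∘ Sum.inl‖ * ‖ζ ∘ Sum.inr‖ :=
    (continuous_pi fun i => continuous_apply _).norm.mul
      (continuous_pi fun i => continuous_apply _).norm
  refine ⟨min ε₂ (ε₂ / (A * max 1 r)), by positivity, fun F hF C hC ζ h hz hw hlt => ?_⟩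
  -- the bound `C` is not vacuous, as the orbit is not empty
  have hC0 : 0 ≤ C := by
    obtain ⟨p, hp⟩ := hQ.unitOrbit_nonempty hU hc hT hε hεT h
    exact (norm_nonneg _).trans (hC p hp)
  rcases le_or_gt (r * ‖ζ (Sum.inr 0)‖) ‖ζ (Sum.inr 1)‖ with hcase | hcase
  · exact hQ.norm_coordLift_le_of_le hU hc hT hε hεT hF hC hr h hz hw hcase
      (hlt.trans_le (min_le_left _ _))
  have hO₁ : IsOpen {ζ : Coord N M ⊕ Fin 2 → ℂ | ‖ζ (Sum.inr 1)‖ < r * ‖ζ (Sum.inr 0)‖} :=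
    isOpen_lt (by fun_prop) (by fun_prop)
  have hO : IsOpen {ζ : Coord N M ⊕ Fin 2 → ℂ | ‖ζ (Sum.inr 1)‖ < r * ‖ζ (Sum.inr 0)‖ ∧
      ‖ζ ∘ Sum.inl‖ * ‖ζ ∘ Sum.inr‖ < ε₂ / (A * max 1 r)} :=
    hO₁.and (isOpen_lt hcl continuous_const)
  refine hQ.norm_coordLift_le_of_generic hc hF hDQ hO ?_ h
    ⟨hcase, hlt.trans_le (min_le_right _ _)⟩ hz hw
  clear hcase hlt hz hw h ζ
  intro ζ h hζO hz hw hDζ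
  obtain ⟨hcase, hlt⟩ := hζO
  rw [hDev h] at hDζ
  have hw0 : ζ (Sum.inr 0) ≠ 0 := by
    rintro h0
    rw [h0, norm_zero, mul_zero] at hcase
    exact (norm_nonneg _).not_gt hcase
  refine hmax _ _ (isAnalyticRestriction_coordLift_coneCoord hF) (r * ‖ζ (Sum.inr 0)‖) C
    (A * ‖ζ ∘ Sum.inl‖ + max 1 r * ‖ζ (Sum.inr 0)‖) hC0 ζ h hDζ (by rw [hev₁]; exact hcase.le) ?_
  intro ζ' h' heq hle'
  rw [hev₁] at hle' ⊢
  have hw0' : ζ' (Sum.inr 0) = ζ (Sum.inr 0) := by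
    have := heq i₀ hi
    rwa [hev₀, hev₀] at this
  have he : Sum.elim (ζ ∘ Sum.inl) (ζ ∘ Sum.inr) ∈ MvPolynomial.zeroLocus ℂ Q := by
    rwa [Sum.elim_comp_inl_inr]
  have he' : Sum.elim (ζ' ∘ Sum.inl) (ζ' ∘ Sum.inr) ∈ MvPolynomial.zeroLocus ℂ Q := by
    rwa [Sum.elim_comp_inl_inr]
  have hee : ∀ {ζ} (h : ζ ∈ MvPolynomial.zeroLocus ℂ Q)
      (he : Sum.elim (ζ ∘ Sum.inl) (ζ ∘ Sum.inr) ∈ MvPolynomial.zeroLocus ℂ Q) x,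
      zeroLocusEval he x = zeroLocusEval h x := by
    intro ζ h he x
    congr 2
    exact Sum.elim_comp_inl_inr ζ
  -- `ζ'` runs through the curve through `ζ`, on which `‖x‖` is bounded
  have hb : ‖ζ' ∘ Sum.inl‖ ≤ A * ‖ζ ∘ Sum.inl‖ :=
    hbound _ _ _ _ he he' (by rw [Function.comp_apply, hw0']; exact hw0)
      (by simp only [Function.comp_apply]; rwa [hw0']) fun j hj => by
        rw [hee h, hee h', heq j hj]
  have hb' : ‖ζ ∘ Sum.inl‖ ≤ A * ‖ζ' ∘ Sum.inl‖ :=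
    hbound _ _ _ _ he' he hw0 hcase.le fun j hj => by rw [hee h, hee h', heq j hj]
  have hz' : ζ' ∘ Sum.inl ≠ 0 := fun h0 => by
    rw [h0, norm_zero, mul_zero] at hb'
    exact hz (norm_le_zero_iff.mp hb')
  have hw' : ζ' ∘ Sum.inr ≠ 0 := fun h0 => hw0 (hw0'.symm.trans (congrFun h0 0))
  have hwn : ‖ζ' ∘ Sum.inr‖ ≤ max 1 r * ‖ζ (Sum.inr 0)‖ := by
    have := norm_pair_le (w := ζ' ∘ Sum.inr) (r := r) (by
      simp only [Function.comp_apply]; rwa [hw0'])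
    rwa [Function.comp_apply, hw0'] at this
  refine ⟨?_, hQ.coneCoord_mem hc h' hz' hw', fun hbd => ?_⟩
  · refine (pi_norm_le_iff_of_nonneg (by positivity)).mpr ?_
    rintro (i | i)
    · exact (norm_le_pi_norm (ζ' ∘ Sum.inl) i).trans
        (hb.trans (le_add_of_nonneg_right (by positivity)))
    · exact (norm_le_pi_norm (ζ' ∘ Sum.inr) i).trans
        (hwn.trans (le_add_of_nonneg_left (by positivity)))
  · refine hQ.norm_coordLift_le_of_le hU hc hT hε hεT hF hC hr h' hz' hw' (by rw [hw0', hbd]) ?_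
    rw [lt_div_iff₀ (by positivity)] at hlt
    refine lt_of_le_of_lt ?_ hlt
    have h3 : ‖ζ (Sum.inr 0)‖ ≤ ‖ζ ∘ Sum.inr‖ := norm_le_pi_norm (ζ ∘ Sum.inr) 0
    calc ‖ζ' ∘ Sum.inl‖ * ‖ζ' ∘ Sum.inr‖
        ≤ (A * ‖ζ ∘ Sum.inl‖) * (max 1 r * ‖ζ ∘ Sum.inr‖) := by
          refine mul_le_mul hb (hwn.trans ?_) (norm_nonneg _) (by positivity)
          exact mul_le_mul_of_nonneg_left h3 hrm.le
      _ = ‖ζ ∘ Sum.inl‖ * ‖ζ ∘ Sum.inr‖ * (A * max 1 r) := by ring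

end Estimate

/-! ### Analytic functions and complex conjugation -/

section ConjAnalytic

theorem FormalMultilinearSeries.exists_star {E : Type*} [NormedAddCommGroup E] [NormedSpace ℂ E]
    [StarAddMonoid E] [NormedStarGroup E] [StarModule ℂ E] (p : FormalMultilinearSeries ℂ E ℂ) :
    ∃ p' : FormalMultilinearSeries ℂ E ℂ, (∀ n v, p' n v = conj (p n fun i => star (v i))) ∧
      p.radius ≤ p'.radius := by
  let p' : FormalMultilinearSeries ℂ E ℂ := fun n =>
    { toFun := fun v => conj (p n fun i => star (v i))
      map_update_add' := by
        intro _ v i x y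
        have h : ∀ z, (fun j => star (Function.update v i z j)) =
            Function.update (fun j => star (v j)) i (star z) := fun z => by
          ext j
          by_cases hj : j = i
          · subst hj; simp
          · simp [hj]
        simp only [h, star_add, ContinuousMultilinearMap.map_update_add, map_add]
      map_update_smul' := by
        intro _ v i c x
        have h : ∀ z, (fun j => star (Function.update v i z j)) =
            Function.update (fun j => star (v j)) i (star z) := fun z => by
          ext j
          by_cases hj : j = i
          · subst hj; simp
          · simp [hj]
        simp only [h, star_smul, ContinuousMultilinearMap.map_update_smul, smul_eq_mul, map_mul]
        simp
      cont := by
        have := (p n).cont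
        exact Complex.continuous_conj.comp (this.comp (by fun_prop)) }
  refine ⟨p', fun n v => rfl, ?_⟩
  refine FormalMultilinearSeries.radius_le_of_le fun n => ?_
  refine ContinuousMultilinearMap.opNorm_le_bound (norm_nonneg _) fun v => ?_
  change ‖conj (p n fun i => star (v i))‖ ≤ _
  rw [RCLike.norm_conj]
  refine ((p n).le_opNorm _).trans_eq ?_
  simp only [norm_star]

theorem AnalyticAt.conj_star {E : Type*} [NormedAddCommGroup E] [NormedSpace ℂ E]
    [StarAddMonoid E] [NormedStarGroup E] [StarModule ℂ E] {G : E → ℂ} {x : E}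
    (hG : AnalyticAt ℂ G (star x)) : AnalyticAt ℂ (fun y => conj (G (star y))) x := by
  obtain ⟨p, r, hp⟩ := hG
  obtain ⟨p', hp', hr⟩ := p.exists_star
  refine ⟨p', r, hp.r_le.trans hr, hp.r_pos, fun {y} hy => ?_⟩
  have h1 : star y ∈ Metric.eball (0 : E) r := by
    rw [Metric.mem_eball, edist_zero_right] at hy ⊢
    rwa [enorm_eq_iff_norm_eq.mpr (norm_star y)]
  have h2 := (hp.hasSum h1).map (starRingEnd ℂ) Complex.continuous_conj
  have h3 : (fun n => p' n fun _ => y) = starRingEnd ℂ ∘ fun n => p n fun _ => star y :=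
    funext fun n => hp' n _
  simp only [h3, star_add]
  exact h2

end ConjAnalytic

/-! ### The hull of the orbit contains a neighbourhood of the zero section -/

section Size

variable {X : Scheme.{0}} {L : X.Modules} {N M : ℕ} {s : Fin (N + 1) → Γ(L, ⊤)}
  {t : Fin M → Γ(L, ⊤)}

namespace DeformationTotalSpace

/-- The largest absolute value of the entries of the tensor `μ x ⊗ w`. -/
def tensorNorm (z : DeformationTotalSpace L s t) : ℝ :=
  ‖fun p : Coord N M × Fin 2 => z.1.1.2.2 p.1 p.2‖

theorem continuous_tensorNorm :
    Continuous (tensorNorm : DeformationTotalSpace L s t → ℝ) := by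
  refine continuous_norm.comp (continuous_pi fun p => ?_)
  have h : Continuous fun z : DeformationTotalSpace L s t => z.1.1.2.2 :=
    continuous_snd.comp (continuous_snd.comp (continuous_subtype_val.comp continuous_subtype_val))
  exact h.matrix_elem p.1 p.2

theorem tensorNorm_smul (c : ℂ) (z : DeformationTotalSpace L s t) :
    tensorNorm (c • z) = ‖c‖ * tensorNorm z :=
  norm_smul c fun p : Coord N M × Fin 2 => z.1.1.2.2 p.1 p.2

theorem eq_zero_smul_of_tensorNorm_eq_zero {z : DeformationTotalSpace L s t}
    (h : tensorNorm z = 0) : z = (0 : ℂ) • z := by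
  have h1 := norm_eq_zero.mp h
  refine Subtype.ext (Subtype.ext (Prod.ext rfl (Prod.ext rfl ?_)))
  ext i j
  refine (congrFun h1 (i, j)).trans ?_
  change _ = (0 : ℂ) * _
  rw [zero_mul]
  rfl

theorem tensorNorm_coordPoint {q : HomCoord N M} (hq : q ∈ coordSet L s t) :
    tensorNorm (coordPoint q hq) = ‖q.2.2‖ * ‖q.1‖ * ‖q.2.1‖ := by
  have hle : ∀ i j, ‖q.2.2 * (q.1 i * q.2.1 j)‖ ≤ ‖q.2.2‖ * ‖q.1‖ * ‖q.2.1‖ := fun i j => by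
    rw [norm_mul, norm_mul, mul_assoc]
    gcongr
    · exact norm_le_pi_norm _ _
    · exact norm_le_pi_norm _ _
  refine le_antisymm ((pi_norm_le_iff_of_nonneg (by positivity)).mpr fun p => hle p.1 p.2) ?_
  obtain ⟨i, hi⟩ := Finite.exists_max fun i => ‖q.1 i‖
  obtain ⟨j, hj⟩ := Finite.exists_max fun j => ‖q.2.1 j‖
  have hi' : ‖q.1‖ ≤ ‖q.1 i‖ := (pi_norm_le_iff_of_nonneg (norm_nonneg _)).mpr hi
  have hj' : ‖q.2.1‖ ≤ ‖q.2.1 j‖ := (pi_norm_le_iff_of_nonneg (norm_nonneg _)).mpr hj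
  calc ‖q.2.2‖ * ‖q.1‖ * ‖q.2.1‖ ≤ ‖q.2.2‖ * ‖q.1 i‖ * ‖q.2.1 j‖ := by gcongr
    _ = ‖q.2.2 * (q.1 i * q.2.1 j)‖ := by rw [mul_assoc, ← norm_mul, ← norm_mul]
    _ ≤ _ := norm_le_pi_norm
      (fun p : Coord N M × Fin 2 => (coordPoint q hq).1.1.2.2 p.1 p.2) (i, j)

end DeformationTotalSpace

/-- The hull of the orbit contains the points with small tensor norm. -/
theorem exists_mem_functionHull_unitOrbit {U : Fin (N + 1) → X.Opens}
    {f : ∀ k, Fin (N + 1) → Γ(X, U k)} {g : ∀ k, Fin M → Γ(X, U k)}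
    (hU : ∀ x, ∃ k, x ∈ U k) (hc : ∀ k, IsCoordChart s t k (U k) (f k) (g k))
    {T : Set (TotalSpace L)} (hT : IsAnalyticTube T) (hdef : IsUniformlyDefinite T) :
    ∃ δ > 0, ∀ z : DeformationTotalSpace L s t, z.tensorNorm < δ →
      z ∈ functionHull (DeformationTotalSpace.holomorphic L s t) (unitOrbit s t T) := by
  obtain ⟨ε, hε, hεT⟩ := hT.exists_forall_norm_le_mem hdef hU hc
  obtain ⟨𝒬, hfin, h𝒬, hcover⟩ := exists_coneComponents_coneSet hU hc
  have hQ : ∀ Q : 𝒬, ∃ δ > 0, ∀ F ∈ DeformationTotalSpace.holomorphic L s t, ∀ C : ℝ,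
      (∀ z ∈ unitOrbit s t T, ‖F z‖ ≤ C) → ∀ ζ ∈ MvPolynomial.zeroLocus ℂ Q.1,
      ζ ∘ Sum.inl ≠ 0 → ζ ∘ Sum.inr ≠ 0 → ‖ζ ∘ Sum.inl‖ * ‖ζ ∘ Sum.inr‖ < δ →
      ‖coordLift F (coneCoord ζ)‖ ≤ C := fun Q =>
    (h𝒬 Q.1 Q.2).exists_norm_coordLift_le hU hc hT.smul_mem hε hεT
  choose δ' hδ' hest using hQ
  have := hfin.to_subtype
  obtain ⟨δ, hδ, hmin⟩ : ∃ δ > 0, ∀ Q, δ ≤ δ' Q := by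
    rcases isEmpty_or_nonempty 𝒬 with h | h
    · exact ⟨1, one_pos, fun Q => h.elim Q⟩
    · obtain ⟨Q, hQ⟩ := Finite.exists_min δ'
      exact ⟨δ' Q, hδ' Q, hQ⟩
  refine ⟨δ, hδ, fun z hz F hF C hC => ?_⟩
  obtain ⟨⟨x, w, μ⟩, hq, rfl⟩ := exists_coordPoint_eq z
  rw [DeformationTotalSpace.tensorNorm_coordPoint] at hz
  rw [← coordLift_of_mem F hq]
  have hqν : ∀ ν : ℂ, (x, w, ν) ∈ coordSet L s t := fun ν => hq
  -- for `ν ≠ 0` the point is represented by the triple `(ν x, w, 1)`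
  have hmain : ∀ ν : ℂ, ν ≠ 0 → ‖ν‖ * ‖x‖ * ‖w‖ < δ → ‖coordLift F (x, w, ν)‖ ≤ C := by
    intro ν hν hlt
    have hx : ν • x ≠ 0 := smul_ne_zero hν hq.1
    have hm : (ν • x, w) ∈ coneSet L s t := by
      have := smul_mem_coneSet hq.2.2 ν 1
      rwa [one_smul] at this
    have hm' : (ν • x, w, (1 : ℂ)) ∈ coordSet L s t := ⟨hx, hq.2.1, hm⟩
    rw [coordLift_congr F (hqν ν) hm' hν one_ne_zero rfl (one_smul _ _).symm (by ring)]
    obtain ⟨Q, hQ, hz⟩ := hcover _ hm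
    have := hest ⟨Q, hQ⟩ F hF C hC (Sum.elim (ν • x) w) hz hx hq.2.1 (by
      change ‖ν • x‖ * ‖w‖ < _
      rw [norm_smul]
      exact hlt.trans_le (hmin _))
    exact this
  -- the value at `ν = 0` is obtained by continuity
  have hcont : Continuous fun ν : ℂ => coordLift F (x, w, ν) :=
    ((mem_holomorphic_iff.mp hF).continuousOn).comp_continuous
      (continuous_const.prodMk (continuous_const.prodMk continuous_id)) hqν
  rcases eq_or_ne μ 0 with rfl | hμ
  · have h1 : ∀ᶠ ν : ℂ in 𝓝[≠] 0, ‖ν‖ * ‖x‖ * ‖w‖ < δ := by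
      have hc' : Continuous fun ν : ℂ => ‖ν‖ * ‖x‖ * ‖w‖ := by fun_prop
      refine nhdsWithin_le_nhds (hc'.continuousAt.eventually_lt continuousAt_const ?_)
      simpa using hδ
    refine le_of_tendsto (hcont.norm.continuousAt.tendsto.mono_left
      (nhdsWithin_le_nhds (s := {0}ᶜ))) ?_
    filter_upwards [h1, self_mem_nhdsWithin] with ν h2 h3
    exact hmain ν h3 h2
  · exact hmain μ hμ hz

theorem functionHull_mono {V : Type*} (𝓞 : Set (V → ℂ)) {K K' : Set V} (h : K ⊆ K') :
    functionHull 𝓞 K ⊆ functionHull 𝓞 K' :=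
  fun _ hv f hf C hC => hv f hf C fun k hk => hC k (h hk)

theorem isUniformlyDefinite_of_tensorNorm_lt {T' : Set (DeformationTotalSpace L s t)} {δ : ℝ}
    (hδ : 0 < δ) (h : ∀ z : DeformationTotalSpace L s t, z.tensorNorm < δ → z ∈ T') :
    IsUniformlyDefinite T' := by
  refine ⟨fun z => 2 / δ * z.tensorNorm,
    ⟨continuous_const.mul DeformationTotalSpace.continuous_tensorNorm, fun c z => ?_,
      fun z hz => mul_pos (by positivity) ?_⟩, fun z hz => h z ?_⟩
  · rw [DeformationTotalSpace.tensorNorm_smul]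
    ring
  · exact lt_of_le_of_ne (norm_nonneg _) fun h0 =>
      hz (DeformationTotalSpace.eq_zero_smul_of_tensorNorm_eq_zero h0.symm)
  · have h1 : 2 / δ * z.tensorNorm ≤ 1 := hz
    rw [div_mul_eq_mul_div, div_le_one hδ] at h1
    linarith

end Size

/-! ### The deformed tube -/

section Tube

variable {X : Scheme.{0}} {L : X.Modules} {N M : ℕ} {s : Fin (N + 1) → Γ(L, ⊤)}
  {t : Fin M → Γ(L, ⊤)}

theorem smul_coordPoint (c : ℂ) {q : HomCoord N M} (hq : q ∈ coordSet L s t) :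
    c • coordPoint q hq =
      coordPoint (q.1, q.2.1, c * q.2.2) (show (q.1, q.2.1, c * q.2.2) ∈ coordSet L s t from hq) :=
  Subtype.ext (Subtype.ext (Prod.ext rfl (Prod.ext rfl (smul_smul c q.2.2 _))))

theorem star_mem_coordSet {q : HomCoord N M} (hq : q ∈ coordSet L s t) :
    star q ∈ coordSet L s t := by
  have h1 : star q.1 ≠ 0 := star_ne_zero.mpr hq.1
  have h2 : star q.2.1 ≠ 0 := star_ne_zero.mpr hq.2.1
  exact ⟨h1, h2, (mem_deformation_iff h1 h2).mp (star (coordPoint q hq)).2⟩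

theorem SegreTotalSpace.star_mk {n : Type} [Finite n] {x : n → ℂ} (hx : x ≠ 0) {w : Fin 2 → ℂ}
    (hw : w ≠ 0) (μ : ℂ) : star (SegreTotalSpace.mk x hx w hw μ) =
      SegreTotalSpace.mk (star x) (star_ne_zero.mpr hx) (star w) (star_ne_zero.mpr hw)
        (star μ) := by
  refine Subtype.ext (Prod.ext rfl (Prod.ext rfl ?_))
  ext i j
  change conj (μ * (x i * w j)) = conj μ * (conj (x i) * conj (w j))
  rw [map_mul, map_mul]

theorem star_coordPoint {q : HomCoord N M} (hq : q ∈ coordSet L s t) :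
    star (coordPoint q hq) = coordPoint (star q) (star_mem_coordSet hq) :=
  Subtype.ext (SegreTotalSpace.star_mk hq.1 hq.2.1 q.2.2)

theorem DeformationTotalSpace.comp_smul_mem_holomorphic {f : DeformationTotalSpace L s t → ℂ}
    (hf : f ∈ holomorphic L s t) (c : ℂ) : (fun z => f (c • z)) ∈ holomorphic L s t := by
  rw [mem_holomorphic_iff] at hf ⊢
  have h := hf.comp (ξ := fun q : HomCoord N M => (q.1, q.2.1, c * q.2.2)) fun q =>
    analyticAt_fst.prod ((analyticAt_fst.comp analyticAt_snd).prod
      (analyticAt_const.mul (analyticAt_snd.comp analyticAt_snd)))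
  intro q hq
  obtain ⟨Ψ, hΨ, he⟩ := h q hq
  refine ⟨Ψ, hΨ, Filter.EventuallyEq.trans ?_ he⟩
  filter_upwards [self_mem_nhdsWithin] with q' hq'
  have hq'' : q' ∈ coordSet L s t := hq'
  rw [coordLift_of_mem _ hq'', smul_coordPoint, ← coordLift_of_mem f]

theorem DeformationTotalSpace.conj_comp_star_mem_holomorphic
    {f : DeformationTotalSpace L s t → ℂ} (hf : f ∈ holomorphic L s t) :
    (fun z => conj (f (star z))) ∈ holomorphic L s t := by
  rw [mem_holomorphic_iff] at hf ⊢
  intro q hq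
  obtain ⟨Ψ, hΨ, he⟩ := hf (star q) (star_mem_coordSet hq)
  refine ⟨fun q => conj (Ψ (star q)), hΨ.conj_star, ?_⟩
  have ht : Filter.Tendsto star (𝓝[coordSet L s t] q) (𝓝[coordSet L s t] (star q)) :=
    continuous_star.continuousWithinAt.tendsto_nhdsWithin fun _ => star_mem_coordSet
  filter_upwards [self_mem_nhdsWithin, ht.eventually he] with q' hq' h
  rw [coordLift_of_mem _ hq', star_coordPoint, ← coordLift_of_mem f, h]

/-- The entries of the tensor `μ x ⊗ w` are holomorphic functions. -/
theorem DeformationTotalSpace.entry_mem_holomorphic (i : Coord N M) (j : Fin 2) :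
    (fun z : DeformationTotalSpace L s t => z.1.1.2.2 i j) ∈ holomorphic L s t := by
  rw [mem_holomorphic_iff]
  intro q hq
  refine ⟨fun q => q.2.2 * (q.1 i * q.2.1 j), ?_, ?_⟩
  · have h1 : AnalyticAt ℂ (fun q : HomCoord N M => q.2.2) q := analyticAt_snd.comp analyticAt_snd
    have h2 : AnalyticAt ℂ (fun q : HomCoord N M => q.1 i) q :=
      ((ContinuousLinearMap.proj (R := ℂ) (φ := fun _ : Coord N M => ℂ) i).comp
        (ContinuousLinearMap.fst ℂ _ _)).analyticAt q
    have h3 : AnalyticAt ℂ (fun q : HomCoord N M => q.2.1 j) q :=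
      ((ContinuousLinearMap.proj (R := ℂ) (φ := fun _ : Fin 2 => ℂ) j).comp
        ((ContinuousLinearMap.fst ℂ _ _).comp (ContinuousLinearMap.snd ℂ _ _))).analyticAt q
    exact h1.mul (h2.mul h3)
  · filter_upwards [self_mem_nhdsWithin] with q' hq'
    rw [coordLift_of_mem _ hq']
    rfl

theorem coordVec_star (v : TotalSpace L) : coordVec s t (star v) = star (coordVec s t v) := by
  ext (i | i) <;> rfl

theorem star_mem_fibreOne {T : Set (TotalSpace L)} (hT : ∀ v ∈ T, star v ∈ T)
    {z : DeformationTotalSpace L s t} (hz : z ∈ fibreOne s t T) : star z ∈ fibreOne s t T := by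
  obtain ⟨v, hv, ψ, hb, hψ, h⟩ := hz
  refine ⟨star v, hT v hv, star ψ, ?_, ?_, ?_⟩
  · change star ψ.base = star v.base
    rw [hb]
  · rw [coordVec_star]
    exact star_ne_zero.mpr hψ
  · change (conjProj z.1.1.1, conjProj z.1.1.2.1, z.1.1.2.2.map conj) = _
    rw [h]
    refine Prod.ext ?_ (Prod.ext ?_ ?_)
    · change Projectivization.mk ℂ _ _ = Projectivization.mk ℂ _ _
      congr 1
      exact (coordVec_star ψ).symm
    · change Projectivization.mk ℂ _ _ = Projectivization.mk ℂ _ _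
      congr 1
      ext j
      fin_cases j <;> exact map_one (starRingEnd ℂ)
    · ext i j
      change conj (coordVec s t v i * (![1, 1] : Fin 2 → ℂ) j) =
        coordVec s t (star v) i * (![1, 1] : Fin 2 → ℂ) j
      rw [coordVec_star]
      fin_cases j <;> simp

theorem star_mem_unitOrbit {T : Set (TotalSpace L)} (hT : ∀ v ∈ T, star v ∈ T)
    {z : DeformationTotalSpace L s t} (hz : z ∈ unitOrbit s t T) : star z ∈ unitOrbit s t T := by
  obtain ⟨c, hc, z', hz', x, y, w, μ, hx, hw, hx', hw', h1, h2⟩ := hz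
  have e1 : ∀ y : Fin M → ℂ, star (Sum.elim x y : Coord N M → ℂ) = Sum.elim (star x) (star y) :=
    fun y => by ext (i | i) <;> rfl
  have e2 : star (![c * w 0, w 1] : Fin 2 → ℂ) = ![star c * star w 0, star w 1] := by
    ext j
    fin_cases j
    · exact map_mul conj _ _
    · rfl
  refine ⟨star c, by rwa [norm_star], star z', star_mem_fibreOne hT hz', star x, star y, star w,
    star μ, ?_, star_ne_zero.mpr hw, ?_, ?_, ?_, ?_⟩
  · rw [← e1]
    exact star_ne_zero.mpr hx
  · rw [← star_smul, ← e1]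
    exact star_ne_zero.mpr hx'
  · rw [← e2]
    exact star_ne_zero.mpr hw'
  · change star z'.1 = _
    rw [h1, SegreTotalSpace.star_mk]
    congr 1
    exact e1 y
  · change star z.1 = _
    rw [h2, SegreTotalSpace.star_mk]
    congr 1
    rw [e1, star_smul]

theorem smul_mem_unitOrbit {T : Set (TotalSpace L)}
    (hT : ∀ c : ℂ, ‖c‖ ≤ 1 → ∀ v ∈ T, c • v ∈ T) {a : ℂ} (ha : ‖a‖ ≤ 1)
    {z : DeformationTotalSpace L s t} (hz : z ∈ unitOrbit s t T) : a • z ∈ unitOrbit s t T := by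
  obtain ⟨c, hc, z', ⟨v, hv, ψ, hb, hψ, h⟩, x, y, w, μ, hx, hw, hx', hw', h1, h2⟩ := hz
  have e : ∀ {x : Coord N M → ℂ} (hx : x ≠ 0) {w : Fin 2 → ℂ} (hw : w ≠ 0) (μ : ℂ),
      a • SegreTotalSpace.mk x hx w hw μ = SegreTotalSpace.mk x hx w hw (a * μ) := fun hx _ hw μ =>
    Subtype.ext (Prod.ext rfl (Prod.ext rfl (smul_smul a μ _)))
  refine ⟨c, hc, a • z', ⟨a • v, hT a ha v hv, ψ, hb, hψ, ?_⟩, x, y, w, a * μ, hx, hw, hx', hw',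
    ?_, ?_⟩
  · change (z'.1.1.1, z'.1.1.2.1, a • z'.1.1.2.2) = _
    rw [h, coordVec_smul, Matrix.smul_vecMulVec]
  · change a • z'.1 = _
    rw [h1, e]
  · change a • z.1 = _
    rw [h2, e]

/-- The entries of the tensor are bounded on the orbit: the action of `U(1)` preserves their
absolute values. -/
theorem exists_norm_entry_le_of_mem_unitOrbit {T : Set (TotalSpace L)} (hT : IsCompact T) :
    ∃ R : ℝ, 0 ≤ R ∧ ∀ z ∈ unitOrbit s t T, ∀ i j, ‖z.1.1.2.2 i j‖ ≤ R := by
  have hcont : Continuous (coordVec s t : TotalSpace L → Coord N M → ℂ) := by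
    refine continuous_pi fun i => ?_
    rcases i with i | i
    · exact TotalSpace.continuous_value (s i)
    · exact TotalSpace.continuous_value (t i)
  obtain ⟨R, hR⟩ := (hT.image hcont).isBounded.exists_norm_le
  refine ⟨max R 0, le_max_right _ _, ?_⟩
  rintro z ⟨c, hc, z', ⟨v, hv, ψ, hb, hψ, h⟩, x, y, w, μ, hx, hw, hx', hw', h1, h2⟩ i j
  have hmat : ‖z.1.1.2.2 i j‖ = ‖z'.1.1.2.2 i j‖ := by
    rw [h1, h2]
    change ‖μ * ((Sum.elim x (c • y) : Coord N M → ℂ) i * (![c * w 0, w 1] : Fin 2 → ℂ) j)‖ =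
      ‖μ * ((Sum.elim x y : Coord N M → ℂ) i * w j)‖
    simp only [norm_mul]
    congr 2
    · rcases i with i | i
      · rfl
      · simp [hc]
    · fin_cases j
      · simp [hc]
      · rfl
  rw [hmat, h]
  change ‖coordVec s t v i * (![1, 1] : Fin 2 → ℂ) j‖ ≤ _
  have h11 : (![1, 1] : Fin 2 → ℂ) j = 1 := by fin_cases j <;> rfl
  rw [h11, mul_one]
  exact (norm_le_pi_norm _ i).trans ((hR _ (Set.mem_image_of_mem _ hv)).trans (le_max_left _ _))

theorem continuous_projectivization_mk {n E : Type} [Finite n] [TopologicalSpace E]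
    {u : E → n → ℂ} (hu : Continuous u) (h0 : ∀ e, u e ≠ 0) :
    Continuous fun e => Projectivization.mk ℂ (u e) (h0 e) := by
  have h1 : Continuous fun e => (⟨u e, h0 e⟩ : {v : n → ℂ // v ≠ 0}) := hu.subtype_mk h0
  exact (continuous_quotient_mk' (s := projectivizationSetoid ℂ (n → ℂ))).comp h1

theorem continuous_coordPoint :
    Continuous fun q : coordSet L s t => coordPoint q.1 q.2 := by
  have h : Continuous fun q : coordSet L s t => q.1 := continuous_subtype_val
  refine Continuous.subtype_mk (Continuous.subtype_mk (Continuous.prodMk ?_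
    (Continuous.prodMk ?_ ?_)) _) _
  · exact continuous_projectivization_mk h.fst fun q => q.2.1
  · exact continuous_projectivization_mk h.snd.fst fun q => q.2.2.1
  · exact h.snd.snd.smul (h.fst.matrix_vecMulVec h.snd.fst)

variable (L s t) in
/-- Homogeneous coordinates `(x, w, μ)` with `‖x‖ = ‖w‖ = 1` and `|μ| ≤ R`. -/
def normalizedCoord (R : ℝ) : Set (HomCoord N M) :=
  {q | ‖q.1‖ = 1 ∧ ‖q.2.1‖ = 1 ∧ ‖q.2.2‖ ≤ R ∧ (q.1, q.2.1) ∈ coneSet L s t}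

theorem normalizedCoord_subset (R : ℝ) : normalizedCoord L s t R ⊆ coordSet L s t :=
  fun _ hq => ⟨norm_ne_zero_iff.mp (hq.1 ▸ one_ne_zero),
    norm_ne_zero_iff.mp (hq.2.1 ▸ one_ne_zero), hq.2.2.2⟩

theorem isCompact_normalizedCoord (R : ℝ) : IsCompact (normalizedCoord L s t R) := by
  refine Metric.isCompact_of_isClosed_isBounded ?_ ?_
  · have h1 : IsClosed {q : HomCoord N M | ‖q.1‖ = 1} :=
      isClosed_eq (by fun_prop) continuous_const
    have h2 : IsClosed {q : HomCoord N M | ‖q.2.1‖ = 1} :=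
      isClosed_eq (by fun_prop) continuous_const
    have h3 : IsClosed {q : HomCoord N M | ‖q.2.2‖ ≤ R} :=
      isClosed_le (by fun_prop) continuous_const
    have h4 : IsClosed {q : HomCoord N M | (q.1, q.2.1) ∈ coneSet L s t} :=
      (isClosed_coneSet L s t).preimage (by fun_prop)
    exact h1.inter (h2.inter (h3.inter h4))
  · refine isBounded_iff_forall_norm_le.mpr ⟨max 1 R, fun q hq => ?_⟩
    exact max_le (hq.1.le.trans (le_max_left _ _))
      (max_le (hq.2.1.le.trans (le_max_left _ _)) (hq.2.2.1.trans (le_max_right _ _)))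

theorem exists_normalizedCoord {z : DeformationTotalSpace L s t} {R : ℝ}
    (hz : z.tensorNorm ≤ R) :
    ∃ q, ∃ hq : q ∈ normalizedCoord L s t R, z = coordPoint q (normalizedCoord_subset R hq) := by
  obtain ⟨q, hq, rfl⟩ := exists_coordPoint_eq z
  rw [DeformationTotalSpace.tensorNorm_coordPoint] at hz
  have ha : (‖q.1‖ : ℂ) ≠ 0 := Complex.ofReal_ne_zero.mpr (norm_ne_zero_iff.mpr hq.1)
  have hb : (‖q.2.1‖ : ℂ) ≠ 0 := Complex.ofReal_ne_zero.mpr (norm_ne_zero_iff.mpr hq.2.1)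
  have hn : ∀ {E : Type} [NormedAddCommGroup E] [NormedSpace ℂ E] {x : E}, x ≠ 0 →
      ‖(‖x‖ : ℂ)⁻¹ • x‖ = 1 := fun {E} _ _ {x} hx => by
    rw [norm_smul, norm_inv, Complex.norm_real, norm_norm,
      inv_mul_cancel₀ (norm_ne_zero_iff.mpr hx)]
  have hq' : ((‖q.1‖ : ℂ)⁻¹ • q.1, (‖q.2.1‖ : ℂ)⁻¹ • q.2.1, q.2.2 * ‖q.1‖ * ‖q.2.1‖) ∈
      normalizedCoord L s t R :=
    ⟨hn hq.1, hn hq.2.1, by simpa using hz, smul_mem_coneSet hq.2.2 _ _⟩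
  exact ⟨_, hq', coordPoint_congr hq _ (inv_ne_zero ha) (inv_ne_zero hb) rfl rfl (by field_simp)⟩

/-- The holomorphically convex hull of a bounded set is compact.  It is bounded since the entries
of the tensor are holomorphic, hence the image of a closed set of normalized homogeneous
coordinates. -/
theorem isCompact_functionHull_holomorphic {K : Set (DeformationTotalSpace L s t)} {R : ℝ}
    (hR : 0 ≤ R) (hK : ∀ z ∈ K, ∀ i j, ‖z.1.1.2.2 i j‖ ≤ R) :
    IsCompact (functionHull (DeformationTotalSpace.holomorphic L s t) K) := by
  set 𝓞 := DeformationTotalSpace.holomorphic L s t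
  set A := normalizedCoord L s t R
  have hA : IsCompact A := isCompact_normalizedCoord R
  let B : Set (HomCoord N M) :=
    {q | q ∈ A ∧ ∀ f ∈ 𝓞, ∀ C : ℝ, (∀ k ∈ K, ‖f k‖ ≤ C) → ‖coordLift f q‖ ≤ C}
  have hB : IsCompact B := by
    have : B = A ∩ ⋂ f ∈ 𝓞, ⋂ C : ℝ, ⋂ _ : ∀ k ∈ K, ‖f k‖ ≤ C,
        A ∩ (fun q => ‖coordLift f q‖) ⁻¹' Set.Iic C := by
      ext q
      simp only [B, Set.mem_ofPred_eq, Set.mem_inter_iff, Set.mem_iInter, Set.mem_preimage,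
        Set.mem_Iic]
      exact ⟨fun h => ⟨h.1, fun f hf C hC => ⟨h.1, h.2 f hf C hC⟩⟩,
        fun h => ⟨h.1, fun f hf C hC => (h.2 f hf C hC).2⟩⟩
    rw [this]
    refine hA.inter_right (isClosed_biInter fun f hf => isClosed_iInter fun C =>
      isClosed_iInter fun _ => ?_)
    exact (((mem_holomorphic_iff.mp hf).continuousOn.mono
      (normalizedCoord_subset R)).norm).preimage_isClosed_of_isClosed hA.isClosed isClosed_Iic
  have hBc : ∀ q : B, q.1 ∈ coordSet L s t := fun q => normalizedCoord_subset R q.2.1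
  have himage : functionHull 𝓞 K = Set.range fun q : B => coordPoint q.1 (hBc q) := by
    ext z
    constructor
    · intro hz
      have hz' : z.tensorNorm ≤ R := (pi_norm_le_iff_of_nonneg hR).mpr fun p =>
        hz _ (DeformationTotalSpace.entry_mem_holomorphic p.1 p.2) R fun k hk => hK k hk _ _
      obtain ⟨q, hq, rfl⟩ := exists_normalizedCoord hz'
      refine ⟨⟨q, hq, fun f hf C hC => ?_⟩, rfl⟩
      rw [coordLift_of_mem f (normalizedCoord_subset R hq)]
      exact hz f hf C hC
    · rintro ⟨q, rfl⟩ f hf C hC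
      rw [← coordLift_of_mem f (hBc q)]
      exact q.2.2 f hf C hC
  have := isCompact_iff_compactSpace.mp hB
  rw [himage]
  refine isCompact_range (continuous_coordPoint.comp (?_ : Continuous fun q : B =>
    (⟨q.1, hBc q⟩ : coordSet L s t)))
  exact continuous_subtype_val.subtype_mk _

theorem isAnalyticTube_deformedTube {T : Set (TotalSpace L)} (hT : IsAnalyticTube T) :
    IsAnalyticTube (deformedTube s t T) := by
  set K := Set.range (fun z : DeformationTotalSpace L s t => (0 : ℂ) • z) ∪ unitOrbit s t T
  have hsmul : ∀ c : ℂ, ‖c‖ ≤ 1 → ∀ z ∈ K, c • z ∈ K := by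
    rintro c hc z (⟨z, rfl⟩ | hz)
    · refine Or.inl ⟨z, Subtype.ext (Subtype.ext (Prod.ext rfl (Prod.ext rfl ?_)))⟩
      change (0 : ℂ) • z.1.1.2.2 = c • (0 : ℂ) • z.1.1.2.2
      rw [zero_smul, smul_zero]
    · exact Or.inr (smul_mem_unitOrbit hT.smul_mem hc hz)
  have hstar : ∀ z ∈ K, star z ∈ K := by
    rintro z (⟨z, rfl⟩ | hz)
    · refine Or.inl ⟨star z, Subtype.ext (Subtype.ext (Prod.ext rfl (Prod.ext rfl ?_)))⟩
      ext i j
      change (0 : ℂ) * conj (z.1.1.2.2 i j) = conj ((0 : ℂ) * z.1.1.2.2 i j)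
      rw [map_mul, map_zero]
    · exact Or.inr (star_mem_unitOrbit hT.star_mem hz)
  refine ⟨?_, fun z f _ C hC => hC _ (Or.inl ⟨z, rfl⟩), fun c hc z hz f hf C hC => ?_,
    fun z hz f hf C hC => ?_⟩
  · obtain ⟨R, hR, hbd⟩ := exists_norm_entry_le_of_mem_unitOrbit (s := s) (t := t) hT.isCompact
    refine isCompact_functionHull_holomorphic hR ?_
    rintro z (⟨z, rfl⟩ | hz) i j
    · change ‖(0 : ℂ) * z.1.1.2.2 i j‖ ≤ R
      rwa [zero_mul, norm_zero]
    · exact hbd z hz i j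
  · exact hz _ (DeformationTotalSpace.comp_smul_mem_holomorphic hf c) C
      fun k hk => hC _ (hsmul c hc k hk)
  · have := hz _ (DeformationTotalSpace.conj_comp_star_mem_holomorphic hf) C fun k hk => by
      rw [RCLike.norm_conj]
      exact hC _ (hstar k hk)
    rwa [RCLike.norm_conj] at this

end Tube

end

theorem mainTheorem4 {X : Scheme.{0}} (L : X.Modules)
    {N : ℕ} (s : Fin (N + 1) → Γ(L, ⊤)) (i : X ⟶ projSpace N) (hi : IsClosedImmersion i)
    (his : IsInducedBy i L s)
    {Y : Scheme.{0}} (j : Y ⟶ X) (hj : IsClosedImmersion j)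
    {M : ℕ} (t : Fin M → Γ(L, ⊤)) (hY : IsHyperplaneSection j L t)
    (T : Set (TotalSpace L)) (hT : IsAnalyticTube T) (hsemi : IsSemipositive T)
    (hdef : IsUniformlyDefinite T) :
    IsAnalyticTube (deformedTube s t T) ∧
    IsUniformlyDefinite (deformedTube s t T) ∧
    ∃ W : Set (DeformationTotalSpace L s t), IsOpen W ∧ (∀ z, (0 : ℂ) • z ∈ W) ∧
      W ⊆ functionHull (DeformationTotalSpace.holomorphic L s t) (unitOrbit s t T) := by
  choose f g hc using exists_isCoordChart hi his t
  have hU : ∀ x, ∃ k, x ∈ i ⁻¹ᵁ coordOpen k := exists_mem_chart i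
  obtain ⟨δ, hδ, h⟩ := exists_mem_functionHull_unitOrbit hU hc hT hdef
  refine ⟨isAnalyticTube_deformedTube hT,
    isUniformlyDefinite_of_tensorNorm_lt hδ fun z hz =>
      functionHull_mono _ Set.subset_union_right (h z hz),
    {z | z.tensorNorm < δ},
    isOpen_lt DeformationTotalSpace.continuous_tensorNorm continuous_const, fun z => ?_, h⟩
  change DeformationTotalSpace.tensorNorm _ < δ
  rwa [DeformationTotalSpace.tensorNorm_smul, norm_zero, zero_mul]
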